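/- Let $G$ be a directed graph on $n\ge 1$ vertices (an undirected graph is the symmetric case) whose edges $(i,j)$ carry real weights $w(i,j)\in[1,M]$, where $M\ge 1$; let $k\ge 2$, $k'=k-1$ and $\varepsilon>0$. A $k$-path is a simple path visiting exactly $k$ vertices, its weight is the sum of its edge weights, and $OPT$ denotes a $k$-path of minimum weight, if there is a $k$-path. Write $\ell(M)=\max(1,\log\log M)$ (and $\ell(M)=1$ where $\log\log M$ is undefined). Let $\mathcal B$ be a subroutine that takes nonnegative integer edge weights $w'$ and a real bound $B$ and returns a path or nothing. Call $\mathcal B$ exact if it always returns a $k$-path of minimum $w'$-weight when there is a $k$-path of $w'$-weight at most $B$, and returns nothing otherwise. Consider the following algorithm. Start with $L=k'$, $U=k'M$. While $U>2L$: put $X=\sqrt{LU}$, $\delta=(L/U)^{1/3}-\sqrt{L/U}$ and $s=\delta U/k'$, call $\mathcal B$ with the weights $\lfloor w(i,j)/s\rfloor$ and the bound $X/s$, and set $U\gets X+\delta U$ if a path was returned, $L\gets X$ otherwise. After the loop, with $s=\varepsilon L/k'$, return the answer of $\mathcal B$ on the weights $\lfloor w(i,j)/s\rfloor$ and the bound $U/s$.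 Let $L_i,U_i$ be the values of $L,U$ after $i$ iterations. (1) There is an absolute constant $C$ such that, for all such inputs and every $\mathcal B$, the main loop stops after some number $t\le C\,\ell(M)$ of iterations, and $U_{i+1}/L_{i+1}\le (U_i/L_i)^{2/3}$ for all $i<t$. If $\mathcal B$ is exact, then moreover $L_i\le w(OPT)\le U_i$ for all $i\le t$ whenever a $k$-path exists, and the algorithm returns a $k$-path of weight at most $(1+\varepsilon)\,w(OPT)$ if a $k$-path exists, and nothing otherwise. (2) Let $\omega$ be the matrix multiplication exponent (over any field), that is, the infimum of the $\tau$ for which the tensor of $n\times n$ matrix multiplication has rank $O(n^\tau)$. For every $c\in\mathbb N$ there are a randomized program and constants $C\in\mathbb R$, $a,d\in\mathbb N$ such that on every input $(G,w,k,M,\varepsilon)$ as above, for all outcomes of its random bits, the program halts within time $$C\,F\,\log^d(2+F),\qquad F=2^k\,k^a\,n^{\omega}\,\bigl(\ell(M)+1/\varepsilon\bigr),$$ that is, in time $\tilde O(2^k\,\mathrm{poly}(k)\,n^\omega(\log\log M+1/\varepsilon))$, and with probability at least $1-n^{-c}$ its output is an output of the above algorithm with some exact subroutine $\mathcal B$,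 and so is a $k$-path of weight at most $(1+\varepsilon)\,w(OPT)$ if a $k$-path exists, and reports that there is none otherwise. The programs are those of a random access machine with natural-number and real registers and arrays and fair random bits, whose only constants are natural numbers; natural-number operations and memory accesses are charged by the bit lengths of the operands (products and divisions by the product of the bit lengths), and the real operations $+,-,\cdot,/,\sqrt{\ },\sqrt[3]{\ }$ and $<$ cost one unit each; there is no rounding of reals to integers. -/

import Mathlib

namespace KPath

noncomputable section

/-! ## Paths in weighted directed graphs

An undirected graph is a digraph with a symmetric adjacency relation. -/

/-- `P` is a simple path of `G` visiting exactly `k` vertices. -/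
def IsKPath {V : Type*} (G : Digraph V) (k : ℕ) (P : List V) : Prop :=
  P.length = k ∧ P.Nodup ∧ P.IsChain G.Adj

/-- The sum of the weights of the edges between consecutive vertices of `P`. -/
def pathWeight {V R : Type*} [AddCommMonoid R] (w : V → V → R) (P : List V) : R :=
  (List.zipWith w P P.tail).sum

/-- `P` is a minimum-weight `k`-path. -/
def IsMinKPath {V : Type*} (G : Digraph V) (w : V → V → ℝ) (k : ℕ) (P : List V) : Prop :=
  IsKPath G k P ∧ ∀ Q, IsKPath G k Q → pathWeight w P ≤ pathWeight w Q

/-- A correct answer to the `(1+ε)`-approximate minimum-weight `k`-path problem: a `k`-path of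
weight at most `1 + ε` times that of every `k`-path, or `none` if there is no `k`-path. -/
def IsApproxAnswer {V : Type*} (G : Digraph V) (w : V → V → ℝ) (k : ℕ) (ε : ℝ) :
    Option (List V) → Prop
  | none => ∀ Q, ¬ IsKPath G k Q
  | some P => IsKPath G k P ∧ ∀ Q, IsKPath G k Q → pathWeight w P ≤ (1 + ε) * pathWeight w Q

/-! ## The scaling algorithm, relative to a subroutine for the bounded integer problem -/

/-- A correct answer to the minimum-weight `k`-path problem of weight at most `B` with
nonnegative integer weights `w'`. -/
def IsBoundedAnswer {V : Type*} (G : Digraph V) (k : ℕ) (w' : V → V → ℕ) (B : ℝ) :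
    Option (List V) → Prop
  | none => ∀ Q, IsKPath G k Q → B < ((pathWeight w' Q : ℕ) : ℝ)
  | some P => IsKPath G k P ∧ ((pathWeight w' P : ℕ) : ℝ) ≤ B ∧
      ∀ Q, IsKPath G k Q → pathWeight w' P ≤ pathWeight w' Q

/-- A subroutine receives integer weights and a bound, and returns a path or nothing
(the graph and `k` are fixed). -/
abbrev Subroutine (V : Type*) := (V → V → ℕ) → ℝ → Option (List V)

/-- The subroutine always answers correctly. -/
def Subroutine.Exact {V : Type*} (𝓑 : Subroutine V) (G : Digraph V) (k : ℕ) : Prop :=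
  ∀ w' B, IsBoundedAnswer G k w' B (𝓑 w' B)

/-- The rounded-down weights `⌊w(i,j) / s⌋`. -/
def scaled {V : Type*} (w : V → V → ℝ) (s : ℝ) (i j : V) : ℕ := ⌊w i j / s⌋₊

/-- The lower and the upper bound maintained by the algorithm. -/
structure Bounds where
  L : ℝ
  U : ℝ

/-- The geometric mean of the two bounds. -/
def Bounds.X (b : Bounds) : ℝ := Real.sqrt (b.L * b.U)

/-- The scaling coefficient. -/
def Bounds.δ (b : Bounds) : ℝ := (b.L / b.U) ^ (1 / 3 : ℝ) - Real.sqrt (b.L / b.U)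

/-- One iteration of the main loop. -/
def loopStep {V : Type*} (𝓑 : Subroutine V) (w : V → V → ℝ) (k : ℕ) (b : Bounds) : Bounds :=
  let s : ℝ := b.δ * b.U / ((k : ℝ) - 1)
  if (𝓑 (scaled w s) (b.X / s)).isSome then ⟨b.L, b.X + b.δ * b.U⟩ else ⟨b.X, b.U⟩

/-- The bounds after `i` iterations, starting from `L = k - 1` and `U = (k - 1) M`. -/
def bounds {V : Type*} (𝓑 : Subroutine V) (w : V → V → ℝ) (k : ℕ) (M : ℝ) : ℕ → Bounds
  | 0 => ⟨(k : ℝ) - 1, ((k : ℝ) - 1) * M⟩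
  | i + 1 => loopStep 𝓑 w k (bounds 𝓑 w k M i)

/-- The main loop, which continues while `U > 2 L`, performs exactly `t` iterations. -/
def LoopRuns {V : Type*} (𝓑 : Subroutine V) (w : V → V → ℝ) (k : ℕ) (M : ℝ) (t : ℕ) : Prop :=
  (∀ i < t, 2 * (bounds 𝓑 w k M i).L < (bounds 𝓑 w k M i).U) ∧
    (bounds 𝓑 w k M t).U ≤ 2 * (bounds 𝓑 w k M t).L

/-- The answer given after `t` iterations: that of the subroutine on the weights scaled by
`ε L / (k - 1)`, with the bound `U / (ε L / (k - 1))`. -/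
def finalAnswer {V : Type*} (𝓑 : Subroutine V) (w : V → V → ℝ) (k : ℕ) (M ε : ℝ) (t : ℕ) :
    Option (List V) :=
  let b := bounds 𝓑 w k M t
  let s : ℝ := ε * b.L / ((k : ℝ) - 1)
  𝓑 (scaled w s) (b.U / s)

/-- The algorithm with the subroutine `𝓑` stops and returns `out`. -/
def Returns {V : Type*} (𝓑 : Subroutine V) (w : V → V → ℝ) (k : ℕ) (M ε : ℝ)
    (out : Option (List V)) : Prop :=
  ∃ t, LoopRuns 𝓑 w k M t ∧ out = finalAnswer 𝓑 w k M ε t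

/-! ## The matrix multiplication exponent -/

/-- The product of `n × n` matrices over `K` has a bilinear algorithm with `r` multiplications,
that is, the matrix multiplication tensor has rank at most `r`. -/
def MatMulRankLE (K : Type*) [Field K] (n r : ℕ) : Prop :=
  ∃ (f g : Fin r → (Matrix (Fin n) (Fin n) K →ₗ[K] K)) (C : Fin r → Matrix (Fin n) (Fin n) K),
    ∀ A B : Matrix (Fin n) (Fin n) K, A * B = ∑ t, (f t A * g t B) • C t

/-- The matrix multiplication exponent `ω` over `K`. -/
def matMulExponent (K : Type*) [Field K] : ℝ :=
  sInf {τ : ℝ | ∃ c : ℝ, ∀ n : ℕ, 1 ≤ n → ∃ r : ℕ, MatMulRankLE K n r ∧ (r : ℝ) ≤ c * (n : ℝ) ^ τ}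

/-! ## A randomized real RAM

Programs are finite and use natural-number and real registers and random-access arrays of both
types. Natural-number operations are charged by the bit lengths of their operands. The real
operations are `+`, `-`, `*`, `/`, square root, cube root and comparison, at unit cost; there is no
rounding operation from reals to integers, and the only constants are natural numbers. -/

/-- The memory; `coins` counts the random bits consumed. -/
structure Store where
  nvar : ℕ → ℕ
  rvar : ℕ → ℝ
  narr : ℕ → ℕ → ℕ
  rarr : ℕ → ℕ → ℝ
  coins : ℕ

/-- Natural-number expressions; `get a e` is entry `e` of array `a`. -/
inductive NExp where
  | const (c : ℕ)
  | var (x : ℕ)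
  | get (a : ℕ) (e : NExp)
  | add (e f : NExp)
  | sub (e f : NExp)
  | mul (e f : NExp)
  | div (e f : NExp)
  | mod (e f : NExp)

def NExp.eval (s : Store) : NExp → ℕ
  | const c => c
  | var x => s.nvar x
  | get a e => s.narr a (e.eval s)
  | add e f => e.eval s + f.eval s
  | sub e f => e.eval s - f.eval s
  | mul e f => e.eval s * f.eval s
  | div e f => e.eval s / f.eval s
  | mod e f => e.eval s % f.eval s

/-- The cost of evaluation: linear in the bit lengths of the operands for a memory access, a sum
or a difference, and the product of the bit lengths for a product or a division. -/
def NExp.cost (s : Store) : NExp → ℕ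
  | const c => 1 + c.size
  | var x => 1 + (s.nvar x).size
  | get a e => e.cost s + (1 + (e.eval s).size + (s.narr a (e.eval s)).size)
  | add e f => e.cost s + f.cost s + (1 + (e.eval s).size + (f.eval s).size)
  | sub e f => e.cost s + f.cost s + (1 + (e.eval s).size + (f.eval s).size)
  | mul e f => e.cost s + f.cost s + (1 + (e.eval s).size) * (1 + (f.eval s).size)
  | div e f => e.cost s + f.cost s + (1 + (e.eval s).size) * (1 + (f.eval s).size)
  | mod e f => e.cost s + f.cost s + (1 + (e.eval s).size) * (1 + (f.eval s).size)

/-- Real expressions. -/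
inductive RExp where
  | ofNat (e : NExp)
  | var (x : ℕ)
  | get (a : ℕ) (e : NExp)
  | add (e f : RExp)
  | sub (e f : RExp)
  | mul (e f : RExp)
  | div (e f : RExp)
  | sqrt (e : RExp)
  | cbrt (e : RExp)

/-- Division by zero and roots of negative numbers give `0`. -/
def RExp.eval (s : Store) : RExp → ℝ
  | ofNat e => (e.eval s : ℝ)
  | var x => s.rvar x
  | get a e => s.rarr a (e.eval s)
  | add e f => e.eval s + f.eval s
  | sub e f => e.eval s - f.eval s
  | mul e f => e.eval s * f.eval s
  | div e f => e.eval s / f.eval s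
  | sqrt e => Real.sqrt (e.eval s)
  | cbrt e => (max (e.eval s) 0) ^ (1 / 3 : ℝ)

def RExp.cost (s : Store) : RExp → ℕ
  | ofNat e => e.cost s + (1 + (e.eval s).size)
  | var _ => 1
  | get _ e => e.cost s + (1 + (e.eval s).size)
  | add e f => e.cost s + f.cost s + 1
  | sub e f => e.cost s + f.cost s + 1
  | mul e f => e.cost s + f.cost s + 1
  | div e f => e.cost s + f.cost s + 1
  | sqrt e => e.cost s + 1
  | cbrt e => e.cost s + 1

/-- Tests. -/
inductive Test where
  | nlt (e f : NExp)
  | neq (e f : NExp)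
  | rlt (e f : RExp)
  | not (b : Test)
  | and (b c : Test)

/-- The test `neq` is for equality of natural numbers. -/
def Test.Holds (s : Store) : Test → Prop
  | nlt e f => e.eval s < f.eval s
  | neq e f => e.eval s = f.eval s
  | rlt e f => e.eval s < f.eval s
  | not b => ¬ b.Holds s
  | and b c => b.Holds s ∧ c.Holds s

def Test.cost (s : Store) : Test → ℕ
  | nlt e f => e.cost s + f.cost s + (1 + (e.eval s).size + (f.eval s).size)
  | neq e f => e.cost s + f.cost s + (1 + (e.eval s).size + (f.eval s).size)
  | rlt e f => e.cost s + f.cost s + 1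
  | not b => b.cost s + 1
  | and b c => b.cost s + c.cost s + 1

/-- Programs; `flip x` stores a fresh random bit in the natural-number register `x`. -/
inductive Prog where
  | skip
  | nset (x : ℕ) (e : NExp)
  | rset (x : ℕ) (e : RExp)
  | nput (a : ℕ) (i e : NExp)
  | rput (a : ℕ) (i : NExp) (e : RExp)
  | flip (x : ℕ)
  | seq (p q : Prog)
  | ite (b : Test) (p q : Prog)
  | loop (b : Test) (p : Prog)

/-- Storing a value in a register or in an array entry. -/
def Store.setN (s : Store) (x v : ℕ) : Store := { s with nvar := Function.update s.nvar x v }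

def Store.setR (s : Store) (x : ℕ) (v : ℝ) : Store :=
  { s with rvar := Function.update s.rvar x v }

def Store.putN (s : Store) (a i v : ℕ) : Store :=
  { s with narr := Function.update s.narr a (Function.update (s.narr a) i v) }

def Store.putR (s : Store) (a i : ℕ) (v : ℝ) : Store :=
  { s with rarr := Function.update s.rarr a (Function.update (s.rarr a) i v) }

/-- Storing the next random bit of `ρ` in a register. -/
def Store.flip (s : Store) (ρ : ℕ → Bool) (x : ℕ) : Store :=
  { s.setN x (if ρ s.coins then 1 else 0) with coins := s.coins + 1 }

/-- `Exec ρ p s s' t`: with the random bits `ρ`, the program `p` started in `s` halts in `s'`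
after time `t`. The program `loop b p` repeats `p` while `b` holds. -/
inductive Exec (ρ : ℕ → Bool) : Prog → Store → Store → ℕ → Prop
  | skip (s) : Exec ρ .skip s s 1
  | nset (x e s) : Exec ρ (.nset x e) s (s.setN x (e.eval s)) (e.cost s + (1 + (e.eval s).size))
  | rset (x e s) : Exec ρ (.rset x e) s (s.setR x (e.eval s)) (e.cost s + 1)
  | nput (a i e s) : Exec ρ (.nput a i e) s (s.putN a (i.eval s) (e.eval s))
      (i.cost s + e.cost s + (1 + (i.eval s).size + (e.eval s).size))
  | rput (a i e s) : Exec ρ (.rput a i e) s (s.putR a (i.eval s) (e.eval s))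
      (i.cost s + e.cost s + (1 + (i.eval s).size))
  | flip (x s) : Exec ρ (.flip x) s (s.flip ρ x) 1
  | seq {p q s s₁ s₂ t₁ t₂} : Exec ρ p s s₁ t₁ → Exec ρ q s₁ s₂ t₂ →
      Exec ρ (.seq p q) s s₂ (t₁ + t₂ + 1)
  | ite_true {b p q s s' t} : b.Holds s → Exec ρ p s s' t →
      Exec ρ (.ite b p q) s s' (b.cost s + t + 1)
  | ite_false {b p q s s' t} : ¬ b.Holds s → Exec ρ q s s' t →
      Exec ρ (.ite b p q) s s' (b.cost s + t + 1)
  | loop_done {b p s} : ¬ b.Holds s → Exec ρ (.loop b p) s s (b.cost s + 1)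
  | loop_step {b p s s₁ s₂ t₁ t₂} : b.Holds s → Exec ρ p s s₁ t₁ →
      Exec ρ (.loop b p) s₁ s₂ t₂ → Exec ρ (.loop b p) s s₂ (b.cost s + t₁ + t₂ + 1)

/-- The distribution of an infinite sequence of independent fair coin flips. -/
def coinMeasure : MeasureTheory.Measure (ℕ → Bool) :=
  MeasureTheory.Measure.infinitePi fun _ : ℕ => (PMF.uniformOfFintype Bool).toMeasure

open scoped Classical in
/-- The initial memory: registers hold `n`, `k` and `M`, `ε`; array `0` of each type holds the
adjacency matrix and the weight matrix, entry `(i, j)` at index `n * i + j`; the rest is `0`. -/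
def inputStore {n : ℕ} (G : Digraph (Fin n)) (w : Fin n → Fin n → ℝ) (k : ℕ) (M ε : ℝ) : Store where
  nvar := Function.update (Function.update (fun _ => 0) 0 n) 1 k
  rvar := Function.update (Function.update (fun _ => 0) 0 M) 1 ε
  narr := Function.update (fun _ _ => 0) 0 fun a =>
    if h : a < n * n then
      if G.Adj (finProdFinEquiv.symm ⟨a, h⟩).1 (finProdFinEquiv.symm ⟨a, h⟩).2 then 1 else 0
    else 0
  rarr := Function.update (fun _ _ => 0) 0 fun a =>
    if h : a < n * n then w (finProdFinEquiv.symm ⟨a, h⟩).1 (finProdFinEquiv.symm ⟨a, h⟩).2 else 0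
  coins := 0

/-- `s` displays the answer `out`: register `0` tells whether there is a path, and if so, its `k`
vertices stand in array `1`. -/
def Displays {n : ℕ} (s : Store) (k : ℕ) : Option (List (Fin n)) → Prop
  | none => s.nvar 0 = 0
  | some P => s.nvar 0 = 1 ∧ P.map Fin.val = (List.range k).map (s.narr 1)

/-- An instance of the problem: weights of edges in `[1, M]`, a parameter `k` of at least `2`
(so that a path has an edge), and a positive accuracy `ε`. -/
def IsInstance {n : ℕ} (G : Digraph (Fin n)) (w : Fin n → Fin n → ℝ) (k : ℕ) (M ε : ℝ) : Prop :=
  1 ≤ n ∧ 2 ≤ k ∧ 1 ≤ M ∧ 0 < ε ∧ ∀ i j, G.Adj i j → 1 ≤ w i j ∧ w i j ≤ M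

/-- `log log M`, replaced by `1` where it is smaller or undefined. -/
def logLog (M : ℝ) : ℝ := max 1 (Real.log (Real.log M))

end

end KPath

/-!
The bounds `L` and `U` are controlled by their ratio. In one iteration `r = L / U` becomes
`r ^ (2 / 3)` if a path is found, since `X + δ U = r ^ (1 / 3) U`, and `r ^ (1 / 2)` otherwise
(`loopStep_spec`). So `U / L ≤ M ^ ((2 / 3) ^ i)` after `i` iterations, and this is at most `2`
after `O(log log M)` of them (`exists_iterations_bound`). Rounding down changes the weight of a
`k`-path by at most `(k - 1) s`, that is, by `δ U` in the loop and by `ε L` in the last call, which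
gives `L ≤ w(OPT) ≤ U` (`bounds_contain_opt`) and the approximation ratio
(`finalAnswer_isApproxAnswer`). The bounds passed to the subroutine are `O(k)` in the loop and
`O(k / ε)` in the last call.

The program solves the bounded integer problem with the exterior algebra of `ℝᵏ`. Give every vertex
`v` a vector `y v` of `ℝᵏ` and a scalar `x v i` for each position `i` of a path. A walk
`v₀, …, v_{k-1}` contributes the product of the scalars `x vᵢ i` times the wedge product of the
vectors `y vᵢ`, which vanishes if the walk repeats a vertex. Hence, if the top coefficient `topSum`
of the sum over the walks of weight `d` is nonzero, there is a `k`-path of weight `d`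
(`exists_path_of_topSum_ne_zero`): whatever the random bits are, the program returns only genuine
paths. As `topSum` is linear in the scalars of one position, a path is extracted by binary search
for its vertices, position by position (`extractProg_spec`), with no further randomness. Conversely,
`topSum` is a polynomial of degree at most `2k` in each of the `2nk` coordinates of `x` and `y`, and
is nonzero at the indicators of a `k`-path of weight `d` (`topSum_indicator_ne_zero`). Replacing the
coordinates of this point by random ones, one at a time, shows that it vanishes with probability at
most `2nk · 2k / 2ᵇ` at a point whose coordinates are drawn from `{0, …, 2ᵇ - 1}`
(`coinMeasure_root_le`).

One point serves for all calls of the subroutine. With an exact subroutine, the weights of the calls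
do not depend on the random bits, so a union bound over these calls applies; if the point detects
the paths of minimum weight in all of them, the program takes the same branches as the algorithm
with an exact subroutine (`isExactOutput_of_detects`).

A table of the sums over walks takes `O(n ^ 2 k)` operations for every set of basis vectors, weight
and position (`evalProg_spec`). This suffices for the time bound because `ω ≥ 2`: the matrices that
occur in a bilinear algorithm for the products `A * 1` span all matrices, so the rank is at least
`n ^ 2` (`two_le_matMulExponent`). All natural numbers in the memory have `O(log (2 + F))` bits, and the
rules for `Runs` bound the time of a program by the number of its steps times the square of the
number of bits. Integer parts are found by counting up, which is affordable because weights above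
the bound of the subroutine are cut off (`roundProg`).
-/

namespace KPath

/-! ### Reasoning about programs of the random access machine -/

/-- All natural numbers in the memory are below `2 ^ β`. -/
def Store.Bdd (s : Store) (β : ℕ) : Prop :=
  (∀ x, s.nvar x < 2 ^ β) ∧ ∀ a i, s.narr a i < 2 ^ β

section StoreSimp

variable (s : Store) (x y v a i j b : ℕ) (r : ℝ) (ρ : ℕ → Bool)

@[simp] lemma Store.setN_nvar : (s.setN x v).nvar y = if y = x then v else s.nvar y := by
  simp [Store.setN, Function.update_apply]
@[simp] lemma Store.setN_rvar : (s.setN x v).rvar = s.rvar := rfl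
@[simp] lemma Store.setN_narr : (s.setN x v).narr = s.narr := rfl
@[simp] lemma Store.setN_rarr : (s.setN x v).rarr = s.rarr := rfl
@[simp] lemma Store.setN_coins : (s.setN x v).coins = s.coins := rfl
@[simp] lemma Store.setR_rvar : (s.setR x r).rvar y = if y = x then r else s.rvar y := by
  simp [Store.setR, Function.update_apply]
@[simp] lemma Store.setR_nvar : (s.setR x r).nvar = s.nvar := rfl
@[simp] lemma Store.setR_narr : (s.setR x r).narr = s.narr := rfl
@[simp] lemma Store.setR_rarr : (s.setR x r).rarr = s.rarr := rfl
@[simp] lemma Store.setR_coins : (s.setR x r).coins = s.coins := rfl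
@[simp] lemma Store.putN_narr :
    (s.putN a i v).narr b j = if b = a ∧ j = i then v else s.narr b j := by
  by_cases h : b = a
  · subst h; simp [Store.putN, Function.update_apply]
  · simp [Store.putN, h]
@[simp] lemma Store.putN_nvar : (s.putN a i v).nvar = s.nvar := rfl
@[simp] lemma Store.putN_rvar : (s.putN a i v).rvar = s.rvar := rfl
@[simp] lemma Store.putN_rarr : (s.putN a i v).rarr = s.rarr := rfl
@[simp] lemma Store.putN_coins : (s.putN a i v).coins = s.coins := rfl
@[simp] lemma Store.putR_rarr :
    (s.putR a i r).rarr b j = if b = a ∧ j = i then r else s.rarr b j := by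
  by_cases h : b = a
  · subst h; simp [Store.putR, Function.update_apply]
  · simp [Store.putR, h]
@[simp] lemma Store.putR_nvar : (s.putR a i r).nvar = s.nvar := rfl
@[simp] lemma Store.putR_rvar : (s.putR a i r).rvar = s.rvar := rfl
@[simp] lemma Store.putR_narr : (s.putR a i r).narr = s.narr := rfl
@[simp] lemma Store.putR_coins : (s.putR a i r).coins = s.coins := rfl
@[simp] lemma Store.flip_nvar :
    (s.flip ρ x).nvar y = if y = x then (if ρ s.coins then 1 else 0) else s.nvar y := by
  simp [Store.flip, Store.setN, Function.update_apply]
@[simp] lemma Store.flip_coins : (s.flip ρ x).coins = s.coins + 1 := rfl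

variable {s} {β : ℕ}

lemma Store.Bdd.setN (h : s.Bdd β) {v : ℕ} (hv : v < 2 ^ β) (x : ℕ) : (s.setN x v).Bdd β :=
  ⟨fun y => by rw [Store.setN_nvar]; split_ifs; exacts [hv, h.1 y], h.2⟩

lemma Store.Bdd.putN (h : s.Bdd β) {v : ℕ} (hv : v < 2 ^ β) (a i : ℕ) : (s.putN a i v).Bdd β :=
  ⟨h.1, fun b j => by rw [Store.putN_narr]; split_ifs; exacts [hv, h.2 b j]⟩

lemma Store.Bdd.flip (h : s.Bdd β) (hβ : 1 ≤ β) (ρ : ℕ → Bool) (x : ℕ) : (s.flip ρ x).Bdd β := by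
  refine ⟨fun y => ?_, h.2⟩
  have h2 : 2 ^ 1 ≤ 2 ^ β := Nat.pow_le_pow_right (by norm_num) hβ
  have := h.1 y
  rw [Store.flip_nvar]
  split_ifs <;> omega

end StoreSimp

/-! The evaluation of a fixed expression costs `O(β ^ 2)` if all numbers in memory have `β` bits. -/

lemma size_add_le (a b : ℕ) : (a + b).size ≤ a.size + b.size + 1 := by
  rw [Nat.size_le]
  have ha := Nat.lt_size_self a
  have hb := Nat.lt_size_self b
  have h1 : 2 ^ a.size ≤ 2 ^ (a.size + b.size) := Nat.pow_le_pow_right (by norm_num) (by omega)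
  have h2 : 2 ^ b.size ≤ 2 ^ (a.size + b.size) := Nat.pow_le_pow_right (by norm_num) (by omega)
  rw [pow_succ]
  omega

lemma size_mul_le (a b : ℕ) : (a * b).size ≤ a.size + b.size := by
  rw [Nat.size_le, pow_add]
  exact Nat.mul_lt_mul'' (Nat.lt_size_self a) (Nat.lt_size_self b)

lemma NExp.exists_bound (e : NExp) : ∃ C, ∀ β s, 1 ≤ β → Store.Bdd s β →
    (e.eval s).size ≤ C * β ∧ e.cost s ≤ C * β ^ 2 := by
  -- all binary operations increase the bit length at most additively
  have bin : ∀ (C D β a b ca cb : ℕ), 1 ≤ β → a ≤ C * β → b ≤ D * β → ca ≤ C * β ^ 2 →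
      cb ≤ D * β ^ 2 → a + b + 1 ≤ (C + D + (1 + C) * (1 + D)) * β ∧
      ca + cb + (1 + a + b) ≤ (C + D + (1 + C) * (1 + D)) * β ^ 2 ∧
      ca + cb + (1 + a) * (1 + b) ≤ (C + D + (1 + C) * (1 + D)) * β ^ 2 := by
    intro C D β a b ca cb hβ ha hb hca hcb
    have h1 : 1 + a ≤ (1 + C) * β := by nlinarith
    have h2 : 1 + b ≤ (1 + D) * β := by nlinarith
    have h3 : (1 + a) * (1 + b) ≤ ((1 + C) * β) * ((1 + D) * β) := Nat.mul_le_mul h1 h2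
    have h4 : 1 + a + b ≤ (1 + a) * (1 + b) := by nlinarith [Nat.zero_le (a * b)]
    refine ⟨?_, ?_, ?_⟩
    · nlinarith [Nat.zero_le (C * D * β)]
    · nlinarith
    · nlinarith
  induction e with
  | const c =>
    refine ⟨1 + c.size, fun β s hβ _ => ⟨?_, ?_⟩⟩
    · simp only [NExp.eval]; nlinarith
    · simp only [NExp.cost]; nlinarith [Nat.one_le_pow 2 β hβ]
  | var x =>
    refine ⟨2, fun β s hβ hs => ?_⟩
    have := Nat.size_le.2 (hs.1 x)
    simp only [NExp.eval, NExp.cost]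
    constructor <;> nlinarith
  | get a e ih =>
    obtain ⟨C, hC⟩ := ih
    refine ⟨2 * C + 2, fun β s hβ hs => ?_⟩
    obtain ⟨h1, h2⟩ := hC β s hβ hs
    have := Nat.size_le.2 (hs.2 a (e.eval s))
    simp only [NExp.eval, NExp.cost]
    have h3 : β ≤ β ^ 2 := by nlinarith
    have h4 : C * β ≤ C * β ^ 2 := Nat.mul_le_mul_left _ h3
    constructor <;> nlinarith
  | add e f ihe ihf =>
    obtain ⟨C, hC⟩ := ihe
    obtain ⟨D, hD⟩ := ihf
    refine ⟨C + D + (1 + C) * (1 + D), fun β s hβ hs => ?_⟩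
    obtain ⟨h1, h2⟩ := hC β s hβ hs
    obtain ⟨h3, h4⟩ := hD β s hβ hs
    obtain ⟨b1, b2, b3⟩ := bin _ _ _ _ _ _ _ hβ h1 h3 h2 h4
    exact ⟨(size_add_le _ _).trans b1, b2⟩
  | sub e f ihe ihf =>
    obtain ⟨C, hC⟩ := ihe
    obtain ⟨D, hD⟩ := ihf
    refine ⟨C + D + (1 + C) * (1 + D), fun β s hβ hs => ?_⟩
    obtain ⟨h1, h2⟩ := hC β s hβ hs
    obtain ⟨h3, h4⟩ := hD β s hβ hs
    obtain ⟨b1, b2, b3⟩ := bin _ _ _ _ _ _ _ hβ h1 h3 h2 h4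
    have := Nat.size_le_size (Nat.sub_le (e.eval s) (f.eval s))
    exact ⟨by simp only [NExp.eval]; omega, b2⟩
  | mul e f ihe ihf =>
    obtain ⟨C, hC⟩ := ihe
    obtain ⟨D, hD⟩ := ihf
    refine ⟨C + D + (1 + C) * (1 + D), fun β s hβ hs => ?_⟩
    obtain ⟨h1, h2⟩ := hC β s hβ hs
    obtain ⟨h3, h4⟩ := hD β s hβ hs
    obtain ⟨b1, b2, b3⟩ := bin _ _ _ _ _ _ _ hβ h1 h3 h2 h4
    have := size_mul_le (e.eval s) (f.eval s)
    exact ⟨by simp only [NExp.eval]; omega, b3⟩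
  | div e f ihe ihf =>
    obtain ⟨C, hC⟩ := ihe
    obtain ⟨D, hD⟩ := ihf
    refine ⟨C + D + (1 + C) * (1 + D), fun β s hβ hs => ?_⟩
    obtain ⟨h1, h2⟩ := hC β s hβ hs
    obtain ⟨h3, h4⟩ := hD β s hβ hs
    obtain ⟨b1, b2, b3⟩ := bin _ _ _ _ _ _ _ hβ h1 h3 h2 h4
    have := Nat.size_le_size (Nat.div_le_self (e.eval s) (f.eval s))
    exact ⟨by simp only [NExp.eval]; omega, b3⟩
  | mod e f ihe ihf =>
    obtain ⟨C, hC⟩ := ihe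
    obtain ⟨D, hD⟩ := ihf
    refine ⟨C + D + (1 + C) * (1 + D), fun β s hβ hs => ?_⟩
    obtain ⟨h1, h2⟩ := hC β s hβ hs
    obtain ⟨h3, h4⟩ := hD β s hβ hs
    obtain ⟨b1, b2, b3⟩ := bin _ _ _ _ _ _ _ hβ h1 h3 h2 h4
    have := Nat.size_le_size (Nat.mod_le (e.eval s) (f.eval s))
    exact ⟨by simp only [NExp.eval]; omega, b3⟩

lemma RExp.exists_bound (e : RExp) : ∃ C, ∀ β s, 1 ≤ β → Store.Bdd s β →
    e.cost s ≤ C * β ^ 2 := by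
  induction e with
  | ofNat e =>
    obtain ⟨C, hC⟩ := e.exists_bound
    refine ⟨2 * C + 1, fun β s hβ hs => ?_⟩
    obtain ⟨h1, h2⟩ := hC β s hβ hs
    simp only [RExp.cost]
    have h3 : β ≤ β ^ 2 := by nlinarith
    have h4 : C * β ≤ C * β ^ 2 := Nat.mul_le_mul_left _ h3
    nlinarith
  | var x => exact ⟨1, fun β s hβ _ => by simp only [RExp.cost]; nlinarith⟩
  | get a e =>
    obtain ⟨C, hC⟩ := e.exists_bound
    refine ⟨2 * C + 1, fun β s hβ hs => ?_⟩
    obtain ⟨h1, h2⟩ := hC β s hβ hs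
    simp only [RExp.cost]
    have h3 : β ≤ β ^ 2 := by nlinarith
    have h4 : C * β ≤ C * β ^ 2 := Nat.mul_le_mul_left _ h3
    nlinarith
  | add e f ihe ihf | sub e f ihe ihf | mul e f ihe ihf | div e f ihe ihf =>
    obtain ⟨C, hC⟩ := ihe
    obtain ⟨D, hD⟩ := ihf
    refine ⟨C + D + 1, fun β s hβ hs => ?_⟩
    have h1 := hC β s hβ hs
    have h2 := hD β s hβ hs
    simp only [RExp.cost]
    nlinarith
  | sqrt e ih | cbrt e ih =>
    obtain ⟨C, hC⟩ := ih
    refine ⟨C + 1, fun β s hβ hs => ?_⟩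
    have h1 := hC β s hβ hs
    simp only [RExp.cost]
    nlinarith

lemma Test.exists_bound (b : Test) : ∃ C, ∀ β s, 1 ≤ β → Store.Bdd s β →
    b.cost s ≤ C * β ^ 2 := by
  induction b with
  | nlt e f | neq e f =>
    obtain ⟨C, hC⟩ := (NExp.add e f).exists_bound
    exact ⟨C, fun β s hβ hs => (hC β s hβ hs).2⟩
  | rlt e f =>
    obtain ⟨C, hC⟩ := (RExp.add e f).exists_bound
    exact ⟨C, fun β s hβ hs => hC β s hβ hs⟩
  | not b ih =>
    obtain ⟨C, hC⟩ := ih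
    refine ⟨C + 1, fun β s hβ hs => ?_⟩
    have h1 := hC β s hβ hs
    simp only [Test.cost]
    nlinarith
  | and b c ihb ihc =>
    obtain ⟨C, hC⟩ := ihb
    obtain ⟨D, hD⟩ := ihc
    refine ⟨C + D + 1, fun β s hβ hs => ?_⟩
    have h1 := hC β s hβ hs
    have h2 := hD β s hβ hs
    simp only [Test.cost]
    nlinarith

/-- The weakest precondition of a loop-free program, which includes that all numbers that are
stored stay below `2 ^ β`. -/
def wp (ρ : ℕ → Bool) (β : ℕ) : Prog → (Store → Prop) → Store → Prop
  | .skip, Q, s => Q s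
  | .nset x e, Q, s => e.eval s < 2 ^ β ∧ Q (s.setN x (e.eval s))
  | .rset x e, Q, s => Q (s.setR x (e.eval s))
  | .nput a i e, Q, s => e.eval s < 2 ^ β ∧ Q (s.putN a (i.eval s) (e.eval s))
  | .rput a i e, Q, s => Q (s.putR a (i.eval s) (e.eval s))
  | .flip x, Q, s => Q (s.flip ρ x)
  | .seq p q, Q, s => wp ρ β p (wp ρ β q Q) s
  | .ite b p q, Q, s => (b.Holds s → wp ρ β p Q s) ∧ (¬ b.Holds s → wp ρ β q Q s)
  | .loop _ _, _, _ => False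

/-- A constant `C` such that evaluating `e` costs at most `C β²` if all numbers have `β` bits. -/
noncomputable def NExp.kc (e : NExp) : ℕ := e.exists_bound.choose

/-- A constant `C` such that evaluating `e` costs at most `C β²` if all numbers have `β` bits. -/
noncomputable def RExp.kc (e : RExp) : ℕ := e.exists_bound.choose

/-- A constant `C` such that evaluating `b` costs at most `C β²` if all numbers have `β` bits. -/
noncomputable def Test.kc (b : Test) : ℕ := b.exists_bound.choose

/-- The cost of a program in units of `β²`, if the bodies of all loops are executed once. -/
noncomputable def Prog.kc : Prog → ℕ
  | .skip => 1
  | .nset _ e => 2 * e.kc + 1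
  | .rset _ e => e.kc + 1
  | .nput _ i e => 2 * i.kc + 2 * e.kc + 1
  | .rput _ i e => 2 * i.kc + e.kc + 1
  | .flip _ => 1
  | .seq p q => p.kc + q.kc + 1
  | .ite b p q => b.kc + p.kc + q.kc + 1
  | .loop b p => b.kc + p.kc + 1

/-- `Runs ρ β N p s Q`: started in `s`, the program `p` halts within time `O(N β²)`, with a constant
that depends on `p` only, in a memory that satisfies `Q` and whose natural numbers are below
`2 ^ β`. -/
def Runs (ρ : ℕ → Bool) (β N : ℕ) (p : Prog) (s : Store) (Q : Store → Prop) : Prop :=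
  1 ≤ N ∧ ∃ s' t, Exec ρ p s s' t ∧ t ≤ p.kc * N * β ^ 2 ∧ s'.Bdd β ∧ Q s'

section Rules

variable {ρ : ℕ → Bool} {β : ℕ} {s : Store} {Q : Store → Prop}

lemma Test.cost_le (b : Test) (hβ : 1 ≤ β) (hs : s.Bdd β) : b.cost s ≤ b.kc * β ^ 2 :=
  b.exists_bound.choose_spec β s hβ hs

lemma Runs.mono {p : Prog} {N N' : ℕ} {Q' : Store → Prop} (h : Runs ρ β N p s Q) (hN : N ≤ N')
    (hQ : ∀ s', s'.Bdd β → Q s' → Q' s') : Runs ρ β N' p s Q' := by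
  obtain ⟨h1, s', t, he, ht, hs', hq⟩ := h
  exact ⟨h1.trans hN, s', t, he,
    ht.trans (Nat.mul_le_mul_right _ (Nat.mul_le_mul_left _ hN)), hs', hQ s' hs' hq⟩

lemma Runs.seq {p q : Prog} {N : ℕ} {R : Store → Prop} (hβ : 1 ≤ β) (h : Runs ρ β N p s R)
    (h' : ∀ s', s'.Bdd β → R s' → Runs ρ β N q s' Q) :
    Runs ρ β N (.seq p q) s Q := by
  obtain ⟨hN, s₁, t₁, he₁, ht₁, hs₁, h₁⟩ := h
  obtain ⟨-, s₂, t₂, he₂, ht₂, hs₂, h₂⟩ := h' s₁ hs₁ h₁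
  have : 1 ≤ N * β ^ 2 := Nat.mul_pos hN (pow_pos hβ 2)
  exact ⟨hN, s₂, _, .seq he₁ he₂, by rw [Prog.kc]; nlinarith, hs₂, h₂⟩

lemma Runs.ite {b : Test} {p q : Prog} {N : ℕ} (hβ : 1 ≤ β) (hs : s.Bdd β) (hN : 1 ≤ N)
    (h : b.Holds s → Runs ρ β N p s Q) (h' : ¬ b.Holds s → Runs ρ β N q s Q) :
    Runs ρ β N (.ite b p q) s Q := by
  have hb := b.cost_le hβ hs
  have h1 : 1 ≤ N * β ^ 2 := Nat.mul_pos hN (pow_pos hβ 2)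
  have h2 : b.kc * β ^ 2 ≤ b.kc * (N * β ^ 2) :=
    Nat.mul_le_mul_left _ (Nat.le_mul_of_pos_left _ hN)
  have h3 := Nat.zero_le (p.kc * N * β ^ 2)
  have h4 := Nat.zero_le (q.kc * N * β ^ 2)
  by_cases hbs : b.Holds s
  · obtain ⟨-, s₁, t₁, he₁, ht₁, hs₁, h₁⟩ := h hbs
    exact ⟨hN, s₁, _, .ite_true hbs he₁, by rw [Prog.kc]; nlinarith, hs₁, h₁⟩
  · obtain ⟨-, s₁, t₁, he₁, ht₁, hs₁, h₁⟩ := h' hbs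
    exact ⟨hN, s₁, _, .ite_false hbs he₁, by rw [Prog.kc]; nlinarith, hs₁, h₁⟩

/-- A loop-free program takes `O(β²)` steps. -/
lemma Runs.of_wp {p : Prog} (hβ : 1 ≤ β) (hs : s.Bdd β) (h : wp ρ β p Q s) :
    Runs ρ β 1 p s Q := by
  have hβ2 : β ≤ β ^ 2 := by nlinarith
  induction p generalizing s Q with
  | skip => exact ⟨le_rfl, s, 1, .skip s, by rw [Prog.kc]; nlinarith, hs, h⟩
  | nset x e =>
    refine ⟨le_rfl, _, _, .nset x e s, ?_, hs.setN h.1 x, h.2⟩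
    obtain ⟨h1, h2⟩ : _ ≤ e.kc * β ∧ _ ≤ e.kc * β ^ 2 := e.exists_bound.choose_spec β s hβ hs
    have h4 : e.kc * β ≤ e.kc * β ^ 2 := Nat.mul_le_mul_left _ hβ2
    rw [Prog.kc]
    nlinarith
  | rset x e =>
    refine ⟨le_rfl, _, _, .rset x e s, ?_, hs, h⟩
    have h1 : _ ≤ e.kc * β ^ 2 := e.exists_bound.choose_spec β s hβ hs
    rw [Prog.kc]
    nlinarith
  | nput a i e =>
    refine ⟨le_rfl, _, _, .nput a i e s, ?_, hs.putN h.1 a _, h.2⟩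
    obtain ⟨h1, h2⟩ : _ ≤ i.kc * β ∧ _ ≤ i.kc * β ^ 2 := i.exists_bound.choose_spec β s hβ hs
    obtain ⟨h3, h4⟩ : _ ≤ e.kc * β ∧ _ ≤ e.kc * β ^ 2 := e.exists_bound.choose_spec β s hβ hs
    have h5 : i.kc * β ≤ i.kc * β ^ 2 := Nat.mul_le_mul_left _ hβ2
    have h6 : e.kc * β ≤ e.kc * β ^ 2 := Nat.mul_le_mul_left _ hβ2
    rw [Prog.kc]
    nlinarith
  | rput a i e =>
    refine ⟨le_rfl, _, _, .rput a i e s, ?_, hs, h⟩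
    obtain ⟨h1, h2⟩ : _ ≤ i.kc * β ∧ _ ≤ i.kc * β ^ 2 := i.exists_bound.choose_spec β s hβ hs
    have h3 : _ ≤ e.kc * β ^ 2 := e.exists_bound.choose_spec β s hβ hs
    have h5 : i.kc * β ≤ i.kc * β ^ 2 := Nat.mul_le_mul_left _ hβ2
    rw [Prog.kc]
    nlinarith
  | flip x => exact ⟨le_rfl, _, 1, .flip x s, by rw [Prog.kc]; nlinarith, hs.flip hβ ρ x, h⟩
  | seq p q ihp ihq => exact .seq hβ (ihp hs h) fun s' hs' h' => ihq hs' h'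
  | ite b p q ihp ihq => exact .ite hβ hs le_rfl (fun hb => ihp hs (h.1 hb)) fun hb => ihq hs (h.2 hb)
  | loop b p => exact h.elim

/-- The natural-number registers that a program may modify. -/
def Prog.nW : Prog → List ℕ
  | .nset x _ => [x]
  | .flip x => [x]
  | .seq p q => p.nW ++ q.nW
  | .ite _ p q => p.nW ++ q.nW
  | .loop _ p => p.nW
  | _ => []

/-- The real registers that a program may modify. -/
def Prog.rW : Prog → List ℕ
  | .rset x _ => [x]
  | .seq p q => p.rW ++ q.rW
  | .ite _ p q => p.rW ++ q.rW
  | .loop _ p => p.rW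
  | _ => []

/-- The natural-number arrays that a program may modify. -/
def Prog.naW : Prog → List ℕ
  | .nput a _ _ => [a]
  | .seq p q => p.naW ++ q.naW
  | .ite _ p q => p.naW ++ q.naW
  | .loop _ p => p.naW
  | _ => []

/-- The real arrays that a program may modify. -/
def Prog.raW : Prog → List ℕ
  | .rput a _ _ => [a]
  | .seq p q => p.raW ++ q.raW
  | .ite _ p q => p.raW ++ q.raW
  | .loop _ p => p.raW
  | _ => []

/-- The memories agree on everything that `p` does not modify. -/
structure Agree (p : Prog) (s s' : Store) : Prop where
  n : ∀ x, x ∉ p.nW → s'.nvar x = s.nvar x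
  r : ∀ x, x ∉ p.rW → s'.rvar x = s.rvar x
  na : ∀ x, x ∉ p.naW → s'.narr x = s.narr x
  ra : ∀ x, x ∉ p.raW → s'.rarr x = s.rarr x

lemma Agree.refl (p : Prog) (s : Store) : Agree p s s :=
  ⟨fun _ _ => rfl, fun _ _ => rfl, fun _ _ => rfl, fun _ _ => rfl⟩

lemma Agree.trans {p : Prog} {s₁ s₂ s₃ : Store} (h : Agree p s₁ s₂) (h' : Agree p s₂ s₃) :
    Agree p s₁ s₃ :=
  ⟨fun x hx => (h'.n x hx).trans (h.n x hx), fun x hx => (h'.r x hx).trans (h.r x hx),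
    fun x hx => (h'.na x hx).trans (h.na x hx), fun x hx => (h'.ra x hx).trans (h.ra x hx)⟩

lemma Agree.seq_left {p : Prog} {s₁ s₂ : Store} (h : Agree p s₁ s₂) (q : Prog) :
    Agree (.seq p q) s₁ s₂ := by
  constructor <;> intro x hx <;> simp only [Prog.nW, Prog.rW, Prog.naW, Prog.raW,
    List.mem_append, not_or] at hx
  exacts [h.n x hx.1, h.r x hx.1, h.na x hx.1, h.ra x hx.1]

lemma Agree.seq_right {q : Prog} {s₁ s₂ : Store} (h : Agree q s₁ s₂) (p : Prog) :
    Agree (.seq p q) s₁ s₂ := by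
  constructor <;> intro x hx <;> simp only [Prog.nW, Prog.rW, Prog.naW, Prog.raW,
    List.mem_append, not_or] at hx
  exacts [h.n x hx.2, h.r x hx.2, h.na x hx.2, h.ra x hx.2]

lemma Agree.loop {p : Prog} {s₁ s₂ : Store} (h : Agree p s₁ s₂) (b : Test) :
    Agree (.loop b p) s₁ s₂ :=
  ⟨h.n, h.r, h.na, h.ra⟩

lemma Exec.agree {p : Prog} {s s' : Store} {t : ℕ} (h : Exec ρ p s s' t) : Agree p s s' := by
  induction h with
  | skip s => exact .refl _ _
  | nset x e s | flip x s =>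
    refine ⟨fun y hy => ?_, fun _ _ => rfl, fun _ _ => rfl, fun _ _ => rfl⟩
    simp only [Prog.nW, List.mem_singleton] at hy
    simp [hy]
  | rset x e s =>
    refine ⟨fun _ _ => rfl, fun y hy => ?_, fun _ _ => rfl, fun _ _ => rfl⟩
    simp only [Prog.rW, List.mem_singleton] at hy
    simp [hy]
  | nput a i e s =>
    refine ⟨fun _ _ => rfl, fun _ _ => rfl, fun y hy => ?_, fun _ _ => rfl⟩
    simp only [Prog.naW, List.mem_singleton] at hy
    ext j
    simp [hy]
  | rput a i e s =>
    refine ⟨fun _ _ => rfl, fun _ _ => rfl, fun _ _ => rfl, fun y hy => ?_⟩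
    simp only [Prog.raW, List.mem_singleton] at hy
    ext j
    simp [hy]
  | seq _ _ ih₁ ih₂ => exact (ih₁.seq_left _).trans (ih₂.seq_right _)
  | ite_true _ _ ih =>
    have := ih.seq_left
    exact ⟨(this _).n, (this _).r, (this _).na, (this _).ra⟩
  | ite_false _ _ ih =>
    have := ih.seq_right
    exact ⟨(this _).n, (this _).r, (this _).na, (this _).ra⟩
  | loop_done => exact .refl _ _
  | loop_step _ _ _ ih₁ ih₂ => exact Agree.trans ⟨ih₁.n, ih₁.r, ih₁.na, ih₁.ra⟩ ih₂

/-- The frame rule. -/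
lemma Runs.agree {p : Prog} {N : ℕ} (h : Runs ρ β N p s Q) :
    Runs ρ β N p s fun s' => Agree p s s' ∧ Q s' := by
  obtain ⟨hN, s', t, he, ht, hs', hq⟩ := h
  exact ⟨hN, s', t, he, ht, hs', he.agree, hq⟩

/-- The rule for a loop that performs exactly `T` iterations. -/
lemma Runs.loop {b : Test} {p : Prog} {N T : ℕ} (J : ℕ → Store → Prop) (hβ : 1 ≤ β)
    (hs : s.Bdd β) (hN : 1 ≤ N) (h0 : J 0 s)
    (hstep : ∀ i < T, ∀ s', s'.Bdd β → Agree p s s' → J i s' →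
      b.Holds s' ∧ Runs ρ β N p s' (J (i + 1)))
    (hend : ∀ s', s'.Bdd β → Agree p s s' → J T s' → ¬ b.Holds s') :
    Runs ρ β (N * (T + 1)) (.loop b p) s (J T) := by
  suffices H : ∀ m ≤ T, ∀ s', s'.Bdd β → Agree p s s' → J (T - m) s' →
      Runs ρ β (N * (m + 1)) (.loop b p) s' (J T) from
    H T le_rfl s hs (.refl _ _) (by simpa using h0)
  have h1 : 1 ≤ N * β ^ 2 := Nat.mul_pos hN (pow_pos hβ 2)
  have h2 : b.kc * β ^ 2 ≤ b.kc * (N * β ^ 2) :=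
    Nat.mul_le_mul_left _ (Nat.le_mul_of_pos_left _ hN)
  have h3 := Nat.zero_le (p.kc * N * β ^ 2)
  intro m
  induction m with
  | zero =>
    intro _ s' hs' hA hJ
    have hb := b.cost_le hβ hs'
    exact ⟨by omega, s', _, .loop_done (hend s' hs' hA (by simpa using hJ)),
      by rw [Prog.kc]; nlinarith, hs', by simpa using hJ⟩
  | succ m ih =>
    intro hm s' hs' hA hJ
    have hb := b.cost_le hβ hs'
    obtain ⟨hh, h₁⟩ := hstep (T - (m + 1)) (by omega) s' hs' hA hJ
    obtain ⟨-, s₁, t₁, he₁, ht₁, hs₁, hA₁, h₁⟩ := h₁.agree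
    rw [show T - (m + 1) + 1 = T - m by omega] at h₁
    obtain ⟨-, s₂, t₂, he₂, ht₂, hs₂, h₂⟩ := ih (by omega) s₁ hs₁ (hA.trans hA₁) h₁
    refine ⟨Nat.mul_pos hN (by omega), s₂, _, .loop_step hh he₁ he₂, ?_, hs₂, h₂⟩
    rw [Prog.kc] at ht₂ ⊢
    calc _ ≤ b.kc * (N * β ^ 2) + p.kc * N * β ^ 2 + (b.kc + p.kc + 1) * (N * (m + 1)) * β ^ 2 +
          N * β ^ 2 := by omega
      _ = _ := by ring

/-- The rule for a loop whose variant `μ` decreases. -/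
lemma Runs.while {b : Test} {p : Prog} {N : ℕ} (J : Store → Prop) (μ : Store → ℕ) (hβ : 1 ≤ β)
    (hs : s.Bdd β) (hN : 1 ≤ N) (h0 : J s)
    (hstep : ∀ s', s'.Bdd β → Agree p s s' → J s' → b.Holds s' →
      Runs ρ β N p s' fun s'' => J s'' ∧ μ s'' < μ s') :
    Runs ρ β (N * (μ s + 1)) (.loop b p) s fun s' => J s' ∧ ¬ b.Holds s' := by
  suffices H : ∀ m, ∀ s', s'.Bdd β → Agree p s s' → J s' → μ s' ≤ m →
      Runs ρ β (N * (m + 1)) (.loop b p) s' fun s' => J s' ∧ ¬ b.Holds s' from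
    H _ s hs (.refl _ _) h0 le_rfl
  have h1 : 1 ≤ N * β ^ 2 := Nat.mul_pos hN (pow_pos hβ 2)
  have h2 : b.kc * β ^ 2 ≤ b.kc * (N * β ^ 2) :=
    Nat.mul_le_mul_left _ (Nat.le_mul_of_pos_left _ hN)
  have hdone : ∀ m s', s'.Bdd β → J s' → ¬ b.Holds s' →
      Runs ρ β (N * (m + 1)) (.loop b p) s' fun s' => J s' ∧ ¬ b.Holds s' := by
    intro m s' hs' hJ hh
    have hb := b.cost_le hβ hs'
    refine ⟨Nat.mul_pos hN (by omega), s', _, .loop_done hh, ?_, hs', hJ, hh⟩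
    rw [Prog.kc]
    calc _ ≤ b.kc * (N * β ^ 2) + N * β ^ 2 := by omega
      _ = (b.kc + 1) * (N * 1) * β ^ 2 := by ring
      _ ≤ _ := by gcongr <;> omega
  intro m
  induction m with
  | zero =>
    intro s' hs' hA hJ hμ
    by_cases hh : b.Holds s'
    · obtain ⟨-, s₁, t₁, he₁, ht₁, hs₁, h₁⟩ := hstep s' hs' hA hJ hh
      omega
    · exact hdone 0 s' hs' hJ hh
  | succ m ih =>
    intro s' hs' hA hJ hμ
    have hb := b.cost_le hβ hs'
    by_cases hh : b.Holds s'
    · obtain ⟨-, s₁, t₁, he₁, ht₁, hs₁, hA₁, h₁⟩ := (hstep s' hs' hA hJ hh).agree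
      obtain ⟨-, s₂, t₂, he₂, ht₂, hs₂, h₂⟩ := ih s₁ hs₁ (hA.trans hA₁) h₁.1 (by omega)
      refine ⟨Nat.mul_pos hN (by omega), s₂, _, .loop_step hh he₁ he₂, ?_, hs₂, h₂⟩
      rw [Prog.kc] at ht₂ ⊢
      calc _ ≤ b.kc * (N * β ^ 2) + p.kc * N * β ^ 2 + (b.kc + p.kc + 1) * (N * (m + 1)) * β ^ 2 +
            N * β ^ 2 := by omega
        _ = _ := by ring
    · exact hdone _ s' hs' hJ hh

/-- `for x < e do p`. -/
def Prog.for (x : ℕ) (e : NExp) (p : Prog) : Prog :=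
  .seq (.nset x (.const 0))
    (.loop (.nlt (.var x) e) (.seq p (.nset x (.add (.var x) (.const 1)))))

/-- The rule for a counting loop. The bound `e` has the value `T` throughout, and the body `p` does
not modify the counter `x`. -/
lemma Runs.for {x : ℕ} {e : NExp} {p : Prog} {N T : ℕ} (J : ℕ → Store → Prop) (hβ : 1 ≤ β)
    (hs : s.Bdd β) (hN : 1 ≤ N) (hT : T < 2 ^ β) (hx : x ∉ p.nW)
    (he : ∀ s', Agree (.for x e p) s s' → e.eval s' = T)
    (h0 : J 0 (s.setN x 0))
    (hstep : ∀ i < T, ∀ s', s'.Bdd β → Agree (.for x e p) s s' → s'.nvar x = i → J i s' →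
      Runs ρ β N p s' fun s'' => J (i + 1) (s''.setN x (i + 1))) :
    Runs ρ β (N * (T + 1)) (.for x e p) s fun s' => J T s' := by
  have hA0 : Agree (.for x e p) s (s.setN x 0) := by
    refine ⟨fun y hy => ?_, fun _ _ => rfl, fun _ _ => rfl, fun _ _ => rfl⟩
    simp only [Prog.for, Prog.nW, List.mem_append, List.mem_singleton, not_or] at hy
    simp [hy.1]
  have h1 : Runs ρ β 1 (.nset x (.const 0)) s (· = s.setN x 0) :=
    .of_wp hβ hs ⟨by simp [NExp.eval], rfl⟩
  refine (Runs.seq (N := N * (T + 1)) hβ (h1.mono (Nat.mul_pos hN (by omega)) fun _ _ h => h)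
    fun s' hs' hs0 => ?_).mono (Q := fun s' => s'.nvar x = T ∧ J T s') le_rfl fun s' _ h => h.2
  subst hs0
  refine Runs.loop (fun i s' => s'.nvar x = i ∧ J i s') hβ hs' hN ⟨by simp, h0⟩ ?_ ?_
  · intro i hi s₁ hs₁ hA ⟨hxi, hJ⟩
    have hA₁ : Agree (.for x e p) s s₁ := hA0.trans ((hA.loop (.nlt (.var x) e)).seq_right _)
    refine ⟨by simpa [Test.Holds, NExp.eval, hxi, he s₁ hA₁] using hi, ?_⟩
    refine Runs.seq hβ (hstep i hi s₁ hs₁ hA₁ hxi hJ).agree fun s₂ hs₂ ⟨hA₂, hJ₂⟩ => ?_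
    have hx2 : s₂.nvar x = i := (hA₂.n x hx).trans hxi
    refine (Runs.of_wp hβ hs₂ ?_).mono hN fun _ _ h => h
    simp only [wp, NExp.eval, hx2, Store.setN_nvar, if_true]
    exact ⟨by omega, trivial, hJ₂⟩
  · intro s₁ hs₁ hA ⟨hxi, hJ⟩
    have hA₁ : Agree (.for x e p) s s₁ := hA0.trans ((hA.loop (.nlt (.var x) e)).seq_right _)
    simp [Test.Holds, NExp.eval, hxi, he s₁ hA₁]

end Rules

/-! ### The exterior algebra on bit masks -/

section

lemma testBit_sub_two_pow {S j : ℕ} (h : S.testBit j = true) (l : ℕ) :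
    (S - 2 ^ j).testBit l = (S.testBit l && decide (l ≠ j)) := by
  induction j generalizing S l with
  | zero =>
    have h1 : S % 2 = 1 := by simpa [Nat.testBit_zero] using h
    cases l with
    | zero => simp [Nat.testBit_zero]; omega
    | succ l =>
      rw [Nat.testBit_add_one, Nat.testBit_add_one, show (S - 2 ^ 0) / 2 = S / 2 by omega]
      simp
  | succ j ih =>
    have h2 := Nat.ge_two_pow_of_testBit h
    rw [pow_succ] at h2 ⊢
    rw [Nat.testBit_add_one] at h
    cases l with
    | zero =>
      rw [Nat.testBit_zero, Nat.testBit_zero, show (S - 2 ^ j * 2) % 2 = S % 2 by omega]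
      simp
    | succ l =>
      rw [Nat.testBit_add_one, Nat.testBit_add_one,
        show (S - 2 ^ j * 2) / 2 = S / 2 - 2 ^ j by omega, ih h]
      simp

/-- The sign `(-1)` to the number of elements of `S` below `j`. -/
def sgn (S : ℕ) : ℕ → ℝ
  | 0 => 1
  | j + 1 => if S.testBit j then -sgn S j else sgn S j

lemma sgn_ne_zero (S j : ℕ) : sgn S j ≠ 0 := by
  induction j with
  | zero => simp [sgn]
  | succ j ih => rw [sgn]; split_ifs <;> simpa using ih

lemma sgn_sub {S j : ℕ} (h : S.testBit j = true) (l : ℕ) :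
    sgn (S - 2 ^ j) l = if j < l then -sgn S l else sgn S l := by
  induction l with
  | zero => simp [sgn]
  | succ l ih =>
    rw [sgn, sgn, testBit_sub_two_pow h, ih]
    rcases lt_trichotomy j l with h1 | rfl | h1
    · have : l ≠ j := by omega
      simp [this, h1, Nat.lt_succ_of_lt h1]
      split_ifs <;> simp
    · simp [h]
    · have : l ≠ j := by omega
      simp [this, show ¬ j < l by omega, show ¬ j < l + 1 by omega]

/-- The exterior product with the vector `y`. The elements of the exterior algebra of `ℝᵏ` are given
by their coordinates, which are indexed by the subsets of `{0, …, k - 1}` as bit masks. -/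
noncomputable def wedge (k : ℕ) (y : ℕ → ℝ) : (ℕ → ℝ) →ₗ[ℝ] (ℕ → ℝ) where
  toFun f S := ∑ j ∈ Finset.range k, if S.testBit j then sgn S j * y j * f (S - 2 ^ j) else 0
  map_add' f g := by
    ext S
    simp only [Pi.add_apply, ← Finset.sum_add_distrib]
    exact Finset.sum_congr rfl fun j _ => by split_ifs <;> ring
  map_smul' c f := by
    ext S
    simp only [Pi.smul_apply, smul_eq_mul, Finset.mul_sum, RingHom.id_apply]
    exact Finset.sum_congr rfl fun j _ => by split_ifs <;> ring

lemma wedge_apply (k : ℕ) (y f : ℕ → ℝ) (S : ℕ) : wedge k y f S =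
    ∑ j ∈ Finset.range k, if S.testBit j then sgn S j * y j * f (S - 2 ^ j) else 0 := rfl

lemma wedge_anticomm (k : ℕ) (y z f : ℕ → ℝ) :
    wedge k y (wedge k z f) = -wedge k z (wedge k y f) := by
  ext S
  simp only [Pi.neg_apply, wedge_apply, Finset.mul_sum]
  have expand : ∀ y z : ℕ → ℝ, (∑ j ∈ Finset.range k, if S.testBit j then ∑ l ∈ Finset.range k,
      sgn S j * y j * (if (S - 2 ^ j).testBit l then
        sgn (S - 2 ^ j) l * z l * f (S - 2 ^ j - 2 ^ l) else 0) else 0) =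
      ∑ j ∈ Finset.range k, ∑ l ∈ Finset.range k,
        if S.testBit j ∧ S.testBit l ∧ l ≠ j then
          sgn S j * y j * ((if j < l then -sgn S l else sgn S l) * z l *
            f (S - 2 ^ j - 2 ^ l)) else 0 := by
    intro y z
    refine Finset.sum_congr rfl fun j _ => ?_
    by_cases h : S.testBit j = true
    · rw [if_pos h]
      refine Finset.sum_congr rfl fun l _ => ?_
      rw [testBit_sub_two_pow h, sgn_sub h]
      by_cases h2 : S.testBit l = true ∧ l ≠ j
      · simp [h, h2]
      · rw [if_neg (by simpa using h2), if_neg (by tauto), mul_zero]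
    · simp [h]
  rw [expand, expand, Finset.sum_comm, ← Finset.sum_neg_distrib]
  refine Finset.sum_congr rfl fun l _ => ?_
  rw [← Finset.sum_neg_distrib]
  refine Finset.sum_congr rfl fun j _ => ?_
  by_cases h : S.testBit j = true ∧ S.testBit l = true ∧ l ≠ j
  · have h' : S.testBit l = true ∧ S.testBit j = true ∧ j ≠ l := ⟨h.2.1, h.1, h.2.2.symm⟩
    rw [if_pos h, if_pos h', Nat.sub_right_comm S (2 ^ j)]
    rcases lt_or_gt_of_ne h.2.2 with h1 | h1
    · rw [if_pos h1, if_neg h1.not_gt]; ring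
    · rw [if_pos h1, if_neg h1.not_gt]; ring
  · rw [if_neg h, if_neg (by tauto), neg_zero]

lemma wedge_self (k : ℕ) (y f : ℕ → ℝ) : wedge k y (wedge k y f) = 0 := by
  have := wedge_anticomm k y y f
  exact self_eq_neg.1 this

/-- The exterior product of the vectors `y v`, for `v` in a list. -/
noncomputable def wedgeList (k : ℕ) (y : ℕ → ℕ → ℝ) (q : List ℕ) : ℕ → ℝ :=
  q.foldr (fun v f => wedge k (y v) f) fun S => if S = 0 then 1 else 0

lemma wedge_wedgeList_of_mem (k : ℕ) (y : ℕ → ℕ → ℝ) {v : ℕ} {q : List ℕ} (h : v ∈ q) :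
    wedge k (y v) (wedgeList k y q) = 0 := by
  induction q with
  | nil => simp at h
  | cons u q ih =>
    change wedge k (y v) (wedge k (y u) (wedgeList k y q)) = 0
    rcases List.mem_cons.1 h with rfl | h
    · exact wedge_self _ _ _
    · rw [wedge_anticomm, ih h, map_zero, neg_zero]

/-- A wedge product with a repeated factor vanishes. -/
lemma nodup_of_wedgeList_ne_zero (k : ℕ) (y : ℕ → ℕ → ℝ) {q : List ℕ} (h : wedgeList k y q ≠ 0) :
    q.Nodup := by
  induction q with
  | nil => simp
  | cons u q ih =>
    refine List.nodup_cons.2 ⟨fun hu => h (wedge_wedgeList_of_mem k y hu), ih fun h0 => h ?_⟩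
    change wedge k (y u) (wedgeList k y q) = 0
    rw [h0, map_zero]

/-! ### The sum over walks -/

open scoped Classical in
/-- The sum over the walks `v₀, …, vᵢ = v` of weight `d` in `{0, …, n - 1}` of the exterior products
of the vectors `x(vⱼ, j) • y(vⱼ)`, the last vertex first, as a function of the bit mask. -/
noncomputable def tab (n k : ℕ) (A : ℕ → ℕ → Prop) (W : ℕ → ℕ → ℕ) (x y : ℕ → ℕ → ℝ) :
    ℕ → ℕ → ℕ → ℕ → ℝ
  | 0, v, d => x v 0 • wedge k (y v) fun T => if d = 0 ∧ T = 0 then 1 else 0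
  | i + 1, v, d => x v (i + 1) • wedge k (y v) (∑ u ∈ Finset.range n,
      if A u v ∧ W u v ≤ d then tab n k A W x y i u (d - W u v) else 0)

/-- The coefficient of the top exterior power in the sum over the walks of `k` vertices and of
weight `d`. -/
noncomputable def topSum (n k : ℕ) (A : ℕ → ℕ → Prop) (W : ℕ → ℕ → ℕ) (x y : ℕ → ℕ → ℝ)
    (d : ℕ) : ℝ :=
  ∑ v ∈ Finset.range n, tab n k A W x y (k - 1) v d (2 ^ k - 1)

variable {n k : ℕ} {A : ℕ → ℕ → Prop} {W : ℕ → ℕ → ℕ} {x y : ℕ → ℕ → ℝ}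

/-- `Walk n A W x i v d q`: the list `q` is the reversal of a walk `v₀, …, vᵢ = v` of weight `d`
in `{0, …, n - 1}` such that `x(vⱼ, j) ≠ 0` for all `j`. -/
inductive Walk (n : ℕ) (A : ℕ → ℕ → Prop) (W : ℕ → ℕ → ℕ) (x : ℕ → ℕ → ℝ) :
    ℕ → ℕ → ℕ → List ℕ → Prop
  | single {v} : v < n → x v 0 ≠ 0 → Walk n A W x 0 v 0 [v]
  | cons {i u v d q} : v < n → x v (i + 1) ≠ 0 → A u v → Walk n A W x i u d q →
      Walk n A W x (i + 1) v (d + W u v) (v :: q)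

lemma tab_mem_span (i v d : ℕ) (hv : v < n) : tab n k A W x y i v d ∈
    Submodule.span ℝ {f | ∃ q, Walk n A W x i v d q ∧ f = wedgeList k y q} := by
  induction i generalizing v d with
  | zero =>
    rw [tab]
    by_cases hx : x v 0 = 0
    · rw [hx, zero_smul]; exact zero_mem _
    refine Submodule.smul_mem _ _ ?_
    by_cases hd : d = 0
    · subst hd
      exact Submodule.subset_span ⟨[v], .single hv hx, by simp [wedgeList]⟩
    · have : (fun T : ℕ => if d = 0 ∧ T = 0 then (1 : ℝ) else 0) = 0 := by ext T; simp [hd]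
      rw [this, map_zero]; exact zero_mem _
  | succ i ih =>
    rw [tab]
    by_cases hx : x v (i + 1) = 0
    · rw [hx, zero_smul]; exact zero_mem _
    refine Submodule.smul_mem _ _ ?_
    rw [map_sum]
    refine Submodule.sum_mem _ fun u hu => ?_
    split_ifs with h
    · have := Submodule.mem_map_of_mem (f := wedge k (y v)) (ih u (d - W u v) (Finset.mem_range.1 hu))
      rw [Submodule.map_span] at this
      refine Submodule.span_mono ?_ this
      rintro _ ⟨_, ⟨q, hq, rfl⟩, rfl⟩
      refine ⟨v :: q, ?_, rfl⟩
      have h2 := Walk.cons hv hx h.1 hq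
      rwa [Nat.sub_add_cancel h.2] at h2
    · rw [map_zero]; exact zero_mem _

lemma pathWeight_append_pair (W : ℕ → ℕ → ℕ) (p : List ℕ) (a b : ℕ) :
    pathWeight W (p ++ [a] ++ [b]) = pathWeight W (p ++ [a]) + W a b := by
  induction p with
  | nil => simp [pathWeight]
  | cons c p ih =>
    cases p with
    | nil => simp [pathWeight]
    | cons e p =>
      simp only [pathWeight, List.cons_append, List.tail_cons, List.zipWith_cons_cons,
        List.sum_cons] at ih ⊢
      rw [ih]; ring

lemma Walk.exists_list {i v d : ℕ} {q : List ℕ} (h : Walk n A W x i v d q) :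
    q.reverse.length = i + 1 ∧ q.head? = some v ∧ q.reverse.IsChain A ∧
      pathWeight W q.reverse = d ∧ (∀ u ∈ q, u < n) ∧
      ∀ j u, q.reverse[j]? = some u → x u j ≠ 0 := by
  induction h with
  | single hv hx =>
    refine ⟨rfl, rfl, by simp, by simp [pathWeight], by simpa using hv, ?_⟩
    rintro (_ | j) u hu
    · simp at hu; exact hu ▸ hx
    · simp at hu
  | @cons i u v d q hv hx hA hw ih =>
    obtain ⟨h1, h2, h3, h4, h5, h6⟩ := ih
    obtain ⟨u', q', rfl⟩ : ∃ u' q', q = u' :: q' := by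
      cases q with
      | nil => simp at h2
      | cons a b => exact ⟨a, b, rfl⟩
    obtain rfl : u' = u := by simpa using h2
    refine ⟨by simpa using h1, rfl, ?_, ?_, ?_, ?_⟩
    · rw [List.isChain_reverse] at h3 ⊢
      exact List.isChain_cons_cons.2 ⟨hA, h3⟩
    · rw [List.reverse_cons, List.reverse_cons, pathWeight_append_pair, ← List.reverse_cons, h4]
    · intro w hw
      rcases List.mem_cons.1 hw with rfl | hw
      exacts [hv, h5 w hw]
    · intro j w hj
      rw [List.reverse_cons, List.getElem?_append] at hj
      split_ifs at hj with hlt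
      · exact h6 j w hj
      · have h7 : j - (u' :: q').reverse.length = 0 := by
          by_contra h0
          rw [List.getElem?_eq_none (by simp only [List.length_singleton]; omega)] at hj
          simp at hj
        rw [h7] at hj
        obtain rfl : v = w := by simpa using hj
        rw [show j = i + 1 by omega]
        exact hx

/-- If the sum is nonzero, then there is a simple path of weight `d`. Its vertices have nonzero
scalars `x u j`, so restricting the support of `x` restricts the path. -/
lemma exists_path_of_topSum_ne_zero (hk : 1 ≤ k) {d : ℕ} (h : topSum n k A W x y d ≠ 0) :
    ∃ p : List ℕ, p.length = k ∧ p.Nodup ∧ p.IsChain A ∧ pathWeight W p = d ∧ (∀ u ∈ p, u < n) ∧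
      ∀ j u, p[j]? = some u → x u j ≠ 0 := by
  obtain ⟨v, hv, h⟩ := Finset.exists_ne_zero_of_sum_ne_zero h
  obtain ⟨q, hq, hqS⟩ : ∃ q, Walk n A W x (k - 1) v d q ∧ wedgeList k y q (2 ^ k - 1) ≠ 0 := by
    by_contra! hn
    have hle : Submodule.span ℝ {f | ∃ q, Walk n A W x (k - 1) v d q ∧ f = wedgeList k y q} ≤
        LinearMap.ker (LinearMap.proj (R := ℝ) (φ := fun _ : ℕ => ℝ) (2 ^ k - 1)) := by
      rw [Submodule.span_le]
      rintro _ ⟨q, hq, rfl⟩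
      exact hn q hq
    exact h (hle (tab_mem_span (k - 1) v d (Finset.mem_range.1 hv)))
  obtain ⟨h1, h2, h3, h4, h5, h6⟩ := hq.exists_list
  refine ⟨q.reverse, by omega, ?_, h3, h4, by simpa using h5, h6⟩
  exact List.nodup_reverse.2 (nodup_of_wedgeList_ne_zero k y fun h0 => hqS (by rw [h0]; rfl))

lemma tab_congr {A' : ℕ → ℕ → Prop} {W' : ℕ → ℕ → ℕ} {x' y' : ℕ → ℕ → ℝ} {D : ℕ}
    (hA : ∀ u < n, ∀ v < n, A u v ↔ A' u v)
    (hW : ∀ u < n, ∀ v < n, A u v → W u v = W' u v ∨ D < W u v ∧ D < W' u v)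
    (hx : ∀ v < n, ∀ i < k, x v i = x' v i) (hy : ∀ v < n, ∀ j < k, y v j = y' v j)
    {i v d : ℕ} (hi : i < k) (hv : v < n) (hd : d ≤ D) :
    tab n k A W x y i v d = tab n k A' W' x' y' i v d := by
  have hwedge : ∀ v < n, wedge k (y v) = wedge k (y' v) := by
    intro v hv
    ext f S
    simp only [wedge_apply]
    exact Finset.sum_congr rfl fun j hj => by rw [hy v hv j (Finset.mem_range.1 hj)]
  induction i generalizing v d with
  | zero => rw [tab, tab, hx v hv 0 hi, hwedge v hv]
  | succ i ih =>
    rw [tab, tab, hx v hv _ hi, hwedge v hv]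
    congr 2
    refine Finset.sum_congr rfl fun u hu => ?_
    have hu := Finset.mem_range.1 hu
    by_cases h : A u v ∧ W u v ≤ d
    · have hW' : W u v = W' u v := by
        rcases hW u hu v hv h.1 with h1 | h1
        · exact h1
        · omega
      rw [if_pos h, if_pos ⟨(hA u hu v hv).1 h.1, hW' ▸ h.2⟩, ← hW',
        ih (by omega) hu (by omega)]
    · rw [if_neg h, if_neg]
      rintro ⟨h1, h2⟩
      refine h ⟨(hA u hu v hv).2 h1, ?_⟩
      rcases hW u hu v hv ((hA u hu v hv).2 h1) with h3 | h3 <;> omega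

/-- The sum depends on the weights only up to `D`, so larger weights may be cut off. -/
lemma topSum_congr {A' : ℕ → ℕ → Prop} {W' : ℕ → ℕ → ℕ} {x' y' : ℕ → ℕ → ℝ} {D d : ℕ}
    (hk : 1 ≤ k) (hA : ∀ u < n, ∀ v < n, A u v ↔ A' u v)
    (hW : ∀ u < n, ∀ v < n, A u v → W u v = W' u v ∨ D < W u v ∧ D < W' u v)
    (hx : ∀ v < n, ∀ i < k, x v i = x' v i) (hy : ∀ v < n, ∀ j < k, y v j = y' v j) (hd : d ≤ D) :
    topSum n k A W x y d = topSum n k A' W' x' y' d :=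
  Finset.sum_congr rfl fun v hv => by
    rw [tab_congr hA hW hx hy (by omega) (Finset.mem_range.1 hv) hd]

/-- The sum is additive in each row of the array `x`. -/
lemma topSum_add {x₁ x₂ : ℕ → ℕ → ℝ} {r d : ℕ} (hr : r < k)
    (h1 : ∀ v, ∀ i ≠ r, x v i = x₁ v i ∧ x v i = x₂ v i) (h2 : ∀ v, x v r = x₁ v r + x₂ v r) :
    topSum n k A W x y d = topSum n k A W x₁ y d + topSum n k A W x₂ y d := by
  have key : ∀ i v d, (i < r → tab n k A W x y i v d = tab n k A W x₁ y i v d ∧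
      tab n k A W x y i v d = tab n k A W x₂ y i v d) ∧
      (r ≤ i → tab n k A W x y i v d = tab n k A W x₁ y i v d + tab n k A W x₂ y i v d) := by
    intro i
    induction i with
    | zero =>
      intro v d
      refine ⟨fun hi => ?_, fun hi => ?_⟩
      · simp only [tab]
        rw [← (h1 v 0 (by omega)).1, ← (h1 v 0 (by omega)).2]
        exact ⟨rfl, rfl⟩
      · obtain rfl : r = 0 := by omega
        simp only [tab]
        rw [h2, add_smul]
    | succ i ih =>
      intro v d
      refine ⟨fun hi => ?_, fun hi => ?_⟩
      · simp only [tab]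
        rw [← (h1 v (i + 1) (by omega)).1, ← (h1 v (i + 1) (by omega)).2]
        constructor <;> congr 2 <;> refine Finset.sum_congr rfl fun u _ => ?_
        · rw [((ih u (d - W u v)).1 (by omega)).1]
        · rw [((ih u (d - W u v)).1 (by omega)).2]
      · simp only [tab]
        rcases Nat.lt_or_ge i r with hir | hir
        · obtain rfl : r = i + 1 := by omega
          rw [h2, add_smul]
          congr 3 <;> refine Finset.sum_congr rfl fun u _ => ?_
          · rw [((ih u (d - W u v)).1 (by omega)).1]
          · rw [((ih u (d - W u v)).1 (by omega)).2]
        · rw [← (h1 v (i + 1) (by omega)).1, ← (h1 v (i + 1) (by omega)).2, ← smul_add, ← map_add,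
            ← Finset.sum_add_distrib]
          congr 2
          refine Finset.sum_congr rfl fun u _ => ?_
          split_ifs
          · exact (ih u _).2 hir
          · rw [add_zero]
  simp only [topSum, ← Finset.sum_add_distrib]
  exact Finset.sum_congr rfl fun v _ => by rw [(key (k - 1) v d).2 (by omega)]; rfl

/-- A simple path `p` provides values of `x` and `y` for which the sum is nonzero: `x` selects the
walk `p`, and `y` maps its vertices to the standard basis. -/
lemma topSum_indicator_ne_zero {p : List ℕ} (hk : 1 ≤ k) (hp : p.length = k) (hnd : p.Nodup)
    (hchain : p.IsChain A) (hlt : ∀ u ∈ p, u < n) :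
    topSum n k A W (fun v i => if p[i]? = some v then 1 else 0)
      (fun v j => if p[j]? = some v then 1 else 0) (pathWeight W p) ≠ 0 := by
  set e : ℕ → ℕ → ℝ := fun v i => if p[i]? = some v then 1 else 0 with he
  have hw : ∀ i (hi : i < k) f S, wedge k (e (p[i]'(hp ▸ hi))) f S =
      if S.testBit i then sgn S i * f (S - 2 ^ i) else 0 := by
    intro i hi f S
    rw [wedge_apply, Finset.sum_eq_single_of_mem i (Finset.mem_range.2 hi)]
    · simp [he, hp ▸ hi]
    · intro j hj hji
      have hj := Finset.mem_range.1 hj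
      have : e p[i] j = 0 := by
        simp only [he, List.getElem?_eq_getElem (hp ▸ hj), Option.some.injEq]
        rw [if_neg]
        rw [hnd.getElem_inj_iff]
        exact hji
      simp [this]
  have hmask : ∀ i S : ℕ, (S.testBit i = true ∧ S - 2 ^ i = 2 ^ i - 1) ↔ S = 2 ^ (i + 1) - 1 := by
    intro i S
    have := Nat.one_le_two_pow (n := i)
    constructor
    · rintro ⟨h1, h2⟩
      have := Nat.ge_two_pow_of_testBit h1
      rw [pow_succ]; omega
    · rintro rfl
      exact ⟨by simp, by rw [pow_succ]; omega⟩
  have key : ∀ i (hi : i < k), ∃ c : ℝ, c ≠ 0 ∧ ∀ v d S, tab n k A W e e i v d S =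
      if v = p[i] ∧ d = pathWeight W (p.take (i + 1)) ∧ S = 2 ^ (i + 1) - 1 then c else 0 := by
    intro i
    induction i with
    | zero =>
      intro hi
      refine ⟨sgn 1 0, sgn_ne_zero _ _, fun v d S => ?_⟩
      have hw0 : pathWeight W (p.take (0 + 1)) = 0 := by
        cases p with
        | nil => rfl
        | cons a p => simp [pathWeight]
      rw [tab, Pi.smul_apply, smul_eq_mul, hw0]
      by_cases hv : v = p[0]
      · subst hv
        rw [hw 0 hi]
        have hm := hmask 0 S
        by_cases hS : S = 2 ^ (0 + 1) - 1
        · have hS' := hm.2 hS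
          by_cases hd : d = 0
          · simp [he, hS, hd]
          · simp [hd]
        · have : ¬ (S.testBit 0 = true ∧ S - 2 ^ 0 = 0) := fun h => hS (hm.1 ⟨h.1, by simpa using h.2⟩)
          rw [if_neg fun h : p[0] = p[0] ∧ d = 0 ∧ S = 2 ^ (0 + 1) - 1 => hS h.2.2]
          split_ifs with h1 h2
          · exact absurd ⟨h1, h2.2⟩ this
          · simp
          · simp
      · have : e v 0 = 0 := by
          simp only [he, List.getElem?_eq_getElem (hp ▸ hi), Option.some.injEq]
          rw [if_neg (Ne.symm hv)]
        simp [this, hv]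
    | succ i ih =>
      intro hi
      obtain ⟨c, hc, ih⟩ := ih (by omega)
      refine ⟨sgn (2 ^ (i + 1 + 1) - 1) (i + 1) * c, mul_ne_zero (sgn_ne_zero _ _) hc,
        fun v d S => ?_⟩
      have hi' : i + 1 < p.length := hp ▸ hi
      have hadj : A p[i] p[i + 1] := List.isChain_iff_getElem.1 hchain i hi'
      have hwt : pathWeight W (p.take (i + 1 + 1)) =
          pathWeight W (p.take (i + 1)) + W p[i] p[i + 1] := by
        rw [← List.take_append_getElem hi', ← List.take_append_getElem (show i < p.length by omega),
          pathWeight_append_pair]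
      rw [tab, Pi.smul_apply, smul_eq_mul]
      by_cases hv : v = p[i + 1]
      · subst hv
        rw [hw (i + 1) hi, Finset.sum_apply, Finset.sum_eq_single_of_mem p[i]
          (Finset.mem_range.2 (hlt _ (List.getElem_mem _)))]
        · have hm := hmask (i + 1) S
          have he1 : e p[i + 1] (i + 1) = 1 := by simp [he, hi']
          rw [he1, one_mul, hwt]
          by_cases hS : S = 2 ^ (i + 1 + 1) - 1
          · have hS' := hm.2 hS
            rw [if_pos hS'.1, hS'.2]
            by_cases hd : d = pathWeight W (p.take (i + 1)) + W p[i] p[i + 1]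
            · rw [if_pos ⟨hadj, by omega⟩, ih, if_pos ⟨rfl, by omega, rfl⟩,
                if_pos ⟨rfl, hd, hS⟩, ← hS]
            · rw [if_neg fun h : p[i + 1] = p[i + 1] ∧
                d = pathWeight W (p.take (i + 1)) + W p[i] p[i + 1] ∧ _ => hd h.2.1]
              split_ifs with h
              · rw [ih, if_neg, mul_zero]
                rintro ⟨-, h2, -⟩
                omega
              · simp
          · rw [if_neg fun h : p[i + 1] = p[i + 1] ∧
              d = pathWeight W (p.take (i + 1)) + W p[i] p[i + 1] ∧ _ => hS h.2.2]
            split_ifs with h1 h2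
            · rw [ih, if_neg, mul_zero]
              rintro ⟨-, -, h3⟩
              exact hS (hm.1 ⟨h1, h3⟩)
            · simp
            · rfl
        · intro u _ hu
          split_ifs with h
          · rw [ih, if_neg (by tauto)]
          · rfl
      · have : e v (i + 1) = 0 := by
          simp only [he, List.getElem?_eq_getElem hi', Option.some.injEq]
          rw [if_neg (Ne.symm hv)]
        simp [this, hv]
  obtain ⟨c, hc, key⟩ := key (k - 1) (by omega)
  have hk1 : k - 1 + 1 = k := by omega
  rw [topSum, Finset.sum_eq_single_of_mem (p[k - 1]'(by omega))
    (Finset.mem_range.2 (hlt _ (List.getElem_mem _)))]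
  · rw [key, if_pos ⟨rfl, by rw [hk1, List.take_of_length_le (by omega)], by rw [hk1]⟩]
    exact hc
  · intro v _ hv
    rw [key, if_neg (by tauto)]

/-! The sum is a polynomial of degree at most `2k` in each variable. -/

/-- A real function is a polynomial of degree at most `N`. -/
def IsPoly (N : ℕ) (f : ℝ → ℝ) : Prop :=
  ∃ P : Polynomial ℝ, P.natDegree ≤ N ∧ ∀ t, f t = P.eval t

lemma IsPoly.const (N : ℕ) (c : ℝ) : IsPoly N fun _ => c :=
  ⟨.C c, by simp, by simp⟩

lemma IsPoly.id {N : ℕ} (hN : 1 ≤ N) : IsPoly N fun t => t :=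
  ⟨.X, by simpa using hN, by simp⟩

lemma IsPoly.mul {M N : ℕ} {f g : ℝ → ℝ} (hf : IsPoly M f) (hg : IsPoly N g) :
    IsPoly (M + N) fun t => f t * g t := by
  obtain ⟨P, hP, hf⟩ := hf
  obtain ⟨Q, hQ, hg⟩ := hg
  exact ⟨P * Q, Polynomial.natDegree_mul_le.trans (by omega), by simp [hf, hg]⟩

lemma IsPoly.sum {ι : Type*} {N : ℕ} {f : ι → ℝ → ℝ} (s : Finset ι)
    (h : ∀ i ∈ s, IsPoly N (f i)) : IsPoly N fun t => ∑ i ∈ s, f i t := by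
  choose! P hP hf using h
  exact ⟨∑ i ∈ s, P i, Polynomial.natDegree_sum_le_of_forall_le s _ hP, fun t => by
    rw [Polynomial.eval_finsetSum]
    exact Finset.sum_congr rfl fun i hi => hf i hi t⟩

lemma IsPoly.wedge {N : ℕ} {y f : ℝ → ℕ → ℝ} (hy : ∀ j, IsPoly 1 fun t => y t j)
    (hf : ∀ S, IsPoly N fun t => f t S) (S : ℕ) :
    IsPoly (1 + N) fun t => wedge k (y t) (f t) S := by
  simp only [wedge_apply]
  refine .sum _ fun j _ => ?_
  split_ifs
  · simp only [mul_assoc (sgn S j)]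
    simpa using (IsPoly.const 0 (sgn S j)).mul ((hy j).mul (hf _))
  · exact .const _ _

lemma IsPoly.topSum {x y : ℝ → ℕ → ℕ → ℝ} (hk : 1 ≤ k) (hx : ∀ v i, IsPoly 1 fun t => x t v i)
    (hy : ∀ v j, IsPoly 1 fun t => y t v j) (d : ℕ) :
    IsPoly (2 * k) fun t => topSum n k A W (x t) (y t) d := by
  have key : ∀ i v d S, IsPoly (2 * (i + 1)) fun t => tab n k A W (x t) (y t) i v d S := by
    intro i
    induction i with
    | zero =>
      intro v d S
      simp only [tab, Pi.smul_apply, smul_eq_mul]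
      exact (hx v 0).mul (IsPoly.wedge (N := 0) (hy v)
        (f := fun _ T => if d = 0 ∧ T = 0 then 1 else 0) (fun S => .const 0 _) S)
    | succ i ih =>
      intro v d S
      simp only [tab, Pi.smul_apply, smul_eq_mul]
      rw [show 2 * (i + 1 + 1) = 1 + (1 + 2 * (i + 1)) by ring]
      refine (hx v (i + 1)).mul (IsPoly.wedge (hy v) (fun S => ?_) S)
      simp only [Finset.sum_apply]
      refine .sum _ fun u _ => ?_
      split_ifs
      · exact ih u _ S
      · exact .const _ _
  have := fun v => key (k - 1) v d (2 ^ k - 1)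
  rw [show k - 1 + 1 = k by omega] at this
  exact .sum _ fun v _ => this v

end

/-! ### Random evaluation points -/

section

/-- The number whose binary digits, most significant first, are the random bits `s, …, s + l - 1`.
-/
def bitsVal (ρ : ℕ → Bool) (s : ℕ) : ℕ → ℕ
  | 0 => 0
  | l + 1 => 2 * bitsVal ρ s l + if ρ (s + l) then 1 else 0

lemma bitsVal_lt (ρ : ℕ → Bool) (s l : ℕ) : bitsVal ρ s l < 2 ^ l := by
  induction l with
  | zero => simp [bitsVal]
  | succ l ih => rw [bitsVal, pow_succ]; split_ifs <;> omega

lemma bitsVal_add (ρ : ℕ → Bool) (s l m : ℕ) :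
    bitsVal ρ s (l + m) = bitsVal ρ s l * 2 ^ m + bitsVal ρ (s + l) m := by
  induction m with
  | zero => simp [bitsVal]
  | succ m ih => rw [← add_assoc, bitsVal, ih, bitsVal, pow_succ, add_assoc s l m]; ring

lemma eq_of_bitsVal_eq {ρ ρ' : ℕ → Bool} {s l : ℕ} (h : bitsVal ρ s l = bitsVal ρ' s l) {j : ℕ}
    (hj : j < l) : ρ (s + j) = ρ' (s + j) := by
  induction l with
  | zero => omega
  | succ l ih =>
    rw [bitsVal, bitsVal] at h
    rcases Nat.lt_succ_iff_lt_or_eq.1 hj with h1 | rfl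
    · exact ih (by split_ifs at h <;> omega) h1
    · cases h2 : ρ (s + j) <;> cases h3 : ρ' (s + j) <;> simp [h2, h3] at h ⊢ <;> omega

lemma bitsVal_congr {ρ ρ' : ℕ → Bool} {s l : ℕ} (h : ∀ j < l, ρ (s + j) = ρ' (s + j)) :
    bitsVal ρ s l = bitsVal ρ' s l := by
  induction l with
  | zero => rfl
  | succ l ih => rw [bitsVal, bitsVal, ih fun j hj => h j (by omega), h l (by omega)]

open MeasureTheory

instance : IsProbabilityMeasure coinMeasure := by
  unfold coinMeasure; infer_instance

/-- The first `T` random bits take any given value with probability at most `2 ^ (-T)`. -/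
lemma coinMeasure_bitsVal_le (T r : ℕ) :
    coinMeasure {ρ | bitsVal ρ 0 T = r} ≤ (2 ^ T : ENNReal)⁻¹ := by
  by_cases h : ∃ ρ, bitsVal ρ 0 T = r
  · obtain ⟨ρ₀, rfl⟩ := h
    have hsub : {ρ | bitsVal ρ 0 T = bitsVal ρ₀ 0 T} ⊆
        Set.pi (Finset.range T : Set ℕ) fun j => {ρ₀ j} := by
      intro ρ hρ j hj
      have := eq_of_bitsVal_eq hρ (Finset.mem_range.1 (Finset.mem_coe.1 hj))
      simpa using this
    refine (measure_mono hsub).trans ?_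
    rw [coinMeasure, Measure.infinitePi_pi _ fun _ _ => measurableSet_singleton _]
    have : ∀ j, (PMF.uniformOfFintype Bool).toMeasure {ρ₀ j} = 2⁻¹ := by
      intro j
      rw [PMF.toMeasure_apply_singleton _ _ (measurableSet_singleton _)]
      simp
    simp [this, ENNReal.inv_pow]
  · have : {ρ | bitsVal ρ 0 T = r} = ∅ := by
      ext ρ; simpa using fun h1 => h ⟨ρ, h1⟩
    simp [this]

/-- A function of `N` variables that is a polynomial of degree at most `Δ` in each of them and that
does not vanish identically vanishes at a random point of `{0, …, 2 ^ b - 1} ^ N` with probability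
at most `N Δ / 2 ^ b`. -/
lemma coinMeasure_root_le {N Δ b : ℕ} {f : (ℕ → ℝ) → ℝ}
    (hpoly : ∀ z m, IsPoly Δ fun t => f (Function.update z m t))
    (hN : ∀ z z' : ℕ → ℝ, (∀ m < N, z m = z' m) → f z = f z') {a : ℕ → ℝ} (ha : f a ≠ 0) :
    coinMeasure {ρ | f (fun m => (bitsVal ρ (m * b) b : ℝ)) = 0} ≤
      (N : ENNReal) * (Δ * (2 ^ b : ENNReal)⁻¹) := by
  classical
  -- the coordinates of the nonzero point `a` are replaced one by one by random ones
  set h : ℕ → (ℕ → Bool) → ℕ → ℝ := fun m ρ i =>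
    if i < m then (bitsVal ρ (i * b) b : ℝ) else a i with hh
  have hsucc : ∀ m ρ, h (m + 1) ρ = Function.update (h m ρ) m (bitsVal ρ (m * b) b : ℝ) := by
    intro m ρ
    ext i
    rcases lt_trichotomy i m with h1 | rfl | h1
    · simp [hh, h1, h1.ne, Nat.lt_succ_of_lt h1]
    · simp [hh]
    · simp [hh, h1.ne', show ¬ i < m by omega, show ¬ i < m + 1 by omega]
  have hself : ∀ m ρ, Function.update (h m ρ) m (a m) = h m ρ := by
    intro m ρ
    rw [Function.update_eq_self_iff]
    simp [hh]
  have hpref : ∀ m ρ ρ', bitsVal ρ 0 (m * b) = bitsVal ρ' 0 (m * b) → h m ρ = h m ρ' := by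
    intro m ρ ρ' he
    ext i
    simp only [hh]
    split_ifs with hi
    · have : bitsVal ρ (i * b) b = bitsVal ρ' (i * b) b := bitsVal_congr fun j hj => by
        have h1 : (i + 1) * b ≤ m * b := Nat.mul_le_mul_right _ hi
        have := eq_of_bitsVal_eq he (j := i * b + j) (by rw [add_mul] at h1; omega)
        simpa using this
      rw [this]
    · rfl
  have hstep : ∀ m, coinMeasure {ρ | f (h (m + 1) ρ) = 0 ∧ f (h m ρ) ≠ 0} ≤
      Δ * (2 ^ b : ENNReal)⁻¹ := by
    intro m
    -- for each value `q` of the earlier bits there are at most `Δ` roots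
    have hroots : ∀ q, ∃ R : Finset ℕ, R.card ≤ Δ ∧ ∀ ρ, bitsVal ρ 0 (m * b) = q →
        f (h m ρ) ≠ 0 → f (h (m + 1) ρ) = 0 → bitsVal ρ (m * b) b ∈ R := by
      intro q
      by_cases hq : ∃ ρ, bitsVal ρ 0 (m * b) = q ∧ f (h m ρ) ≠ 0
      · obtain ⟨ρ₀, hρ₀, hf⟩ := hq
        obtain ⟨P, hP, hPf⟩ := hpoly (h m ρ₀) m
        have hP0 : P ≠ 0 := by
          rintro rfl
          have := hPf (a m)
          beta_reduce at this
          rw [hself, Polynomial.eval_zero] at this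
          exact hf this
        refine ⟨P.roots.toFinset.preimage (fun r : ℕ => (r : ℝ)) (Nat.cast_injective.injOn),
          ?_, ?_⟩
        · rw [Finset.card_preimage]
          exact (Finset.card_filter_le _ _).trans
            ((Multiset.toFinset_card_le _).trans ((Polynomial.card_roots' P).trans hP))
        · intro ρ hρ _ h0
          rw [Finset.mem_preimage, Multiset.mem_toFinset, Polynomial.mem_roots hP0,
            Polynomial.IsRoot, ← hPf, ← hpref m ρ ρ₀ (hρ.trans hρ₀.symm)]
          beta_reduce
          rw [← hsucc, h0]
      · exact ⟨∅, by simp, fun ρ h1 h2 => (hq ⟨ρ, h1, h2⟩).elim⟩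
    choose R hR hR' using hroots
    have hsub : {ρ | f (h (m + 1) ρ) = 0 ∧ f (h m ρ) ≠ 0} ⊆
        ⋃ q ∈ Finset.range (2 ^ (m * b)), ⋃ r ∈ R q,
          {ρ | bitsVal ρ 0 (m * b + b) = q * 2 ^ b + r} := by
      rintro ρ ⟨h1, h2⟩
      simp only [Set.mem_iUnion, Finset.mem_range, Set.mem_ofPred_eq]
      exact ⟨_, bitsVal_lt ρ 0 _, _, hR' _ ρ rfl h2 h1, by rw [bitsVal_add, zero_add]⟩
    calc _ ≤ _ := measure_mono hsub
      _ ≤ ∑ q ∈ Finset.range (2 ^ (m * b)), ∑ r ∈ R q, (2 ^ (m * b + b) : ENNReal)⁻¹ := by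
        refine (measure_biUnion_finset_le _ _).trans (Finset.sum_le_sum fun q _ => ?_)
        refine (measure_biUnion_finset_le _ _).trans (Finset.sum_le_sum fun r _ => ?_)
        exact coinMeasure_bitsVal_le _ _
      _ ≤ ∑ q ∈ Finset.range (2 ^ (m * b)), Δ * (2 ^ (m * b + b) : ENNReal)⁻¹ := by
        refine Finset.sum_le_sum fun q _ => ?_
        rw [Finset.sum_const, nsmul_eq_mul]
        gcongr
        exact_mod_cast hR q
      _ = Δ * (2 ^ b : ENNReal)⁻¹ := by
        rw [Finset.sum_const, nsmul_eq_mul, Finset.card_range, pow_add,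
          ENNReal.mul_inv (by simp) (by simp)]
        push_cast
        rw [← mul_assoc, ← mul_assoc, mul_comm _ (Δ : ENNReal), mul_assoc (Δ : ENNReal),
          ENNReal.mul_inv_cancel (by simp) (by simp), mul_one]
  have hall : ∀ m : ℕ, coinMeasure {ρ | f (h m ρ) = 0} ≤ m * (Δ * (2 ^ b : ENNReal)⁻¹) := by
    intro m
    induction m with
    | zero => simp [hh, ha]
    | succ m ih =>
      have hsub : {ρ | f (h (m + 1) ρ) = 0} ⊆
          {ρ | f (h m ρ) = 0} ∪ {ρ | f (h (m + 1) ρ) = 0 ∧ f (h m ρ) ≠ 0} := by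
        intro ρ hρ
        by_cases h0 : f (h m ρ) = 0
        exacts [.inl h0, .inr ⟨hρ, h0⟩]
      refine (measure_mono hsub).trans ((measure_union_le _ _).trans ?_)
      push_cast
      rw [add_mul, one_mul]
      exact add_le_add ih (hstep m)
  refine le_trans (le_of_eq ?_) (hall N)
  congr 1
  ext ρ
  simp only [Set.mem_ofPred_eq]
  rw [hN _ (h N ρ) fun m hm => by simp [hh, hm]]

end

/-! ### The scaling algorithm -/

section Scaling

variable {V : Type*} {G : Digraph V} {w : V → V → ℝ} {k : ℕ} {M ε : ℝ} {𝓑 : Subroutine V}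

lemma div_pos_and_lt_half {b : Bounds} (hL : 0 < b.L) (hU : 2 * b.L < b.U) :
    0 < b.L / b.U ∧ b.L / b.U < 1 / 2 := by
  have : 0 < b.U := by linarith
  refine ⟨by positivity, ?_⟩
  rw [div_lt_iff₀ this]
  linarith

lemma Bounds.δ_pos {b : Bounds} (hL : 0 < b.L) (hU : 2 * b.L < b.U) : 0 < b.δ := by
  obtain ⟨h1, h2⟩ := div_pos_and_lt_half hL hU
  rw [Bounds.δ, Real.sqrt_eq_rpow, sub_pos]
  exact Real.rpow_lt_rpow_of_exponent_gt h1 (by linarith) (by norm_num)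

lemma Bounds.X_eq {b : Bounds} (hL : 0 < b.L) (hU : 2 * b.L < b.U) :
    b.X = Real.sqrt (b.L / b.U) * b.U := by
  have hU0 : 0 < b.U := by linarith
  rw [Bounds.X, show b.L * b.U = (b.L / b.U) * b.U ^ 2 by field_simp, Real.sqrt_mul' _ (by positivity),
    Real.sqrt_sq hU0.le]

/-- The case of the loop where a path is found: `X + δ U = (L / U) ^ (1 / 3) U`. -/
lemma Bounds.X_add {b : Bounds} (hL : 0 < b.L) (hU : 2 * b.L < b.U) :
    b.X + b.δ * b.U = (b.L / b.U) ^ (1 / 3 : ℝ) * b.U := by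
  rw [Bounds.X_eq hL hU, Bounds.δ]; ring

/-- One iteration preserves `0 < L ≤ U` and shrinks the ratio `U / L`. -/
lemma loopStep_spec {b : Bounds} (𝓑 : Subroutine V) (w : V → V → ℝ) (k : ℕ) (hL : 0 < b.L)
    (hU : 2 * b.L < b.U) :
    0 < (loopStep 𝓑 w k b).L ∧ (loopStep 𝓑 w k b).L ≤ (loopStep 𝓑 w k b).U ∧
      (loopStep 𝓑 w k b).U / (loopStep 𝓑 w k b).L ≤ (b.U / b.L) ^ (2 / 3 : ℝ) := by
  obtain ⟨h1, h2⟩ := div_pos_and_lt_half hL hU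
  have hU0 : 0 < b.U := by linarith
  set r := b.L / b.U with hr
  have hLr : b.L = r * b.U := by rw [hr]; field_simp
  have hrinv : b.U / b.L = r⁻¹ := by rw [hr, inv_div]
  have hr1 : r ^ (1 / 3 : ℝ) * r ^ (2 / 3 : ℝ) = r := by
    rw [← Real.rpow_add h1]; norm_num
  have hp : 0 < r ^ (2 / 3 : ℝ) := by positivity
  have hp1 : 0 < r ^ (1 / 3 : ℝ) := by positivity
  rw [hrinv, Real.inv_rpow h1.le]
  unfold loopStep
  simp only
  split_ifs with h
  · simp only
    rw [Bounds.X_add hL hU]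
    refine ⟨hL, ?_, ?_⟩
    · have h3 : r ^ (1 : ℝ) ≤ r ^ (1 / 3 : ℝ) :=
        Real.rpow_le_rpow_of_exponent_ge h1 (by linarith) (by norm_num)
      rw [Real.rpow_one] at h3
      calc b.L = r * b.U := hLr
        _ ≤ r ^ (1 / 3 : ℝ) * b.U := by gcongr
    · rw [← hr, div_le_iff₀ hL, hLr]
      refine le_of_eq ?_
      have : r ^ (1 / 3 : ℝ) = (r ^ (2 / 3 : ℝ))⁻¹ * r := by
        field_simp
        exact hr1
      rw [this]; ring
  · simp only
    rw [Bounds.X_eq hL hU, ← hr, Real.sqrt_eq_rpow]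
    have hp2 : 0 < r ^ (1 / 2 : ℝ) := by positivity
    refine ⟨by positivity, ?_, ?_⟩
    · have : r ^ (1 / 2 : ℝ) ≤ 1 := Real.rpow_le_one h1.le (by linarith) (by norm_num)
      nlinarith
    · rw [div_mul_cancel_right₀ hU0.ne']
      gcongr ?_⁻¹
      exact Real.rpow_le_rpow_of_exponent_ge h1 (by linarith) (by norm_num)

lemma bounds_zero_pos (hk : 2 ≤ k) (hM : 1 ≤ M) :
    0 < (bounds 𝓑 w k M 0).L ∧ (bounds 𝓑 w k M 0).L ≤ (bounds 𝓑 w k M 0).U ∧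
      (bounds 𝓑 w k M 0).U / (bounds 𝓑 w k M 0).L = M := by
  have hk' : (2 : ℝ) ≤ k := by exact_mod_cast hk
  have : (0 : ℝ) < k - 1 := by linarith
  simp only [bounds]
  refine ⟨this, by nlinarith, by field_simp⟩

lemma bounds_spec (hk : 2 ≤ k) (hM : 1 ≤ M) {i : ℕ}
    (h : ∀ j < i, 2 * (bounds 𝓑 w k M j).L < (bounds 𝓑 w k M j).U) :
    0 < (bounds 𝓑 w k M i).L ∧ (bounds 𝓑 w k M i).L ≤ (bounds 𝓑 w k M i).U ∧
      (bounds 𝓑 w k M i).U / (bounds 𝓑 w k M i).L ≤ M ^ ((2 / 3 : ℝ) ^ i) := by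
  induction i with
  | zero => simpa using ⟨(bounds_zero_pos hk hM).1, (bounds_zero_pos hk hM).2.1,
      (bounds_zero_pos hk hM).2.2.le⟩
  | succ i ih =>
    obtain ⟨h1, h2, h3⟩ := ih fun j hj => h j (by omega)
    obtain ⟨h4, h5, h6⟩ := loopStep_spec 𝓑 w k h1 (h i (by omega))
    refine ⟨h4, h5, h6.trans ?_⟩
    rw [pow_succ, Real.rpow_mul (by linarith)]
    exact Real.rpow_le_rpow (div_nonneg (h1.le.trans h2) h1.le) h3 (by norm_num)

/-- The ratio `U / L` is at most `2` after `O(log log M)` iterations. -/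
lemma exists_iterations_bound : ∃ C : ℝ, 0 ≤ C ∧ ∀ M : ℝ, 1 ≤ M →
    ∃ T : ℕ, (T : ℝ) ≤ C * logLog M ∧ M ^ ((2 / 3 : ℝ) ^ T) ≤ 2 := by
  have hl2 : 0 < Real.log 2 := Real.log_pos (by norm_num)
  have hl32 : 0 < Real.log (3 / 2) := Real.log_pos (by norm_num)
  set c := 1 / Real.log (3 / 2) with hc
  have hc0 : 0 < c := by positivity
  refine ⟨c * (1 + |Real.log (Real.log 2)|) + 1, by positivity, fun M hM => ?_⟩
  have hll1 : 1 ≤ logLog M := le_max_left _ _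
  have hll2 : Real.log (Real.log M) ≤ logLog M := le_max_right _ _
  by_cases hM2 : M ≤ 2
  · refine ⟨0, ?_, by simpa using hM2⟩
    have : 0 ≤ logLog M := by linarith
    rw [Nat.cast_zero]
    positivity
  have hM2 : 2 < M := not_le.1 hM2
  have hlM : 0 < Real.log M := Real.log_pos (by linarith)
  set a := c * (Real.log (Real.log M) - Real.log (Real.log 2)) with ha
  have ha0 : 0 ≤ a := by
    refine mul_nonneg hc0.le (sub_nonneg.2 ?_)
    exact Real.log_le_log hl2 (Real.log_le_log (by norm_num) hM2.le)
  refine ⟨⌈a⌉₊, ?_, ?_⟩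
  · have h1 := (Nat.ceil_lt_add_one ha0).le
    have h2 := neg_abs_le (Real.log (Real.log 2))
    have h3 := abs_nonneg (Real.log (Real.log 2))
    have h4 : a ≤ c * (logLog M + |Real.log (Real.log 2)|) := by
      rw [ha]; gcongr; linarith
    have h5 : c * (logLog M + |Real.log (Real.log 2)|) + 1 ≤
        (c * (1 + |Real.log (Real.log 2)|) + 1) * logLog M := by
      have : c * |Real.log (Real.log 2)| * 1 ≤ c * |Real.log (Real.log 2)| * logLog M := by gcongr
      nlinarith
    linarith
  · have h1 := Nat.le_ceil a
    rw [← Real.log_le_log_iff (by positivity) (by norm_num), Real.log_rpow (by linarith)]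
    rw [← Real.log_le_log_iff (by positivity) hl2, Real.log_mul (by positivity) hlM.ne',
      Real.log_pow, show (2 / 3 : ℝ) = (3 / 2)⁻¹ by norm_num, Real.log_inv]
    have h2 : a * Real.log (3 / 2) ≤ (⌈a⌉₊ : ℝ) * Real.log (3 / 2) := by gcongr
    have h3 : a * Real.log (3 / 2) = Real.log (Real.log M) - Real.log (Real.log 2) := by
      rw [ha, hc]; field_simp
    linarith

/-- The loop stops, since `U / L ≤ M ^ ((2 / 3) ^ i)` as long as it runs. -/
lemma exists_loopRuns (hk : 2 ≤ k) (hM : 1 ≤ M) (𝓑 : Subroutine V) (w : V → V → ℝ) {T : ℕ}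
    (hT : M ^ ((2 / 3 : ℝ) ^ T) ≤ 2) : ∃ t ≤ T, LoopRuns 𝓑 w k M t := by
  classical
  have hex : ∃ t, (bounds 𝓑 w k M t).U ≤ 2 * (bounds 𝓑 w k M t).L := by
    by_contra! hn
    obtain ⟨h1, h2, h3⟩ := bounds_spec (𝓑 := 𝓑) (w := w) hk hM (i := T) fun j _ => hn j
    have h4 := h3.trans hT
    rw [div_le_iff₀ h1] at h4
    linarith [hn T]
  refine ⟨Nat.find hex, ?_, fun i hi => not_le.1 (Nat.find_min hex hi), Nat.find_spec hex⟩
  by_contra! hn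
  obtain ⟨h1, h2, h3⟩ := bounds_spec (𝓑 := 𝓑) (w := w) hk hM (i := T)
    fun j hj => not_le.1 (Nat.find_min hex (hj.trans hn))
  have h4 := h3.trans hT
  rw [div_le_iff₀ h1] at h4
  exact Nat.find_min hex hn h4

lemma LoopRuns.unique {t t' : ℕ} (h : LoopRuns 𝓑 w k M t) (h' : LoopRuns 𝓑 w k M t') : t = t' := by
  rcases lt_trichotomy t t' with h1 | h1 | h1
  · linarith [h'.1 t h1, h.2]
  · exact h1
  · linarith [h.1 t' h1, h'.2]

lemma LoopRuns.bounds_spec (hk : 2 ≤ k) (hM : 1 ≤ M) {t i : ℕ} (h : LoopRuns 𝓑 w k M t)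
    (hi : i ≤ t) : 0 < (bounds 𝓑 w k M i).L ∧ (bounds 𝓑 w k M i).L ≤ (bounds 𝓑 w k M i).U :=
  have := KPath.bounds_spec (𝓑 := 𝓑) (w := w) hk hM (i := i) fun j hj => h.1 j (by omega)
  ⟨this.1, this.2.1⟩

/-- Rounding changes the weight of a path by less than `s` per edge. -/
lemma pathWeight_scaled {s : ℝ} (hs : 0 < s) {P : List V} (hP : P.IsChain G.Adj)
    (hw : ∀ i j, G.Adj i j → 0 ≤ w i j) :
    s * (pathWeight (scaled w s) P : ℕ) ≤ pathWeight w P ∧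
      pathWeight w P ≤ s * (pathWeight (scaled w s) P : ℕ) + s * (P.length - 1 : ℕ) := by
  induction P with
  | nil => simp [pathWeight]
  | cons a P ih =>
    cases P with
    | nil => simp [pathWeight]
    | cons b P =>
      obtain ⟨hab, hP⟩ := List.isChain_cons_cons.1 hP
      obtain ⟨h1, h2⟩ := ih hP
      have hfl := Nat.floor_le (div_nonneg (hw a b hab) hs.le)
      have hfl' := (Nat.lt_floor_add_one (w a b / s)).le
      rw [le_div_iff₀ hs] at hfl
      rw [div_le_iff₀ hs] at hfl'
      simp only [pathWeight, List.tail_cons, List.zipWith_cons_cons, List.sum_cons, List.length_cons,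
        Nat.add_sub_cancel, scaled] at h1 h2 ⊢
      push_cast at h1 h2 ⊢
      constructor <;> nlinarith

/-- The initial bounds are valid, as each edge has a weight in `[1, M]`. -/
lemma pathWeight_mem_bounds {P : List V} (hP : P.IsChain G.Adj)
    (hw : ∀ i j, G.Adj i j → 1 ≤ w i j ∧ w i j ≤ M) :
    ((P.length - 1 : ℕ) : ℝ) ≤ pathWeight w P ∧ pathWeight w P ≤ ((P.length - 1 : ℕ) : ℝ) * M := by
  induction P with
  | nil => simp [pathWeight]
  | cons a P ih =>
    cases P with
    | nil => simp [pathWeight]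
    | cons b P =>
      obtain ⟨hab, hP⟩ := List.isChain_cons_cons.1 hP
      obtain ⟨h1, h2⟩ := ih hP
      have h3 := hw a b hab
      simp only [pathWeight, List.tail_cons, List.zipWith_cons_cons, List.sum_cons, List.length_cons,
        Nat.add_sub_cancel] at h1 h2 ⊢
      push_cast at h1 h2 ⊢
      constructor <;> nlinarith

lemma natCast_sub_one (hk : 2 ≤ k) : ((k - 1 : ℕ) : ℝ) = (k : ℝ) - 1 := by
  rw [Nat.cast_sub (by omega), Nat.cast_one]

/-- With an exact subroutine, `L ≤ w(OPT) ≤ U` throughout. -/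
lemma bounds_contain_opt (hk : 2 ≤ k) (hM : 1 ≤ M)
    (hw : ∀ i j, G.Adj i j → 1 ≤ w i j ∧ w i j ≤ M) (h𝓑 : 𝓑.Exact G k) {P : List V}
    (hP : IsMinKPath G w k P) {t : ℕ} (ht : LoopRuns 𝓑 w k M t) {i : ℕ} (hi : i ≤ t) :
    (bounds 𝓑 w k M i).L ≤ pathWeight w P ∧ pathWeight w P ≤ (bounds 𝓑 w k M i).U := by
  have hk1 : (0 : ℝ) < (k : ℝ) - 1 := by
    have : (2 : ℝ) ≤ k := by exact_mod_cast hk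
    linarith
  have hw0 : ∀ i j, G.Adj i j → 0 ≤ w i j := fun i j h => by linarith [(hw i j h).1]
  induction i with
  | zero =>
    have := pathWeight_mem_bounds hP.1.2.2 hw
    rw [hP.1.1, natCast_sub_one hk] at this
    exact this
  | succ i ih =>
    obtain ⟨h1, h2⟩ := ih (by omega)
    have hL := (ht.bounds_spec hk hM (i := i) (by omega)).1
    have hU := ht.1 i (by omega)
    set b := bounds 𝓑 w k M i with hb
    have hδ := Bounds.δ_pos hL hU
    have hU0 : 0 < b.U := by linarith
    set s : ℝ := b.δ * b.U / ((k : ℝ) - 1) with hs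
    have hs0 : 0 < s := by positivity
    have hsk : s * ((k : ℝ) - 1) = b.δ * b.U := by rw [hs]; field_simp
    have hans := h𝓑 (scaled w s) (b.X / s)
    change (loopStep 𝓑 w k b).L ≤ _ ∧ _ ≤ (loopStep 𝓑 w k b).U
    unfold loopStep
    simp only
    rw [← hs]
    cases hout : 𝓑 (scaled w s) (b.X / s) with
    | none =>
      rw [hout] at hans
      have h3 := hans P hP.1
      rw [div_lt_iff₀' hs0] at h3
      have h4 := (pathWeight_scaled hs0 hP.1.2.2 hw0).1
      simpa using ⟨by linarith, h2⟩
    | some Q =>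
      rw [hout] at hans
      obtain ⟨hQ, h3, -⟩ := hans
      rw [le_div_iff₀' hs0] at h3
      have h4 := (pathWeight_scaled hs0 hQ.2.2 hw0).2
      rw [hQ.1, natCast_sub_one hk] at h4
      have h5 := hP.2 Q hQ
      simpa using ⟨h1, by linarith⟩

lemma exists_isMinKPath {n : ℕ} {G : Digraph (Fin n)} (w : Fin n → Fin n → ℝ) {Q : List (Fin n)}
    (hQ : IsKPath G k Q) : ∃ P, IsMinKPath G w k P := by
  have hfin : {P | IsKPath G k P}.Finite :=
    (List.finite_length_eq (Fin n) k).subset fun P hP => hP.1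
  obtain ⟨P, hP, hmin⟩ := Set.exists_min_image _ (pathWeight w) hfin ⟨Q, hQ⟩
  exact ⟨P, hP, hmin⟩

lemma finalAnswer_isApproxAnswer {n : ℕ} {G : Digraph (Fin n)} {w : Fin n → Fin n → ℝ}
    {𝓑 : Subroutine (Fin n)} (h : IsInstance G w k M ε) (h𝓑 : 𝓑.Exact G k) {t : ℕ}
    (ht : LoopRuns 𝓑 w k M t) : IsApproxAnswer G w k ε (finalAnswer 𝓑 w k M ε t) := by
  obtain ⟨-, hk, hM, hε, hw⟩ := h
  have hk1 : (0 : ℝ) < (k : ℝ) - 1 := by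
    have : (2 : ℝ) ≤ k := by exact_mod_cast hk
    linarith
  have hw0 : ∀ i j, G.Adj i j → 0 ≤ w i j := fun i j h => by linarith [(hw i j h).1]
  have hL := (ht.bounds_spec hk hM le_rfl).1
  unfold finalAnswer
  simp only
  set b := bounds 𝓑 w k M t with hb
  set s : ℝ := ε * b.L / ((k : ℝ) - 1) with hs
  have hs0 : 0 < s := by positivity
  have hsk : s * ((k : ℝ) - 1) = ε * b.L := by rw [hs]; field_simp
  have hans := h𝓑 (scaled w s) (b.U / s)
  cases hout : 𝓑 (scaled w s) (b.U / s) with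
  | none =>
    rw [hout] at hans
    intro Q hQ
    obtain ⟨P, hP⟩ := exists_isMinKPath w hQ
    have h1 := bounds_contain_opt hk hM hw h𝓑 hP ht le_rfl
    have h3 := hans P hP.1
    rw [div_lt_iff₀' hs0] at h3
    have h4 := (pathWeight_scaled hs0 hP.1.2.2 hw0).1
    linarith [h1.2]
  | some P =>
    rw [hout] at hans
    obtain ⟨hP, -, hmin⟩ := hans
    refine ⟨hP, fun Q hQ => ?_⟩
    obtain ⟨P₀, hP₀⟩ := exists_isMinKPath w hQ
    have h1 := (bounds_contain_opt hk hM hw h𝓑 hP₀ ht le_rfl).1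
    have h2 := hP₀.2 Q hQ
    have h3 := (pathWeight_scaled hs0 hP.2.2 hw0).2
    have h4 := (pathWeight_scaled hs0 hQ.2.2 hw0).1
    have h5 : ((pathWeight (scaled w s) P : ℕ) : ℝ) ≤ (pathWeight (scaled w s) Q : ℕ) := by
      exact_mod_cast hmin Q hQ
    rw [hP.1, natCast_sub_one hk, hsk] at h3
    have h6 := mul_le_mul_of_nonneg_left h5 hs0.le
    have h7 : ε * b.L ≤ ε * pathWeight w Q := by gcongr; linarith
    linarith

/-- The run of the loop depends only on whether the subroutine returns a path. -/
lemma bounds_congr {𝓑' : Subroutine V} {t : ℕ}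
    (h : ∀ i < t, let b := bounds 𝓑 w k M i; let s : ℝ := b.δ * b.U / ((k : ℝ) - 1);
      (𝓑 (scaled w s) (b.X / s)).isSome = (𝓑' (scaled w s) (b.X / s)).isSome) {i : ℕ} (hi : i ≤ t) :
    bounds 𝓑' w k M i = bounds 𝓑 w k M i := by
  induction i with
  | zero => rfl
  | succ i ih =>
    have h1 := h i hi
    simp only at h1
    simp only [bounds, ih (by omega), loopStep, h1]

/-- Two correct answers may be different paths, but one is a path if and only if the other is. -/
lemma IsBoundedAnswer.isSome_eq {w' : V → V → ℕ} {B : ℝ} {o o' : Option (List V)}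
    (h : IsBoundedAnswer G k w' B o) (h' : IsBoundedAnswer G k w' B o') : o.isSome = o'.isSome := by
  cases o <;> cases o' <;> simp only [Option.isSome_none, Option.isSome_some]
  · exact absurd (h _ h'.1) (not_lt.2 h'.2.1)
  · exact absurd (h' _ h.1) (not_lt.2 h.2.1)

/-- The bounds of the integer problems are `O(k)` in the main loop. -/
lemma Bounds.X_div_le {b : Bounds} (hL : 0 < b.L) (hU : 2 * b.L < b.U) (hk : 2 ≤ k) :
    0 < b.δ * b.U / ((k : ℝ) - 1) ∧ 0 ≤ b.X / (b.δ * b.U / ((k : ℝ) - 1)) ∧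
      b.X / (b.δ * b.U / ((k : ℝ) - 1)) ≤ 9 * k := by
  obtain ⟨h1, h2⟩ := div_pos_and_lt_half hL hU
  have hk1 : (0 : ℝ) < (k : ℝ) - 1 := by
    have : (2 : ℝ) ≤ k := by exact_mod_cast hk
    linarith
  have hδ := Bounds.δ_pos hL hU
  have hU0 : 0 < b.U := by linarith
  have hX0 : 0 ≤ b.X := Real.sqrt_nonneg _
  refine ⟨by positivity, by positivity, ?_⟩
  rw [div_le_iff₀ (by positivity), Bounds.X_eq hL hU, Bounds.δ, Real.sqrt_eq_rpow]
  set r := b.L / b.U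
  -- with `q`, the numbers `X = q ^ 3 U` and `δ U = (q ^ 2 - q ^ 3) U` become polynomial
  set q := r ^ (1 / 6 : ℝ) with hq
  have hq0 : 0 < q := by positivity
  have e2 : r ^ (1 / 3 : ℝ) = q ^ 2 := by
    rw [hq, ← Real.rpow_natCast, ← Real.rpow_mul h1.le]; norm_num
  have e3 : r ^ (1 / 2 : ℝ) = q ^ 3 := by
    rw [hq, ← Real.rpow_natCast, ← Real.rpow_mul h1.le]; norm_num
  have e6 : q ^ 6 = r := by
    rw [hq, ← Real.rpow_natCast, ← Real.rpow_mul h1.le]; norm_num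
  rw [e2, e3]
  -- `r < 1 / 2 < (9 / 10) ^ 6`, and `X / (δ U) = q / (1 - q)`
  have hq9 : q ≤ 9 / 10 := by
    by_contra! hn
    have : (9 / 10 : ℝ) ^ 6 < q ^ 6 := by gcongr
    norm_num at this
    linarith
  have h10 : q ^ 3 ≤ 9 * (q ^ 2 - q ^ 3) := by nlinarith [pow_pos hq0 2]
  have hkk : 1 ≤ (k : ℝ) / ((k : ℝ) - 1) := by rw [one_le_div hk1]; linarith
  have h11 : 0 ≤ 9 * (q ^ 2 - q ^ 3) * b.U := by nlinarith [pow_pos hq0 3]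
  calc q ^ 3 * b.U ≤ 9 * (q ^ 2 - q ^ 3) * b.U := by gcongr
    _ ≤ 9 * (q ^ 2 - q ^ 3) * b.U * ((k : ℝ) / ((k : ℝ) - 1)) := le_mul_of_one_le_right h11 hkk
    _ = _ := by ring

/-- The bound of the last integer problem is `O(k / ε)`. -/
lemma Bounds.U_div_le {b : Bounds} (hL : 0 < b.L) (hLU : b.L ≤ b.U) (hU : b.U ≤ 2 * b.L)
    (hk : 2 ≤ k) (hε : 0 < ε) : 0 < ε * b.L / ((k : ℝ) - 1) ∧
      0 ≤ b.U / (ε * b.L / ((k : ℝ) - 1)) ∧ b.U / (ε * b.L / ((k : ℝ) - 1)) ≤ 2 * k * (1 / ε) := by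
  have hk1 : (0 : ℝ) < (k : ℝ) - 1 := by
    have : (2 : ℝ) ≤ k := by exact_mod_cast hk
    linarith
  have hU0 : 0 < b.U := by linarith
  refine ⟨by positivity, by positivity, ?_⟩
  rw [div_le_iff₀ (by positivity)]
  have hkk : 1 ≤ (k : ℝ) / ((k : ℝ) - 1) := by rw [one_le_div hk1]; linarith
  calc b.U ≤ 2 * b.L := hU
    _ ≤ 2 * b.L * ((k : ℝ) / ((k : ℝ) - 1)) := le_mul_of_one_le_right (by linarith) hkk
    _ = _ := by field_simp

end Scaling

/-! ### The table of the sums over walks -/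

section Notation

instance : Add NExp := ⟨.add⟩
instance : Sub NExp := ⟨.sub⟩
instance : Mul NExp := ⟨.mul⟩
instance : Div NExp := ⟨.div⟩
instance : Mod NExp := ⟨.mod⟩
instance : Add RExp := ⟨.add⟩
instance : Sub RExp := ⟨.sub⟩
instance : Mul RExp := ⟨.mul⟩
instance : Div RExp := ⟨.div⟩

/-- A natural-number register. -/
abbrev nv (x : ℕ) : NExp := .var x
/-- A natural-number constant. -/
abbrev nc (c : ℕ) : NExp := .const c
/-- An entry of a natural-number array. -/
abbrev na (a : ℕ) (e : NExp) : NExp := .get a e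
/-- A real register. -/
abbrev rv (x : ℕ) : RExp := .var x
/-- A constant as a real number. -/
abbrev rc (c : ℕ) : RExp := .ofNat (.const c)
/-- An entry of a real array. -/
abbrev ra (a : ℕ) (e : NExp) : RExp := .get a e

/-- Sequential composition of programs. -/
infixr:30 " ;; " => Prog.seq

variable (s : Store) (e f : NExp) (g h : RExp)

@[simp] lemma NExp.eval_add : (e + f).eval s = e.eval s + f.eval s := rfl
@[simp] lemma NExp.eval_sub : (e - f).eval s = e.eval s - f.eval s := rfl
@[simp] lemma NExp.eval_mul : (e * f).eval s = e.eval s * f.eval s := rfl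
@[simp] lemma NExp.eval_div : (e / f).eval s = e.eval s / f.eval s := rfl
@[simp] lemma NExp.eval_mod : (e % f).eval s = e.eval s % f.eval s := rfl
@[simp] lemma NExp.eval_var (x : ℕ) : (NExp.var x).eval s = s.nvar x := rfl
@[simp] lemma NExp.eval_const (c : ℕ) : (NExp.const c).eval s = c := rfl
@[simp] lemma NExp.eval_get (a : ℕ) : (NExp.get a e).eval s = s.narr a (e.eval s) := rfl
@[simp] lemma RExp.eval_add : (g + h).eval s = g.eval s + h.eval s := rfl
@[simp] lemma RExp.eval_sub : (g - h).eval s = g.eval s - h.eval s := rfl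
@[simp] lemma RExp.eval_mul : (g * h).eval s = g.eval s * h.eval s := rfl
@[simp] lemma RExp.eval_div : (g / h).eval s = g.eval s / h.eval s := rfl
@[simp] lemma RExp.eval_var (x : ℕ) : (RExp.var x).eval s = s.rvar x := rfl
@[simp] lemma RExp.eval_ofNat : (RExp.ofNat e).eval s = e.eval s := rfl
@[simp] lemma RExp.eval_get (a : ℕ) : (RExp.get a e).eval s = s.rarr a (e.eval s) := rfl
@[simp] lemma RExp.eval_sqrt : (RExp.sqrt g).eval s = Real.sqrt (g.eval s) := rfl
@[simp] lemma RExp.eval_cbrt : (RExp.cbrt g).eval s = (max (g.eval s) 0) ^ (1 / 3 : ℝ) := rfl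
@[simp] lemma Test.holds_nlt : (Test.nlt e f).Holds s ↔ e.eval s < f.eval s := Iff.rfl
@[simp] lemma Test.holds_neq : (Test.neq e f).Holds s ↔ e.eval s = f.eval s := Iff.rfl
@[simp] lemma Test.holds_rlt : (Test.rlt g h).Holds s ↔ g.eval s < h.eval s := Iff.rfl
@[simp] lemma Test.holds_not (b : Test) : (Test.not b).Holds s ↔ ¬ b.Holds s := Iff.rfl
@[simp] lemma Test.holds_and (b c : Test) :
    (Test.and b c).Holds s ↔ b.Holds s ∧ c.Holds s := Iff.rfl

end Notation

/-- Adds the contribution of the predecessor `u` to the partial sum, in the notation of `cellProg`.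
-/
def edgeProg : Prog :=
  .ite (.and (.neq (na 0 (nv 0 * nv 6 + nv 10)) (nc 1))
      (.not (.nlt (nv 9) (na 3 (nv 0 * nv 6 + nv 10)))))
    (.rset 6 (rv 6 + rv 7 * ra 1 (nv 0 * nv 1 + nv 10 * nv 1 + nv 5) *
      ra 2 ((((nv 11 - nc 1) * nv 0 + nv 6) * (nv 3 + nc 1) +
        (nv 9 - na 3 (nv 0 * nv 6 + nv 10))) * nv 2 + (nv 8 - nv 7))))
    .skip

/-- Adds the terms of the exterior product that belong to the basis vector `j`, in the notation of
`cellProg`. -/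
def bitProg : Prog :=
  .ite (.neq ((nv 8 / nv 7) % nc 2) (nc 1))
      (.ite (.neq (nv 11) (nc 0))
          (.ite (.and (.neq (nv 9) (nc 0)) (.neq (nv 8) (nv 7)))
            (.rset 6 (rv 6 + rv 7 * ra 1 (nv 0 * nv 1 + nv 10 * nv 1 + nv 5))) .skip)
          (.for 6 (nv 0) edgeProg) ;;
        .rset 7 (rc 0 - rv 7))
      .skip ;;
  .nset 7 (nv 7 + nv 7)

/-- Entry `m` of the table, whose index `m = ((i n + v) (D + 1) + d) 2ᵏ + S` stands for the position
`i`, the vertex `v`, the weight `d` and the bit mask `S`. Registers `0`, …, `4` hold `n`, `k`, `2ᵏ`,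
`D` and `m`; the loop variables are `j` and `u` in the registers `5` and `6`; register `7` holds
`2ʲ`, and `8`, …, `11` hold `S`, `d`, `v`, `i`. The real registers `6` and `7` hold the partial sum
and the sign. The arrays `0` and `3` hold the adjacency matrix and the integer weights, the real
array `1` the random point, and `2` the table. Row `i` of `x` is restricted to the vertices from
entry `i` of array `1` up to entry `i` of array `2`. -/
def cellProg : Prog :=
  (.nset 8 (nv 4 % nv 2) ;;
    .nset 9 ((nv 4 / nv 2) % (nv 3 + nc 1)) ;;
    .nset 10 ((nv 4 / (nv 2 * (nv 3 + nc 1))) % nv 0) ;;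
    .nset 11 (nv 4 / (nv 2 * (nv 3 + nc 1) * nv 0)) ;;
    .rset 6 (rc 0) ;; .rset 7 (rc 1) ;; .nset 7 (nc 1)) ;;
  .for 5 (nv 1) bitProg ;;
  .ite (.and (.not (.nlt (nv 10) (na 1 (nv 11)))) (.nlt (nv 10) (na 2 (nv 11))))
    (.rput 2 (nv 4) (rv 6 * ra 1 (nv 10 * nv 1 + nv 11)))
    (.rput 2 (nv 4) (rc 0))

/-- The adjacency relation that is stored in memory. -/
def Store.adj (s : Store) (n u v : ℕ) : Prop := s.narr 0 (n * u + v) = 1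

/-- The integer weights that are stored in memory. -/
def Store.wt (s : Store) (n u v : ℕ) : ℕ := s.narr 3 (n * u + v)

/-- The scalars `x v i` at the point that is stored in memory, replaced by `0` unless `v` lies in
the interval of vertices that the memory allows at position `i`. -/
noncomputable def Store.xs (s : Store) (k v i : ℕ) : ℝ :=
  if s.narr 1 i ≤ v ∧ v < s.narr 2 i then s.rarr 1 (v * k + i) else 0

/-- The coordinates of the vectors `y v` at the point that is stored in memory. -/
def Store.ys (s : Store) (n k v j : ℕ) : ℝ := s.rarr 1 (n * k + v * k + j)

/-- The table `tab` for the data in memory. -/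
noncomputable def Store.tab (s : Store) (n k : ℕ) : ℕ → ℕ → ℕ → ℕ → ℝ :=
  KPath.tab n k (s.adj n) (s.wt n) (s.xs k) (s.ys n k)

/-- The top coefficient `topSum` for the data in memory. -/
noncomputable def Store.topSum (s : Store) (n k d : ℕ) : ℝ :=
  KPath.topSum n k (s.adj n) (s.wt n) (s.xs k) (s.ys n k) d

open scoped Classical in
/-- The factor of `tab i v d` without the last vertex. -/
noncomputable def Store.inner (s : Store) (n k : ℕ) : ℕ → ℕ → ℕ → ℕ → ℝ
  | 0, _, d => fun T => if d = 0 ∧ T = 0 then 1 else 0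
  | i + 1, v, d => ∑ u ∈ Finset.range n,
      if s.adj n u v ∧ s.wt n u v ≤ d then s.tab n k i u (d - s.wt n u v) else 0

lemma Store.tab_eq (s : Store) (n k i v d : ℕ) :
    s.tab n k i v d = s.xs k v i • wedge k (s.ys n k v) (s.inner n k i v d) := by
  cases i <;> rfl

/-- The registers that hold `n`, `k`, `2ᵏ` and `D`. -/
structure Params (s : Store) (n k D : ℕ) : Prop where
  hn : s.nvar 0 = n
  hk : s.nvar 1 = k
  hP : s.nvar 2 = 2 ^ k
  hD : s.nvar 3 = D

/-- The value of the table entry with index `m = ((i n + v) (D + 1) + d) 2ᵏ + S`. -/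
noncomputable def Store.cell (s : Store) (n k D m : ℕ) : ℝ :=
  s.tab n k (m / (2 ^ k * (D + 1) * n)) (m / (2 ^ k * (D + 1)) % n) (m / 2 ^ k % (D + 1))
    (m % 2 ^ k)

lemma decode_index {n E P i v d S : ℕ} (hS : S < P) (hd : d < E) (hv : v < n) :
    (((i * n + v) * E + d) * P + S) % P = S ∧ (((i * n + v) * E + d) * P + S) / P % E = d ∧
      (((i * n + v) * E + d) * P + S) / (P * E) % n = v ∧
      (((i * n + v) * E + d) * P + S) / (P * E * n) = i := by
  have hP : 0 < P := by omega
  have hE : 0 < E := by omega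
  have hn : 0 < n := by omega
  have h1 : (((i * n + v) * E + d) * P + S) / P = (i * n + v) * E + d := by
    rw [mul_comm, Nat.mul_add_div hP, Nat.div_eq_of_lt hS, add_zero]
  have h2 : ((i * n + v) * E + d) / E = i * n + v := by
    rw [mul_comm, Nat.mul_add_div hE, Nat.div_eq_of_lt hd, add_zero]
  rw [← Nat.div_div_eq_div_mul, ← Nat.div_div_eq_div_mul, h1, h2]
  refine ⟨?_, ?_, ?_, ?_⟩
  · rw [mul_comm, Nat.mul_add_mod, Nat.mod_eq_of_lt hS]
  · rw [mul_comm, Nat.mul_add_mod, Nat.mod_eq_of_lt hd]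
  · rw [mul_comm, Nat.mul_add_mod, Nat.mod_eq_of_lt hv]
  · rw [← Nat.div_div_eq_div_mul, h1, h2, mul_comm, Nat.mul_add_div hn, Nat.div_eq_of_lt hv,
      add_zero]

lemma Store.cell_index (s : Store) {n k D i v d S : ℕ} (hS : S < 2 ^ k) (hd : d ≤ D) (hv : v < n) :
    s.cell n k D (((i * n + v) * (D + 1) + d) * 2 ^ k + S) = s.tab n k i v d S := by
  obtain ⟨h1, h2, h3, h4⟩ := decode_index (i := i) hS (Nat.lt_succ_of_le hd) hv
  rw [Store.cell, h1, h2, h3, h4]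

section

variable {ρ : ℕ → Bool} {β : ℕ} {s s₀ : Store} {n k D : ℕ}

/-- The invariant while entry `m` of the table is computed: the registers hold the data of the
entry, and all earlier entries have been filled in. The memory `s₀` is the one at the start of the
computation of the table. -/
structure AtCell (s s₀ : Store) (n k D m i v d S : ℕ) : Prop where
  params : Params s n k D
  hS : s.nvar 8 = S
  hd : s.nvar 9 = d
  hv : s.nvar 10 = v
  hi : s.nvar 11 = i
  hm : s.nvar 4 = m
  narr : s.narr = s₀.narr
  rarr : s.rarr 1 = s₀.rarr 1
  tab : ∀ m' < m, s.rarr 2 m' = s₀.cell n k D m'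

lemma AtCell.of_agree {p : Prog} {s' : Store} {m i v d S : ℕ} (h : AtCell s s₀ n k D m i v d S)
    (hA : Agree p s s') (h0 : ∀ x ∈ [0, 1, 2, 3, 4, 8, 9, 10, 11], x ∉ p.nW)
    (h1 : p.naW = []) (h2 : p.raW = []) : AtCell s' s₀ n k D m i v d S := by
  obtain ⟨⟨a1, a2, a3, a4⟩, a5, a6, a7, a8, a9, a10, a11, a12⟩ := h
  have e : ∀ x ∈ [0, 1, 2, 3, 4, 8, 9, 10, 11], s'.nvar x = s.nvar x := fun x hx =>
    hA.n x (h0 x hx)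
  simp only [List.forall_mem_cons] at e
  obtain ⟨e0, e1, e2, e3, e4, e8, e9, e10, e11, -⟩ := e
  refine ⟨⟨e0 ▸ a1, e1 ▸ a2, e2 ▸ a3, e3 ▸ a4⟩, e8 ▸ a5, e9 ▸ a6, e10 ▸ a7, e11 ▸ a8, e4 ▸ a9, ?_,
    ?_, ?_⟩
  · rw [← a10]; ext1 a; exact hA.na a (by simp [h1])
  · rw [← a11]; exact hA.ra 1 (by simp [h2])
  · rw [hA.ra 2 (by simp [h2])]; exact a12

open scoped Classical in
lemma edgeProg_spec (hβ : 1 ≤ β) (hs : s.Bdd β) {m i v d S j u : ℕ} {acc sg : ℝ}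
    (h : AtCell s s₀ n k D m (i + 1) v d S)
    (hm : m = (((i + 1) * n + v) * (D + 1) + d) * 2 ^ k + S)
    (hu : u < n) (hd : d ≤ D) (hS : S < 2 ^ k) (hj : s.nvar 5 = j)
    (h6 : s.nvar 6 = u) (h7 : s.nvar 7 = 2 ^ j)
    (hacc : s.rvar 6 = acc) (hsg : s.rvar 7 = sg) :
    Runs ρ β 1 edgeProg s fun s' => s'.rvar 7 = sg ∧ s'.rvar 6 = acc + sg * s₀.ys n k v j *
      (if s₀.adj n u v ∧ s₀.wt n u v ≤ d then s₀.tab n k i u (d - s₀.wt n u v) else 0)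
        (S - 2 ^ j) := by
  refine .of_wp hβ hs ?_
  simp only [edgeProg, wp, Test.holds_and, Test.holds_not, Test.holds_neq, Test.holds_nlt,
    NExp.eval_get, NExp.eval_add, NExp.eval_sub, NExp.eval_mul, NExp.eval_var, NExp.eval_const,
    RExp.eval_add, RExp.eval_mul, RExp.eval_get, RExp.eval_var, Store.setR_rvar, if_true,
    h.params.hn, h.params.hk, h.params.hP, h.params.hD, h.hS, h.hd, h.hv, h.hi, h.narr, h.rarr, hj,
    h6, h7, hacc, hsg, not_lt, Nat.add_sub_cancel]
  constructor
  · intro hc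
    have hc' : s₀.adj n u v ∧ s₀.wt n u v ≤ d := hc
    rw [if_pos hc']
    refine ⟨by simp, ?_⟩
    have hlt : ((i * n + u) * (D + 1) + (d - s₀.wt n u v)) * 2 ^ k + (S - 2 ^ j) < m := by
      have h1 : (i * n + u + 1) * (D + 1) ≤ ((i + 1) * n + v) * (D + 1) :=
        Nat.mul_le_mul_right _ (by rw [add_mul]; omega)
      have h2 : ((i * n + u) * (D + 1) + (d - s₀.wt n u v) + 1) * 2 ^ k ≤
          (((i + 1) * n + v) * (D + 1) + d) * 2 ^ k :=
        Nat.mul_le_mul_right _ (by rw [add_mul (i * n + u) 1] at h1; omega)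
      rw [add_mul _ 1, one_mul] at h2
      omega
    have h3 := h.tab _ hlt
    rw [Store.cell_index s₀ (by omega) (by omega) hu] at h3
    change acc + sg * s₀.ys n k v j * _ = _
    rw [← h3]
    rfl
  · intro hc
    have hc' : ¬ (s₀.adj n u v ∧ s₀.wt n u v ≤ d) := hc
    rw [if_neg hc']
    simp

lemma bitProg_spec (hβ : 1 ≤ β) (hs : s.Bdd β) {m i v d S j : ℕ} {acc : ℝ}
    (h : AtCell s s₀ n k D m i v d S) (hm : m = ((i * n + v) * (D + 1) + d) * 2 ^ k + S)
    (hd : d ≤ D) (hS : S < 2 ^ k) (hjk : j < k) (hj : s.nvar 5 = j)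
    (h7 : s.nvar 7 = 2 ^ j) (hacc : s.rvar 6 = acc) (hsg : s.rvar 7 = sgn S j) :
    Runs ρ β (n + 1) bitProg s fun s' => s'.rvar 7 = sgn S (j + 1) ∧ s'.nvar 7 = 2 ^ (j + 1) ∧
      s'.rvar 6 = acc + if S.testBit j then
        sgn S j * s₀.ys n k v j * s₀.inner n k i v d (S - 2 ^ j) else 0 := by
  have hn : n < 2 ^ β := h.params.hn ▸ hs.1 0
  have hP : 2 ^ k < 2 ^ β := h.params.hP ▸ hs.1 2
  have hpow : 2 ^ (j + 1) < 2 ^ β :=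
    (Nat.pow_le_pow_right (by norm_num) hjk).trans_lt hP
  have htest : S.testBit j = true ↔ S / 2 ^ j % 2 = 1 := by
    rw [Nat.testBit_eq_decide_div_mod_eq, decide_eq_true_iff]
  refine Runs.seq (R := fun s' => s'.nvar 7 = 2 ^ j ∧ s'.rvar 7 = sgn S (j + 1) ∧
    s'.rvar 6 = acc + if S.testBit j then
        sgn S j * s₀.ys n k v j * s₀.inner n k i v d (S - 2 ^ j) else 0) hβ ?_ ?_
  · refine Runs.ite hβ hs (by omega) (fun hb => ?_) (fun hb => ?_)
    · have hbit : S.testBit j = true := by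
        rw [htest]; simpa [h.hS, h7] using hb
      rw [if_pos hbit]
      refine Runs.seq (R := fun s' => s'.nvar 7 = 2 ^ j ∧ s'.rvar 7 = sgn S j ∧ s'.rvar 6 = acc +
        sgn S j * s₀.ys n k v j * s₀.inner n k i v d (S - 2 ^ j)) hβ ?_ ?_
      · refine Runs.ite hβ hs (by omega) (fun hb => ?_) (fun hb => ?_)
        · have hi : i = 0 := by simpa [h.hi] using hb
          subst hi
          refine (Runs.of_wp hβ hs ?_).mono (by omega) fun _ _ h => h
          simp only [wp, Test.holds_and, Test.holds_neq,
            NExp.eval_add, NExp.eval_mul, NExp.eval_var, NExp.eval_const,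
            RExp.eval_add, RExp.eval_mul, RExp.eval_get, RExp.eval_var, Store.setR_rvar, if_true,
            h.params.hn, h.params.hk, h.hS, h.hd, h.hv, h.rarr, hj, h7, hacc, hsg,
            Store.setR_nvar, Store.inner]
          have hge := Nat.ge_two_pow_of_testBit hbit
          constructor
          · rintro ⟨h1, h2⟩
            refine ⟨trivial, by simp, ?_⟩
            rw [if_pos ⟨h1, by omega⟩, mul_one]
            rfl
          · intro hc
            refine ⟨trivial, trivial, ?_⟩
            rw [if_neg fun h1 => hc ⟨h1.1, by omega⟩]
            simp
        · obtain ⟨i, rfl⟩ : ∃ i', i = i' + 1 := by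
            refine Nat.exists_eq_succ_of_ne_zero ?_
            simpa [h.hi] using hb
          refine (Runs.for (N := 1) (T := n) (fun u s' => s'.rvar 7 = sgn S j ∧ s'.rvar 6 = acc +
            sgn S j * s₀.ys n k v j * ∑ u ∈ Finset.range u,
              (open scoped Classical in if s₀.adj n u v ∧ s₀.wt n u v ≤ d then
                s₀.tab n k i u (d - s₀.wt n u v) else 0) (S - 2 ^ j)) hβ hs le_rfl hn
            (by decide) ?_ ?_ ?_).agree.mono (by omega) ?_
          · intro s' hA
            rw [NExp.eval_var, hA.n 0 (by decide), h.params.hn]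
          · simp [hsg, hacc]
          · intro u hu s' hs' hA hu6 ⟨h1, h2⟩
            have hat := h.of_agree hA (by decide) (by decide) (by decide)
            refine (edgeProg_spec hβ hs' hat hm hu hd hS ((hA.n 5 (by decide)).trans hj) hu6
              ((hA.n 7 (by decide)).trans h7) h2 h1).mono le_rfl ?_
            rintro s'' - ⟨h3, h4⟩
            refine ⟨h3, ?_⟩
            rw [Store.setN_rvar, h4, Finset.sum_range_succ]
            ring
          · rintro s' - ⟨hA, h1, h2⟩
            refine ⟨(hA.n 7 (by decide)).trans h7, h1, ?_⟩
            rw [h2, Store.inner, Finset.sum_apply]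
      · rintro s' hs' ⟨h1, h2, h3⟩
        refine (Runs.of_wp hβ hs' ?_).mono (by omega) fun _ _ h => h
        simp [wp, h1, h2, h3, sgn, hbit]
    · have hbit : ¬ S.testBit j = true := by
        rw [htest]; simpa [h.hS, h7] using hb
      refine (Runs.of_wp hβ hs ?_).mono (by omega) fun _ _ h => h
      simp [wp, h7, hsg, hacc, sgn, hbit]
  · rintro s' hs' ⟨h1, h2, h3⟩
    refine (Runs.of_wp hβ hs' ?_).mono (by omega) fun _ _ h => h
    simp only [wp, NExp.eval_add, NExp.eval_var, h1, Store.setN_nvar, if_true, Store.setN_rvar, h2,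
      h3, and_true, true_and]
    rw [← two_mul, ← pow_succ']
    exact ⟨hpow, rfl⟩

lemma cellProg_spec (hβ : 1 ≤ β) (hs : s.Bdd β) (hp : Params s n k D) {m : ℕ} (hm : s.nvar 4 = m)
    (hn : 1 ≤ n) (hnarr : s.narr = s₀.narr) (hrarr : s.rarr 1 = s₀.rarr 1)
    (htab : ∀ m' < m, s.rarr 2 m' = s₀.cell n k D m') :
    Runs ρ β ((n + 1) * (k + 1)) cellProg s fun s' =>
      ∀ m' < m + 1, s'.rarr 2 m' = s₀.cell n k D m' := by
  have hP1 : 1 ≤ 2 ^ k := Nat.one_le_two_pow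
  have hmβ : m < 2 ^ β := hm ▸ hs.1 4
  have hk : k < 2 ^ β := hp.hk ▸ hs.1 1
  set S := m % 2 ^ k with hS
  set d := m / 2 ^ k % (D + 1) with hd
  set v := m / (2 ^ k * (D + 1)) % n with hv
  set i := m / (2 ^ k * (D + 1) * n) with hi
  have hS' : S < 2 ^ k := Nat.mod_lt _ hP1
  have hd' : d < D + 1 := Nat.mod_lt _ (by omega)
  have hv' : v < n := Nat.mod_lt _ hn
  have hmeq : m = ((i * n + v) * (D + 1) + d) * 2 ^ k + S := by
    rw [hi, hv, hd, hS, ← Nat.div_div_eq_div_mul, mul_comm _ n, Nat.div_add_mod,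
      ← Nat.div_div_eq_div_mul, mul_comm _ (D + 1), Nat.div_add_mod, mul_comm _ (2 ^ k),
      Nat.div_add_mod]
  have hdiv : ∀ a, m / a < 2 ^ β := fun a => (Nat.div_le_self _ _).trans_lt hmβ
  have hmod : ∀ a b, a < 2 ^ β → a % b < 2 ^ β := fun a b h => (Nat.mod_le _ _).trans_lt h
  refine Runs.seq (R := fun s' => AtCell s' s₀ n k D m i v d S ∧ s'.nvar 7 = 1 ∧ s'.rvar 6 = 0 ∧
    s'.rvar 7 = 1) hβ ((Runs.of_wp hβ hs ?_).mono (Nat.mul_pos (by omega) (by omega))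
      fun _ _ h => h) ?_
  · simp +decide only [wp, NExp.eval_mod, NExp.eval_div, NExp.eval_mul, NExp.eval_add, NExp.eval_var,
      NExp.eval_const, RExp.eval_ofNat, hm, hp.hn, hp.hP, hp.hD, Store.setN_nvar, if_false,
      Store.setR_nvar]
    refine ⟨hmod _ _ hmβ, hmod _ _ (hdiv _), hmod _ _ (hdiv _), hdiv _, ?_, ?_⟩
    · exact Nat.one_lt_two_pow (by omega)
    · refine ⟨⟨⟨?_, ?_, ?_, ?_⟩, ?_, ?_, ?_, ?_, ?_, ?_, ?_, ?_⟩, ?_, ?_, ?_⟩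
      all_goals simp [hm, hp.hn, hp.hk, hp.hP, hp.hD, hnarr, hrarr, hS, hd, hv, hi]
      exact htab
  rintro s₁ hs₁ ⟨hat, h7, hacc, hsg⟩
  refine Runs.seq (R := fun s' => AtCell s' s₀ n k D m i v d S ∧ s'.rvar 6 =
    wedge k (s₀.ys n k v) (s₀.inner n k i v d) S) hβ ?_ ?_
  · refine (Runs.for (N := n + 1) (T := k) (fun j s' => s'.nvar 7 = 2 ^ j ∧ s'.rvar 7 = sgn S j ∧
      s'.rvar 6 = ∑ j ∈ Finset.range j, if S.testBit j then
        sgn S j * s₀.ys n k v j * s₀.inner n k i v d (S - 2 ^ j) else 0) hβ hs₁ (by omega) hk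
      (by decide) ?_ ?_ ?_).agree.mono le_rfl ?_
    · intro s' hA
      rw [NExp.eval_var, hA.n 1 (by decide), hat.params.hk]
    · simp [h7, hacc, hsg, sgn]
    · intro j hj s' hs' hA hj5 ⟨h1, h2, h3⟩
      refine (bitProg_spec hβ hs' (hat.of_agree hA (by decide) (by decide) (by decide)) hmeq
        (by omega) hS' hj hj5 h1 h3 h2).mono le_rfl ?_
      rintro s'' - ⟨h4, h5, h6⟩
      refine ⟨?_, h4, ?_⟩
      · simpa using h5
      · rw [Store.setN_rvar, h6, Finset.sum_range_succ]
    · rintro s' - ⟨hA, h1, h2, h3⟩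
      exact ⟨hat.of_agree hA (by decide) (by decide) (by decide), h3⟩
  · rintro s₂ hs₂ ⟨hat, hacc⟩
    refine (Runs.of_wp hβ hs₂ ?_).mono (Nat.mul_pos (by omega) (by omega)) fun _ _ h => h
    have hcell : s₀.cell n k D m = s₀.xs k v i * wedge k (s₀.ys n k v) (s₀.inner n k i v d) S := by
      rw [Store.cell, Store.tab_eq]; rfl
    simp only [wp, Test.holds_and, Test.holds_not, Test.holds_nlt, NExp.eval_get, NExp.eval_var,
      hat.hv, hat.hi, hat.hm, hat.narr, not_lt, RExp.eval_mul, RExp.eval_var, RExp.eval_get, hacc,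
      NExp.eval_add, NExp.eval_mul, hat.params.hk, hat.rarr, RExp.eval_ofNat, NExp.eval_const,
      Store.putR_rarr, true_and]
    constructor <;> intro hc m' hm'
    · split_ifs with h
      · rw [h, hcell, Store.xs, if_pos hc]; ring
      · exact hat.tab m' (by omega)
    · split_ifs with h
      · rw [h, hcell, Store.xs, if_neg hc]; simp
      · exact hat.tab m' (by omega)

end

/-- Computes the table and, in the real array `3`, the sums for all weights up to `D`. -/
def evalProg : Prog :=
  .for 4 (nv 1 * nv 0 * (nv 3 + nc 1) * nv 2) cellProg ;;
  .for 9 (nv 3 + nc 1)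
    (.rset 6 (rc 0) ;;
      .for 6 (nv 0) (.rset 6 (rv 6 + ra 2 ((((nv 1 - nc 1) * nv 0 + nv 6) * (nv 3 + nc 1) + nv 9) *
        nv 2 + (nv 2 - nc 1)))) ;;
      .rput 3 (nv 9) (rv 6))

/-- The number of iterations of `evalProg`, up to a constant factor. -/
def evalBound (n k D : ℕ) : ℕ := (n + 1) * (k + 1) * (k * n * (D + 1) * 2 ^ k + 1)

section

variable {ρ : ℕ → Bool} {β : ℕ} {s s₀ : Store} {n k D : ℕ}

lemma Store.topSum_congr (hn : s.narr = s₀.narr) (hr : s.rarr 1 = s₀.rarr 1) :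
    s.topSum n k = s₀.topSum n k := by
  have h1 : s.adj n = s₀.adj n := by ext u v; simp only [Store.adj, hn]
  have h2 : s.wt n = s₀.wt n := by ext u v; simp only [Store.wt, hn]
  have h3 : s.xs k = s₀.xs k := by ext u v; simp only [Store.xs, hn, hr]
  have h4 : s.ys n k = s₀.ys n k := by ext u v; simp only [Store.ys, hr]
  ext d
  simp only [Store.topSum, h1, h2, h3, h4]

lemma Params.of_agree {p : Prog} {s' : Store} (h : Params s n k D) (hA : Agree p s s')
    (h0 : ∀ x ∈ [0, 1, 2, 3], x ∉ p.nW) : Params s' n k D := by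
  have e : ∀ x ∈ [0, 1, 2, 3], s'.nvar x = s.nvar x := fun x hx => hA.n x (h0 x hx)
  simp only [List.forall_mem_cons] at e
  obtain ⟨e0, e1, e2, e3, -⟩ := e
  exact ⟨e0 ▸ h.hn, e1 ▸ h.hk, e2 ▸ h.hP, e3 ▸ h.hD⟩

/-- The numbers that occur in `evalProg` fit into `β` bits. -/
structure Fits (β n k D : ℕ) : Prop where
  hβ : 1 ≤ β
  hn : 1 ≤ n
  hk : 2 ≤ k
  hlt : k * n * (D + 1) * 2 ^ k < 2 ^ β

lemma Fits.D_lt (h : Fits β n k D) : D + 1 < 2 ^ β := by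
  refine lt_of_le_of_lt ?_ h.hlt
  calc D + 1 = 1 * 1 * (D + 1) * 1 := by ring
    _ ≤ k * n * (D + 1) * 2 ^ k := by
      gcongr
      exacts [by linarith [h.hk], h.hn, Nat.one_le_two_pow]

lemma Fits.n_lt (h : Fits β n k D) : n < 2 ^ β := by
  refine lt_of_le_of_lt ?_ h.hlt
  calc n = 1 * n * 1 * 1 := by ring
    _ ≤ k * n * (D + 1) * 2 ^ k := by
      gcongr
      exacts [by linarith [h.hk], by omega, Nat.one_le_two_pow]

lemma evalProg_spec (hF : Fits β n k D) (hs : s.Bdd β) (hp : Params s n k D) :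
    Runs ρ β (evalBound n k D) evalProg s fun s' => ∀ d ≤ D, s'.rarr 3 d = s.topSum n k d := by
  obtain ⟨hβ, hn, hk, hlt⟩ := hF
  have hP1 : 1 ≤ 2 ^ k := Nat.one_le_two_pow
  refine Runs.seq (R := fun s' => Agree (.for 4 (nv 1 * nv 0 * (nv 3 + nc 1) * nv 2) cellProg) s s' ∧
    ∀ m < k * n * (D + 1) * 2 ^ k, s'.rarr 2 m = s.cell n k D m) hβ ?_ ?_
  · refine (Runs.for (N := (n + 1) * (k + 1)) (T := k * n * (D + 1) * 2 ^ k)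
      (fun m s' => ∀ m' < m, s'.rarr 2 m' = s.cell n k D m') hβ hs
      (Nat.mul_pos (by omega) (by omega)) hlt (by decide)
      ?_ ?_ ?_).agree
    · intro s' hA
      have hp' := hp.of_agree hA (by decide)
      simp only [NExp.eval_mul, NExp.eval_add, NExp.eval_var, NExp.eval_const, hp'.hn, hp'.hk, hp'.hP,
        hp'.hD]
    · intro m' hm'; omega
    · intro m hm s' hs' hA hm4 hJ
      refine cellProg_spec hβ hs' (hp.of_agree hA (by decide)) hm4 hn ?_ (hA.ra 1 (by decide)) hJ
      ext1 a
      exact hA.na a (by simp [show (Prog.for 4 (nv 1 * nv 0 * (nv 3 + nc 1) * nv 2) cellProg).naW = []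
        from rfl])
  · rintro s₁ hs₁ ⟨hA₁, htab⟩
    have hp₁ := hp.of_agree hA₁ (by decide)
    have hD1 : D + 1 < 2 ^ β := Fits.D_lt ⟨hβ, hn, hk, hlt⟩
    refine (Runs.for (N := n + 1) (T := D + 1)
      (fun d s' => ∀ d' < d, s'.rarr 3 d' = s.topSum n k d') hβ hs₁ (by omega) hD1 (by decide)
      ?_ ?_ ?_).mono ?_ fun s' _ h d hd => h d (by omega)
    · intro s' hA
      have hp' := hp₁.of_agree hA (by decide)
      simp only [NExp.eval_add, NExp.eval_var, NExp.eval_const, hp'.hD]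
    · intro d hd; omega
    · intro d hd s₂ hs₂ hA₂ hd9 hJ
      have hp₂ := hp₁.of_agree hA₂ (by decide)
      have ht₂ : s₂.rarr 2 = s₁.rarr 2 := hA₂.ra 2 (by decide)
      refine Runs.seq (R := (· = s₂.setR 6 0)) hβ ((Runs.of_wp hβ hs₂ ?_).mono (by omega)
        fun _ _ h => h) ?_
      · simp [wp]
      rintro s₃ hs₃ rfl
      refine Runs.seq (R := fun s' => s'.rvar 6 = s.topSum n k d ∧ s'.nvar 9 = d ∧
        s'.rarr 3 = s₂.rarr 3) hβ ?_ ?_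
      · refine (Runs.for (N := 1) (T := n) (fun u s' => s'.rvar 6 = ∑ u ∈ Finset.range u,
          s.tab n k (k - 1) u d (2 ^ k - 1)) hβ hs₃ le_rfl (Fits.n_lt ⟨hβ, hn, hk, hlt⟩) (by decide)
          ?_ ?_ ?_).agree.mono (by omega) ?_
        · intro s' hA
          rw [NExp.eval_var, hA.n 0 (by decide)]
          exact hp₂.hn
        · simp
        · intro u hu s' hs' hA hu6 hJ
          have hp' : Params s' n k D :=
            Params.of_agree (s := s₂.setR 6 0) ⟨hp₂.hn, hp₂.hk, hp₂.hP, hp₂.hD⟩ hA (by decide)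
          refine .of_wp hβ hs' ?_
          have h9 : s'.nvar 9 = d := (hA.n 9 (by decide)).trans hd9
          have ht' : s'.rarr 2 = s₁.rarr 2 := (hA.ra 2 (by decide)).trans ht₂
          simp only [wp, RExp.eval_add, RExp.eval_var, RExp.eval_get, NExp.eval_add, NExp.eval_mul,
            NExp.eval_sub, NExp.eval_var, NExp.eval_const, hp'.hn, hp'.hk, hp'.hD, hp'.hP, hu6, h9,
            Store.setN_rvar, Store.setR_rvar, if_true, hJ, ht']
          rw [Finset.sum_range_succ, htab, Store.cell_index s (by omega) (by omega) hu]
          have h1 : (k - 1) * n + u + 1 ≤ k * n := by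
            calc (k - 1) * n + u + 1 ≤ (k - 1) * n + n := by omega
              _ = (k - 1 + 1) * n := by ring
              _ = k * n := by rw [Nat.sub_add_cancel (by omega)]
          have h2 := Nat.mul_le_mul_right (D + 1) h1
          have h3 : (((k - 1) * n + u) * (D + 1) + d + 1) * 2 ^ k ≤ k * n * (D + 1) * 2 ^ k :=
            Nat.mul_le_mul_right _ (by rw [add_mul _ 1] at h2; omega)
          rw [add_mul _ 1] at h3
          omega
        · rintro s' - ⟨hA, h1⟩
          exact ⟨h1, (hA.n 9 (by decide)).trans hd9, hA.ra 3 (by decide)⟩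
      · rintro s' hs' ⟨h1, h2, h3⟩
        refine (Runs.of_wp hβ hs' ?_).mono (by omega) fun _ _ h => h
        intro d' hd'
        simp only [NExp.eval_var, h2, RExp.eval_var, h1, Store.setN_rarr, Store.putR_rarr,
          true_and]
        split_ifs with h
        · rw [h]
        · rw [h3]; exact hJ d' (by omega)
    · rw [evalBound, mul_assoc]
      refine Nat.mul_le_mul_left _ ?_
      have h1 : D + 1 ≤ k * n * (D + 1) * 2 ^ k := by
        calc D + 1 = 1 * 1 * (D + 1) * 1 := by ring
          _ ≤ k * n * (D + 1) * 2 ^ k := by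
            gcongr
            exacts [by omega]
      nlinarith

/-- The test whether a real number is nonzero. -/
def Test.rne (g : RExp) : Test := .not (.and (.not (.rlt g (rc 0))) (.not (.rlt (rc 0) g)))

@[simp] lemma Test.holds_rne (s : Store) (g : RExp) : (Test.rne g).Holds s ↔ g.eval s ≠ 0 := by
  simp only [Test.rne, Test.holds_not, Test.holds_and, Test.holds_rlt, RExp.eval_ofNat,
    NExp.eval_const, Nat.cast_zero, not_lt]
  exact ⟨fun h h0 => h ⟨h0.ge, h0.le⟩, fun h h0 => h (le_antisymm h0.2 h0.1)⟩

/-- Searches for the least weight up to `D` with a nonzero sum. Register `12` tells whether there is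
one, and register `13` holds it. -/
def searchProg : Prog :=
  .nset 12 (nc 0) ;;
  .for 9 (nv 3 + nc 1)
    (.ite (.and (.neq (nv 12) (nc 0)) (.rne (ra 3 (nv 9))))
      (.nset 12 (nc 1) ;; .nset 13 (nv 9)) .skip)

lemma searchProg_spec (hβ : 1 ≤ β) (hs : s.Bdd β) (hp : Params s n k D) (hD : D + 1 < 2 ^ β) :
    Runs ρ β (D + 2) searchProg s fun s' =>
      (s'.nvar 12 = 1 ∧ s'.nvar 13 ≤ D ∧ s.rarr 3 (s'.nvar 13) ≠ 0 ∧
        ∀ d < s'.nvar 13, s.rarr 3 d = 0) ∨ (s'.nvar 12 = 0 ∧ ∀ d ≤ D, s.rarr 3 d = 0) := by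
  refine Runs.seq (R := (· = s.setN 12 0)) hβ ((Runs.of_wp hβ hs (by simp [wp])).mono (by omega)
    fun _ _ h => h) ?_
  rintro s₁ hs₁ rfl
  refine (Runs.for (N := 1) (T := D + 1) (fun e s' =>
      (s'.nvar 12 = 1 ∧ s'.nvar 13 ≤ D ∧ s.rarr 3 (s'.nvar 13) ≠ 0 ∧
        ∀ d < s'.nvar 13, s.rarr 3 d = 0) ∨ (s'.nvar 12 = 0 ∧ ∀ d < e, s.rarr 3 d = 0)) hβ hs₁
    le_rfl hD (by decide) ?_ ?_ ?_).mono (by omega) ?_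
  · intro s' hA
    rw [NExp.eval_add, NExp.eval_var, hA.n 3 (by decide)]
    simp [hp.hD]
  · right; simp
  · intro d hd s' hs' hA hd9 hJ
    have h3 : s'.rarr 3 = s.rarr 3 := hA.ra 3 (by decide)
    have hd2 : d < 2 ^ β := by omega
    have h1 : 1 < 2 ^ β := Nat.one_lt_two_pow (by omega)
    refine .of_wp hβ hs' ?_
    rcases hJ with ⟨a1, a2, a3, a4⟩ | ⟨a1, a2⟩
    · simpa [wp, a1, a2, a3] using a4
    · by_cases h0 : s.rarr 3 d = 0
      · simp [wp, a1, hd9, h3, h0]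
        intro e he
        rcases he.lt_or_eq with he | rfl
        exacts [a2 e he, h0]
      · simp [wp, a1, hd9, h3, h0, hd2]
        exact ⟨by omega, by omega, a2⟩
  · rintro s' - (h | ⟨h1, h2⟩)
    exacts [.inl h, .inr ⟨h1, fun d hd => h2 d (by omega)⟩]

end

/-! ### Extraction of a path -/

/-- One step of the binary search for the vertex at position `i`, which register `14` holds: the
interval is replaced by its left half if the sum restricted to that half is nonzero, and by the
right half otherwise. -/
def halveProg : Prog :=
  (.nset 15 ((na 1 (nv 14) + na 2 (nv 14)) / nc 2) ;;
    .nset 16 (na 2 (nv 14)) ;;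
    .nput 2 (nv 14) (nv 15)) ;;
  evalProg ;;
  .ite (.rne (ra 3 (nv 13))) .skip
    (.nput 1 (nv 14) (nv 15) ;; .nput 2 (nv 14) (nv 16))

/-- Finds a path whose weight is in register `13`, by reducing the interval of each position to a
single vertex. -/
def extractProg : Prog :=
  .for 14 (nv 1) (.loop (.nlt (nc 1) (na 2 (nv 14) - na 1 (nv 14))) halveProg)

section

variable {ρ : ℕ → Bool} {β : ℕ} {s s₀ : Store} {n k D : ℕ}

/-- The invariant of the search for a path of weight `dd`: the sum restricted to the current
intervals is nonzero. -/
structure Searching (s s₀ : Store) (n k D dd : ℕ) : Prop where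
  params : Params s n k D
  hdd : s.nvar 13 = dd
  adj : s.narr 0 = s₀.narr 0
  wt : s.narr 3 = s₀.narr 3
  rarr : s.rarr 1 = s₀.rarr 1
  lt : ∀ i < k, s.narr 1 i < s.narr 2 i ∧ s.narr 2 i ≤ n
  ne : s.topSum n k dd ≠ 0

/-- Splitting an interval splits the sum. -/
lemma Store.topSum_split {s₁ s₂ : Store} {i mid d : ℕ} (hi : i < k) (h0 : s.narr 1 i ≤ mid)
    (h1 : mid ≤ s.narr 2 i) (hs₁ : s₁.narr = (s.putN 2 i mid).narr)
    (hs₂ : s₂.narr = (s.putN 1 i mid).narr)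
    (hr₁ : s₁.rarr 1 = s.rarr 1) (hr₂ : s₂.rarr 1 = s.rarr 1) :
    s.topSum n k d = s₁.topSum n k d + s₂.topSum n k d := by
  have a1 : s₁.adj n = s.adj n := by ext u v; simp [Store.adj, hs₁]
  have a2 : s₁.wt n = s.wt n := by ext u v; simp [Store.wt, hs₁]
  have a3 : s₁.ys n k = s.ys n k := by ext u v; simp only [Store.ys, hr₁]
  have b1 : s₂.adj n = s.adj n := by ext u v; simp [Store.adj, hs₂]
  have b2 : s₂.wt n = s.wt n := by ext u v; simp [Store.wt, hs₂]
  have b3 : s₂.ys n k = s.ys n k := by ext u v; simp only [Store.ys, hr₂]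
  simp only [Store.topSum, a1, a2, a3, b1, b2, b3]
  refine KPath.topSum_add hi (fun v j hj => ?_) fun v => ?_
  · simp [Store.xs, hs₁, hs₂, hr₁, hr₂, hj]
  · simp only [Store.xs, hs₁, hs₂, hr₁, hr₂, Store.putN_narr, and_true, if_true]
    norm_num
    by_cases c1 : v < mid
    · by_cases c2 : s.narr 1 i ≤ v
      · simp [c1, c2, not_le.2 c1, c1.trans_le h1]
      · simp [c2, not_le.2 c1]
    · have c2 : s.narr 1 i ≤ v := h0.trans (not_lt.1 c1)
      simp [c1, c2, not_lt.1 c1]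

/-- If the sum over the left half vanishes, then the sum over the right half does not; either way
the interval shrinks to at most half its length, rounded up. -/
lemma halveProg_spec (hF : Fits β n k D) (hs : s.Bdd β) {i dd : ℕ} (h : Searching s s₀ n k D dd)
    (hdd : dd ≤ D) (hi : i < k) (h14 : s.nvar 14 = i) (hlt : 1 < s.narr 2 i - s.narr 1 i) :
    Runs ρ β (evalBound n k D) halveProg s fun s' => Searching s' s₀ n k D dd ∧
      (∀ j ≠ i, s'.narr 1 j = s.narr 1 j ∧ s'.narr 2 j = s.narr 2 j) ∧
      Nat.clog 2 (s'.narr 2 i - s'.narr 1 i) < Nat.clog 2 (s.narr 2 i - s.narr 1 i) := by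
  have hβ := hF.hβ
  have hE : 1 ≤ evalBound n k D := Nat.mul_pos (Nat.mul_pos (by omega) (by omega)) (by omega)
  have hn := hF.n_lt
  have hhi := (h.lt i hi).2
  have hclog : ∀ a, a ≤ (s.narr 2 i - s.narr 1 i + 1) / 2 →
      Nat.clog 2 a < Nat.clog 2 (s.narr 2 i - s.narr 1 i) := by
    intro a ha
    rw [Nat.clog_of_two_le (le_refl 2) hlt, Nat.lt_succ_iff]
    exact Nat.clog_mono_right 2 ha
  set mid := (s.narr 1 i + s.narr 2 i) / 2 with hmid
  refine Runs.seq (R := fun s' => Params s' n k D ∧ s'.nvar 13 = dd ∧ s'.nvar 14 = i ∧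
    s'.nvar 15 = mid ∧ s'.nvar 16 = s.narr 2 i ∧ s'.narr = (s.putN 2 i mid).narr ∧
    s'.rarr 1 = s.rarr 1) hβ ((Runs.of_wp hβ hs ?_).mono hE fun _ _ h => h) ?_
  · simp +decide only [wp, NExp.eval_div, NExp.eval_add, NExp.eval_get, NExp.eval_var,
      NExp.eval_const, h14, Store.setN_nvar, Store.setN_narr, if_true, if_false, ← hmid]
    refine ⟨by omega, by omega, by omega, ⟨?_, ?_, ?_, ?_⟩, ?_, ?_, ?_, ?_, rfl, rfl⟩ <;>
      simp [h.params.hn, h.params.hk, h.params.hP, h.params.hD, h.hdd, h14]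
  rintro s₁ hs₁ ⟨hp₁, h13, h14₁, h15, h16, hnarr, hr1⟩
  refine Runs.seq (R := fun s' => Agree evalProg s₁ s' ∧ ∀ d ≤ D, s'.rarr 3 d = s₁.topSum n k d) hβ
    (evalProg_spec hF hs₁ hp₁).agree ?_
  rintro s₂ hs₂ ⟨hA, hval⟩
  have hp₂ := hp₁.of_agree hA (by decide)
  have e13 := (hA.n 13 (by decide)).trans h13
  have e14 := (hA.n 14 (by decide)).trans h14₁
  have e15 := (hA.n 15 (by decide)).trans h15
  have e16 := (hA.n 16 (by decide)).trans h16
  have enarr : s₂.narr = s₁.narr := by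
    ext1 a
    exact hA.na a (by simp [show evalProg.naW = [] from rfl])
  have er1 : s₂.rarr 1 = s₁.rarr 1 := hA.ra 1 (by decide)
  have hsum : s₂.topSum n k dd = s₁.topSum n k dd := by rw [Store.topSum_congr enarr er1]
  have hval' := hval dd hdd
  refine (Runs.of_wp hβ hs₂ ?_).mono hE fun _ _ h => h
  simp +decide only [wp, Test.holds_rne, RExp.eval_get, NExp.eval_var, e13, e14, e15,
    e16, Store.putN_nvar]
  rw [hval', enarr, hnarr]
  constructor
  · intro hne
    refine ⟨⟨hp₂, e13, ?_, ?_, er1.trans (hr1.trans h.rarr), ?_, hsum ▸ hne⟩, ?_, ?_⟩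
    · rw [enarr, hnarr, ← h.adj]; ext a; simp
    · rw [enarr, hnarr, ← h.wt]; ext a; simp
    · intro j hj
      have := h.lt j hj
      simp only [enarr, hnarr, Store.putN_narr]
      norm_num
      by_cases hji : j = i
      · subst hji; simp; omega
      · simp [hji, this]
    · intro j hj
      simp [hj]
    · refine hclog _ ?_
      simp
      omega
  · intro h0
    rw [not_not] at h0
    have hsplit := Store.topSum_split (s := s) (s₁ := s₁)
      (s₂ := (s₂.putN 1 i mid).putN 2 i (s.narr 2 i)) (n := n) (d := dd) hi
      (mid := mid) (by omega) (by omega) hnarr ?_ hr1 (by simp [er1, hr1])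
    · rw [h0, zero_add] at hsplit
      refine ⟨by omega, by omega, ⟨⟨hp₂.hn, hp₂.hk, hp₂.hP, hp₂.hD⟩, e13, ?_, ?_,
        er1.trans (hr1.trans h.rarr), ?_, hsplit ▸ h.ne⟩, ?_, ?_⟩
      · rw [← h.adj]; ext a; simp [enarr, hnarr]
      · rw [← h.wt]; ext a; simp [enarr, hnarr]
      · intro j hj
        have := h.lt j hj
        by_cases hji : j = i
        · subst hji; simp; omega
        · simp [hji, this, enarr, hnarr]
      · intro j hj
        simp [hj, enarr, hnarr]
      · refine hclog _ ?_
        simp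
        omega
    · ext a j
      simp only [Store.putN_narr, enarr, hnarr]
      by_cases hj : j = i
      · by_cases ha : a = 2
        · simp [hj, ha]
        · simp [hj, ha]
      · simp [hj]

lemma extractProg_spec (hF : Fits β n k D) (hs : s.Bdd β) {dd : ℕ} (h : Searching s s₀ n k D dd)
    (hdd : dd ≤ D) :
    Runs ρ β (evalBound n k D * (β + 1) * (k + 1)) extractProg s fun s' =>
      Searching s' s₀ n k D dd ∧ ∀ i < k, s'.narr 2 i = s'.narr 1 i + 1 := by
  have hE : 1 ≤ evalBound n k D := Nat.mul_pos (Nat.mul_pos (by omega) (by omega)) (by omega)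
  refine Runs.for (N := evalBound n k D * (β + 1)) (fun i s' =>
      Searching s' s₀ n k D dd ∧ ∀ j < i, s'.narr 2 j = s'.narr 1 j + 1) hF.hβ hs
    (Nat.mul_pos hE (by omega)) (h.params.hk ▸ hs.1 1) (by decide) ?_ ?_ ?_
  · intro s' hA
    rw [NExp.eval_var, hA.n 1 (by decide), h.params.hk]
  · refine ⟨⟨⟨?_, ?_, ?_, ?_⟩, ?_, h.adj, h.wt, h.rarr, h.lt, h.ne⟩, by omega⟩ <;>
      simp [h.params.hn, h.params.hk, h.params.hP, h.params.hD, h.hdd]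
  · rintro i hi s₁ hs₁ hA h14 ⟨hS, hlt⟩
    have hclog : Nat.clog 2 (s₁.narr 2 i - s₁.narr 1 i) ≤ β := by
      refine Nat.clog_le_of_le_pow ?_
      have := (hS.lt i hi).2
      have := hF.n_lt
      omega
    refine (Runs.while (N := evalBound n k D) (fun s' => s'.nvar 14 = i ∧ Searching s' s₀ n k D dd ∧
      ∀ j < i, s'.narr 2 j = s'.narr 1 j + 1) (fun s' => Nat.clog 2 (s'.narr 2 i - s'.narr 1 i))
      hF.hβ hs₁ hE ⟨h14, hS, hlt⟩ ?_).mono (Nat.mul_le_mul_left _ (by omega)) ?_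
    · rintro s' hs' hA' ⟨h14', hS', hlt'⟩ hb
      refine (halveProg_spec hF hs' hS' hdd hi h14' ?_).agree.mono le_rfl ?_
      · simpa [h14'] using hb
      · rintro s'' - ⟨hA'', h1, h2, h3⟩
        refine ⟨⟨(hA''.n 14 (by decide)).trans h14', h1, fun j hj => ?_⟩, h3⟩
        rw [(h2 j hj.ne).1, (h2 j hj.ne).2]
        exact hlt' j hj
    · rintro s' - ⟨⟨h1, h2, h3⟩, h4⟩
      refine ⟨⟨⟨?_, ?_, ?_, ?_⟩, ?_, h2.adj, h2.wt, h2.rarr, h2.lt, h2.ne⟩, ?_⟩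
      · simp [h2.params.hn]
      · simp [h2.params.hk]
      · simp [h2.params.hP]
      · simp [h2.params.hD]
      · simp [h2.hdd]
      · intro j hj
        rcases Nat.lt_succ_iff_lt_or_eq.1 hj with hj | rfl
        · exact h3 j hj
        · have := h2.lt j hi
          simp [h1] at h4
          simp only [Store.setN_narr]
          omega

end

/-! ### The bounded integer problem -/

/-- Computes in register `3` the integer part of the real register `5`. -/
def floorProg : Prog :=
  .nset 3 (nc 0) ;; .loop (.not (.rlt (rv 5) (.ofNat (nv 3 + nc 1)))) (.nset 3 (nv 3 + nc 1))

/-- Divides the weights by the real register `4` and rounds down. Quotients above `D` are replaced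
by `D + 1`, so that the time and the size of the integers depend on `D` only. -/
def roundProg : Prog :=
  .for 17 (nv 0 * nv 0)
    (.nset 18 (nc 0) ;;
      .loop (.and (.not (.nlt (nv 3) (nv 18)))
          (.not (.rlt (ra 0 (nv 17) / rv 4) (.ofNat (nv 18 + nc 1)))))
        (.nset 18 (nv 18 + nc 1)) ;;
      .nput 3 (nv 17) (nv 18))

/-- The subroutine for the weights `⌊w / s⌋` and the bound `B`, where `s` and `B` are in the real
registers `4` and `5`. Register `12` tells whether there is a path, and array `1` displays it. -/
def solveProg : Prog :=
  floorProg ;; roundProg ;;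
  .for 17 (nv 1) (.nput 1 (nv 17) (nc 0) ;; .nput 2 (nv 17) (nv 0)) ;;
  evalProg ;; searchProg ;;
  .ite (.neq (nv 12) (nc 1)) extractProg .skip

/-- The number of iterations of `solveProg`, up to a constant factor. -/
def solveBound (β n k D : ℕ) : ℕ := evalBound n k D * (β + 1) * (k + 1)

/-- The sum over walks for the weights `⌊w / σ⌋` at the point `z`. -/
noncomputable def pointSum (n k : ℕ) (A : ℕ → ℕ → Prop) (w : ℕ → ℝ) (z : ℕ → ℝ) (σ : ℝ)
    (d : ℕ) : ℝ :=
  topSum n k A (fun u v => ⌊w (n * u + v) / σ⌋₊) (fun v i => z (v * k + i))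
    (fun v j => z (n * k + v * k + j)) d

section

variable {ρ : ℕ → Bool} {β : ℕ} {s s₀ : Store} {n k D : ℕ}

lemma floorProg_spec (hβ : 1 ≤ β) (hs : s.Bdd β) {B : ℝ} (hB : s.rvar 5 = B) (hB0 : 0 ≤ B)
    (hD : ⌊B⌋₊ + 1 < 2 ^ β) :
    Runs ρ β (⌊B⌋₊ + 1) floorProg s fun s' => s'.nvar 3 = ⌊B⌋₊ := by
  refine Runs.seq (R := fun s' => s'.nvar 3 = 0 ∧ s'.rvar 5 = B) hβ
    ((Runs.of_wp hβ hs ?_).mono (by omega) fun _ _ h => h) ?_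
  · simp [wp, hB]
  rintro s₁ hs₁ ⟨h3, h5⟩
  refine (Runs.loop (N := 1) (T := ⌊B⌋₊) (fun d s' => s'.nvar 3 = d) hβ hs₁ le_rfl h3 ?_ ?_).mono
    (by omega) fun _ _ h => h
  · intro d hd s' hs' hA hJ
    have h5' : s'.rvar 5 = B := (hA.r 5 (by decide)).trans h5
    refine ⟨?_, .of_wp hβ hs' ?_⟩
    · have : ((d + 1 : ℕ) : ℝ) ≤ B := (Nat.le_floor_iff hB0).1 hd
      simpa [h5', hJ] using this
    · simp [wp, hJ]; omega
  · intro s' hs' hA hJ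
    have h5' : s'.rvar 5 = B := (hA.r 5 (by decide)).trans h5
    have := Nat.lt_floor_add_one B
    simpa [h5', hJ] using this

lemma roundProg_spec (hβ : 1 ≤ β) (hs : s.Bdd β) (hn : s.nvar 0 = n) (hD : s.nvar 3 = D) {σ : ℝ}
    (hσ : s.rvar 4 = σ) (hDβ : D + 1 < 2 ^ β) (hnβ : n * n < 2 ^ β) :
    Runs ρ β ((D + 2) * (n * n + 1)) roundProg s fun s' =>
      ∀ e < n * n, s'.narr 3 e = min ⌊s.rarr 0 e / σ⌋₊ (D + 1) := by
  refine Runs.for (N := D + 2) (T := n * n) (fun e s' => ∀ e' < e, s'.narr 3 e' =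
    min ⌊s.rarr 0 e' / σ⌋₊ (D + 1)) hβ hs (by omega) hnβ (by decide) ?_ (by omega) ?_
  · intro s' hA
    rw [NExp.eval_mul, NExp.eval_var, hA.n 0 (by decide), hn]
  · intro e he s' hs' hA h17 hJ
    have hD' : s'.nvar 3 = D := (hA.n 3 (by decide)).trans hD
    have hσ' : s'.rvar 4 = σ := (hA.r 4 (by decide)).trans hσ
    have hw' : s'.rarr 0 = s.rarr 0 := hA.ra 0 (by decide)
    refine Runs.seq (R := (· = s'.setN 18 0)) hβ ((Runs.of_wp hβ hs' (by simp [wp])).mono (by omega)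
      fun _ _ h => h) ?_
    rintro s₁ hs₁ rfl
    set q := min ⌊s.rarr 0 e / σ⌋₊ (D + 1) with hq
    have hqD : q ≤ D + 1 := min_le_right _ _
    refine Runs.seq (R := fun s'' => s''.nvar 18 = q ∧ s''.nvar 17 = e ∧
      s''.narr 3 = s'.narr 3) hβ ?_ ?_
    · refine (Runs.loop (N := 1) (T := q) (fun d s' => s'.nvar 18 = d) hβ hs₁ le_rfl (by simp) ?_
        ?_).agree.mono (by omega) ?_
      · intro d hd s₂ hs₂ hA₂ hJ
        have e3 : s₂.nvar 3 = D := (hA₂.n 3 (by decide)).trans hD'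
        have e17 : s₂.nvar 17 = e := (hA₂.n 17 (by decide)).trans h17
        have e4 : s₂.rvar 4 = σ := (hA₂.r 4 (by decide)).trans hσ'
        have e0 : s₂.rarr 0 = s.rarr 0 := (hA₂.ra 0 (by decide)).trans hw'
        refine ⟨?_, .of_wp hβ hs₂ ?_⟩
        · have h1 : d + 1 ≤ ⌊s.rarr 0 e / σ⌋₊ := (Nat.succ_le_of_lt hd).trans (min_le_left _ _)
          rw [Nat.le_floor_iff' (by omega)] at h1
          push_cast at h1
          simp [e3, e17, e4, e0, hJ, h1]
          omega
        · simp [wp, hJ]; omega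
      · intro s₂ hs₂ hA₂ hJ
        have e3 : s₂.nvar 3 = D := (hA₂.n 3 (by decide)).trans hD'
        have e17 : s₂.nvar 17 = e := (hA₂.n 17 (by decide)).trans h17
        have e4 : s₂.rvar 4 = σ := (hA₂.r 4 (by decide)).trans hσ'
        have e0 : s₂.rarr 0 = s.rarr 0 := (hA₂.ra 0 (by decide)).trans hw'
        simp only [Test.holds_and, Test.holds_not, Test.holds_nlt, Test.holds_rlt, NExp.eval_var,
          RExp.eval_div, RExp.eval_get, RExp.eval_var, RExp.eval_ofNat, NExp.eval_add,
          NExp.eval_const, e3, e17, e4, e0, hJ, not_lt]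
        rintro ⟨h1, h2⟩
        rw [← Nat.le_floor_iff' (by omega)] at h2
        have : q = ⌊s.rarr 0 e / σ⌋₊ := by omega
        omega
      · rintro s₂ - ⟨hA₂, h18⟩
        exact ⟨h18, (hA₂.n 17 (by decide)).trans h17, hA₂.na 3 (by decide)⟩
    · rintro s₂ hs₂ ⟨h18, h17', hna⟩
      refine (Runs.of_wp hβ hs₂ ?_).mono (by omega) fun _ _ h => h
      simp only [wp, NExp.eval_var, h18, h17', Store.setN_narr, Store.putN_narr, true_and]
      refine ⟨by omega, fun e' he' => ?_⟩
      split_ifs with h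
      · rw [h]
      · rw [hna]; exact hJ e' (by omega)

lemma evalBound_pos : 1 ≤ evalBound n k D :=
  Nat.mul_pos (Nat.mul_pos (by omega) (by omega)) (by omega)

lemma evalBound_le_solveBound : evalBound n k D ≤ solveBound β n k D := by
  rw [solveBound, mul_assoc]
  exact Nat.le_mul_of_pos_right _ (Nat.mul_pos (by omega) (by omega))

lemma round_le_evalBound (hn : 1 ≤ n) (hk : 2 ≤ k) : (D + 2) * (n * n + 1) ≤ evalBound n k D := by
  have h1 : D + 2 ≤ k * (D + 1) * 2 ^ k := by
    calc D + 2 ≤ 2 * (D + 1) * 1 := by omega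
      _ ≤ k * (D + 1) * 2 ^ k := by gcongr; exact Nat.one_le_two_pow
  calc (D + 2) * (n * n + 1) ≤ (k * (D + 1) * 2 ^ k) * ((n + 1) * n) :=
        Nat.mul_le_mul h1 (by nlinarith)
    _ = (n + 1) * 1 * (k * n * (D + 1) * 2 ^ k) := by ring
    _ ≤ _ := by rw [evalBound]; gcongr <;> omega

lemma map_range_eq {p : List ℕ} {f : ℕ → ℕ} (hp : p.length = k)
    (h : ∀ j (hj : j < p.length), p[j] = f j) : (List.range k).map f = p := by
  refine List.ext_getElem (by simp [hp]) fun j h1 h2 => ?_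
  simp [h j h2]

lemma solveProg_spec {B σ : ℝ} (hF : Fits β n k ⌊B⌋₊) (hnβ : n * n < 2 ^ β) (hs : s.Bdd β)
    (hn : s.nvar 0 = n) (hk : s.nvar 1 = k) (hP : s.nvar 2 = 2 ^ k) (hσ : s.rvar 4 = σ)
    (hB : s.rvar 5 = B) (hB0 : 0 ≤ B) :
    Runs ρ β (solveBound β n k ⌊B⌋₊) solveProg s fun s' =>
      (s'.nvar 12 = 1 ∧ ∃ p : List ℕ, (List.range k).map (s'.narr 1) = p ∧ p.length = k ∧ p.Nodup ∧
        p.IsChain (s.adj n) ∧ (∀ u ∈ p, u < n) ∧ ∃ dd ≤ ⌊B⌋₊,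
          pathWeight (fun u v => ⌊s.rarr 0 (n * u + v) / σ⌋₊) p = dd ∧
          pointSum n k (s.adj n) (s.rarr 0) (s.rarr 1) σ dd ≠ 0 ∧
          ∀ d < dd, pointSum n k (s.adj n) (s.rarr 0) (s.rarr 1) σ d = 0) ∨
      (s'.nvar 12 = 0 ∧ ∀ d ≤ ⌊B⌋₊, pointSum n k (s.adj n) (s.rarr 0) (s.rarr 1) σ d = 0) := by
  have hβ := hF.hβ
  have hn1 := hF.hn
  have hk2 := hF.hk
  have hD := hF.D_lt
  set D := ⌊B⌋₊ with hDdef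
  have hround := round_le_evalBound (D := D) hn1 hk2
  have hE := evalBound_le_solveBound (β := β) (n := n) (k := k) (D := D)
  have hRD : D + 2 ≤ (D + 2) * (n * n + 1) := Nat.le_mul_of_pos_right _ (by omega)
  have hkE : 1 * (k + 1) ≤ solveBound β n k D :=
    Nat.mul_le_mul_right _ (Nat.mul_pos evalBound_pos (by omega))
  refine Runs.seq (R := fun s' => Agree floorProg s s' ∧ s'.nvar 3 = D) hβ
    ((floorProg_spec hβ hs hB hB0 hD).agree.mono (by omega) fun _ _ h => h) ?_
  rintro s₁ hs₁ ⟨hA₁, h3⟩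
  have hp₁ : Params s₁ n k D := ⟨(hA₁.n 0 (by decide)).trans hn, (hA₁.n 1 (by decide)).trans hk,
    (hA₁.n 2 (by decide)).trans hP, h3⟩
  have hw₁ : s₁.rarr = s.rarr := by ext1 a; exact hA₁.ra a (by simp [floorProg, Prog.raW])
  have hna₁ : s₁.narr = s.narr := by ext1 a; exact hA₁.na a (by simp [floorProg, Prog.naW])
  refine Runs.seq (R := fun s' => Agree roundProg s₁ s' ∧ ∀ e < n * n, s'.narr 3 e =
    min ⌊s₁.rarr 0 e / σ⌋₊ (D + 1)) hβ ((roundProg_spec hβ hs₁ hp₁.hn h3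
      ((hA₁.r 4 (by decide)).trans hσ) hD hnβ).agree.mono (by omega) fun _ _ h => h) ?_
  rintro s₂ hs₂ ⟨hA₂, hwt⟩
  have hp₂ := hp₁.of_agree hA₂ (by decide)
  have hadj₂ : s₂.narr 0 = s.narr 0 := by rw [hA₂.na 0 (by decide), hna₁]
  have hr₂ : s₂.rarr = s.rarr := by
    rw [← hw₁]; ext1 a
    exact hA₂.ra a (by simp [show roundProg.raW = [] from rfl])
  rw [hw₁] at hwt
  refine Runs.seq (R := fun s' => Params s' n k D ∧ s'.narr 0 = s.narr 0 ∧ s'.rarr = s.rarr ∧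
    s'.narr 3 = s₂.narr 3 ∧ ∀ i < k, s'.narr 1 i = 0 ∧ s'.narr 2 i = n) hβ ?_ ?_
  · refine (Runs.for (N := 1) (T := k) (fun i s' => ∀ j < i, s'.narr 1 j = 0 ∧ s'.narr 2 j = n) hβ
      hs₂ le_rfl (hk ▸ hs.1 1) (by decide) ?_ (by omega) ?_).agree.mono hkE ?_
    · intro s' hA
      rw [NExp.eval_var, hA.n 1 (by decide), hp₂.hk]
    · intro i hi s' hs' hA h17 hJ
      refine .of_wp hβ hs' ?_
      have e0 : s'.nvar 0 = n := (hA.n 0 (by decide)).trans hp₂.hn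
      simp +decide only [wp, NExp.eval_var, NExp.eval_const, h17, Store.putN_nvar, e0,
        Store.setN_narr, Store.putN_narr, true_and, false_and, if_false]
      refine ⟨by positivity, hF.n_lt, fun j hj => ?_⟩
      by_cases hji : j = i
      · simp [hji]
      · simpa [hji] using hJ j (by omega)
    · rintro s' - ⟨hA, h1⟩
      refine ⟨hp₂.of_agree hA (by decide), (hA.na 0 (by decide)).trans hadj₂, ?_,
        hA.na 3 (by decide), h1⟩
      rw [← hr₂]; ext1 a
      exact hA.ra a (by simp [Prog.for, Prog.raW])
  rintro s₃ hs₃ ⟨hp₃, hadj₃, hr₃, hwt₃, hmask⟩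
  -- the sums for the rounded weights agree with those for the exact integer weights up to `D`
  have hsum : ∀ (x : ℕ → ℕ → ℝ) (d : ℕ), d ≤ D → topSum n k (s₃.adj n) (s₃.wt n) x (s₃.ys n k) d =
      topSum n k (s.adj n) (fun u v => ⌊s.rarr 0 (n * u + v) / σ⌋₊) x
        (fun v j => s.rarr 1 (n * k + v * k + j)) d := by
    intro x d hd
    refine topSum_congr (D := D) (by omega) (fun u _ v _ => ?_) (fun u hu v hv _ => ?_)
      (fun _ _ _ _ => rfl) (fun v _ j _ => ?_) hd
    · simp only [Store.adj, hadj₃]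
    · have he : n * u + v < n * n := by
        calc n * u + v < n * u + n := by omega
          _ = n * (u + 1) := by ring
          _ ≤ n * n := Nat.mul_le_mul_left _ hu
      simp only [Store.wt, hwt₃, hwt _ he]
      omega
    · simp only [Store.ys, hr₃]
  have hsum₃ : ∀ d ≤ D, s₃.topSum n k d = pointSum n k (s.adj n) (s.rarr 0) (s.rarr 1) σ d := by
    intro d hd
    rw [Store.topSum, hsum _ d hd, pointSum]
    refine topSum_congr (D := D) (by omega) (fun _ _ _ _ => Iff.rfl) (fun _ _ _ _ _ => .inl rfl)
      (fun v hv i hi => ?_) (fun _ _ _ _ => rfl) hd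
    rw [Store.xs, (hmask i hi).1, (hmask i hi).2, if_pos ⟨Nat.zero_le _, hv⟩, hr₃]
  refine Runs.seq (R := fun s' => Agree evalProg s₃ s' ∧ ∀ d ≤ D, s'.rarr 3 d = s₃.topSum n k d) hβ
    ((evalProg_spec hF hs₃ hp₃).agree.mono hE fun _ _ h => h) ?_
  rintro s₄ hs₄ ⟨hA₄, hval⟩
  have hp₄ := hp₃.of_agree hA₄ (by decide)
  refine Runs.seq hβ ((searchProg_spec hβ hs₄ hp₄ hD).agree.mono (by omega) fun _ _ h => h) ?_
  rintro s₅ hs₅ ⟨hA₅, hres⟩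
  have hp₅ := hp₄.of_agree hA₅ (by decide)
  have hn₅ : s₅.narr = s₃.narr := by
    ext1 a
    rw [hA₅.na a (by simp [show searchProg.naW = [] from rfl]),
      hA₄.na a (by simp [show evalProg.naW = [] from rfl])]
  have hr₅ : s₅.rarr 1 = s₃.rarr 1 := by rw [hA₅.ra 1 (by decide), hA₄.ra 1 (by decide)]
  refine Runs.ite hβ hs₅ (by omega) (fun hb => ?_) fun hb => ?_
  · rcases hres with ⟨h1, h2, h3, h4⟩ | ⟨h1, -⟩
    · have hS : Searching s₅ s₃ n k D (s₅.nvar 13) := by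
        refine ⟨hp₅, rfl, by rw [hn₅], by rw [hn₅], hr₅, fun i hi => ?_, ?_⟩
        · rw [hn₅, (hmask i hi).1, (hmask i hi).2]; omega
        · rw [Store.topSum_congr hn₅ hr₅, ← hval _ h2]; exact h3
      refine (extractProg_spec hF hs₅ hS h2).agree.mono le_rfl ?_
      rintro s₆ - ⟨hA₆, hS₆, hlo⟩
      left
      refine ⟨(hA₆.n 12 (by decide)).trans h1, ?_⟩
      -- the sum that is restricted to the singletons found is nonzero, so they form a path
      have hne := hS₆.ne
      have e1 : s₆.adj n = s₃.adj n := by ext u v; simp only [Store.adj, hS₆.adj]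
      have e2 : s₆.wt n = s₃.wt n := by ext u v; simp only [Store.wt, hS₆.wt]
      have e3 : s₆.ys n k = s₃.ys n k := by ext u v; simp only [Store.ys, hS₆.rarr]
      rw [Store.topSum, e1, e2, e3, hsum _ _ h2] at hne
      obtain ⟨p, hpk, hnd, hch, hpw, hlt, hx⟩ := exists_path_of_topSum_ne_zero (by omega) hne
      refine ⟨p, map_range_eq hpk fun j hj => ?_, hpk, hnd, hch, hlt, s₅.nvar 13, h2, hpw, ?_,
        fun d hd => ?_⟩
      · have h5 := hx j _ (List.getElem?_eq_getElem hj)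
        rw [Store.xs] at h5
        have h6 := hlo j (hpk ▸ hj)
        split_ifs at h5 with h7
        · omega
        · exact absurd rfl h5
      · rw [← hsum₃ _ h2, ← hval _ h2]; exact h3
      · rw [← hsum₃ _ (by omega), ← hval _ (by omega)]; exact h4 d hd
    · simp [h1] at hb
  · refine (Runs.of_wp hβ hs₅ ?_).mono (by omega) fun _ _ h => h
    rcases hres with ⟨h1, h2, h3, h4⟩ | ⟨h1, h2⟩
    · simp [h1] at hb
    · exact .inr ⟨h1, fun d hd => by rw [← hsum₃ d hd, ← hval d hd]; exact h2 d hd⟩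

end

/-! ### The random subroutine -/

section Random

variable {n k : ℕ} {G : Digraph (Fin n)} {w' : Fin n → Fin n → ℕ} {z : ℕ → ℝ} {B : ℝ}

/-- The adjacency relation on natural numbers. -/
def adjN (G : Digraph (Fin n)) (u v : ℕ) : Prop :=
  ∃ (hu : u < n) (hv : v < n), G.Adj ⟨u, hu⟩ ⟨v, hv⟩

/-- The weights on natural numbers, with the value `0` outside of the range. -/
def wtN (w' : Fin n → Fin n → ℕ) (u v : ℕ) : ℕ :=
  if h : u < n ∧ v < n then w' ⟨u, h.1⟩ ⟨v, h.2⟩ else 0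

/-- The sum over the walks of weight `d`, evaluated at the point `z`. -/
noncomputable def testSum (G : Digraph (Fin n)) (k : ℕ) (z : ℕ → ℝ) (w' : Fin n → Fin n → ℕ)
    (d : ℕ) : ℝ :=
  topSum n k (adjN G) (wtN w') (fun v i => z (v * k + i)) (fun v j => z (n * k + v * k + j)) d

lemma wtN_val (w' : Fin n → Fin n → ℕ) (i j : Fin n) : wtN w' i j = w' i j := by
  rw [wtN, dif_pos ⟨i.2, j.2⟩]

lemma pathWeight_map_val (w' : Fin n → Fin n → ℕ) (P : List (Fin n)) :
    pathWeight (wtN w') (P.map Fin.val) = pathWeight w' P := by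
  rw [pathWeight, pathWeight, ← List.map_tail, List.zipWith_map]
  simp only [wtN_val]

lemma isChain_map_val {P : List (Fin n)} :
    (P.map Fin.val).IsChain (adjN G) ↔ P.IsChain G.Adj := by
  rw [List.isChain_map]
  have : (fun a b : Fin n => adjN G a b) = G.Adj := by
    ext a b
    exact ⟨fun ⟨_, _, h⟩ => h, fun h => ⟨a.2, b.2, h⟩⟩
  rw [this]

lemma exists_map_val {p : List ℕ} (hp : ∀ u ∈ p, u < n) : ∃ P : List (Fin n), P.map Fin.val = p :=
  ⟨p.pmap Fin.mk hp, by rw [List.map_pmap]; simp⟩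

lemma isKPath_of_map_val {P : List (Fin n)} (h1 : (P.map Fin.val).length = k)
    (h2 : (P.map Fin.val).Nodup) (h3 : (P.map Fin.val).IsChain (adjN G)) : IsKPath G k P :=
  ⟨by simpa using h1, List.Nodup.of_map _ h2, isChain_map_val.1 h3⟩

lemma exists_isKPath_of_testSum_ne_zero (hk : 1 ≤ k) {d : ℕ} (h : testSum G k z w' d ≠ 0) :
    ∃ P, IsKPath G k P ∧ pathWeight w' P = d := by
  obtain ⟨p, h1, h2, h3, h4, h5, -⟩ := exists_path_of_topSum_ne_zero hk h
  obtain ⟨P, rfl⟩ := exists_map_val h5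
  exact ⟨P, isKPath_of_map_val h1 h2 h3, by rw [← h4, pathWeight_map_val]⟩

/-- An answer found with the sums over walks at `z`: a path of the least weight `d ≤ B` with a
nonzero sum. It is correct if `z` detects the paths of minimum weight. -/
def IsTestAnswer (G : Digraph (Fin n)) (k : ℕ) (z : ℕ → ℝ) (w' : Fin n → Fin n → ℕ) (B : ℝ) :
    Option (List (Fin n)) → Prop
  | none => ∀ d ≤ ⌊B⌋₊, testSum G k z w' d = 0
  | some P => IsKPath G k P ∧ pathWeight w' P ≤ ⌊B⌋₊ ∧ testSum G k z w' (pathWeight w' P) ≠ 0 ∧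
      ∀ d < pathWeight w' P, testSum G k z w' d = 0

lemma exists_isTestAnswer (hk : 1 ≤ k) (G : Digraph (Fin n)) (z : ℕ → ℝ) (w' : Fin n → Fin n → ℕ)
    (B : ℝ) : ∃ o, IsTestAnswer G k z w' B o := by
  classical
  by_cases h : ∃ d, d ≤ ⌊B⌋₊ ∧ testSum G k z w' d ≠ 0
  · obtain ⟨h1, h2⟩ := Nat.find_spec h
    obtain ⟨P, hP, hPd⟩ := exists_isKPath_of_testSum_ne_zero hk h2
    refine ⟨some P, hP, hPd ▸ h1, hPd ▸ h2, fun d hd => ?_⟩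
    rw [hPd] at hd
    by_contra h0
    exact Nat.find_min h hd ⟨by omega, h0⟩
  · push Not at h
    exact ⟨none, h⟩

lemma IsTestAnswer.isSome_iff {o : Option (List (Fin n))} (h : IsTestAnswer G k z w' B o) :
    o.isSome ↔ ∃ d ≤ ⌊B⌋₊, testSum G k z w' d ≠ 0 := by
  cases o with
  | none =>
    simp only [Option.isSome_none, Bool.false_eq_true, false_iff]
    push Not
    exact h
  | some P => simpa using ⟨_, h.2.1, h.2.2.1⟩

/-- The subroutine that evaluates the sums over walks at the point `z`. -/
noncomputable def pointSubroutine (hk : 1 ≤ k) (G : Digraph (Fin n)) (z : ℕ → ℝ) :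
    Subroutine (Fin n) :=
  fun w' B => (exists_isTestAnswer hk G z w' B).choose

lemma pointSubroutine_spec (hk : 1 ≤ k) (G : Digraph (Fin n)) (z : ℕ → ℝ) (w' : Fin n → Fin n → ℕ)
    (B : ℝ) : IsTestAnswer G k z w' B (pointSubroutine hk G z w' B) :=
  (exists_isTestAnswer hk G z w' B).choose_spec

/-- The point `z` detects the paths of minimum weight. -/
def Detects (G : Digraph (Fin n)) (k : ℕ) (z : ℕ → ℝ) (w' : Fin n → Fin n → ℕ) : Prop :=
  ∀ P, IsKPath G k P → (∀ Q, IsKPath G k Q → pathWeight w' P ≤ pathWeight w' Q) →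
    testSum G k z w' (pathWeight w' P) ≠ 0

lemma exists_min_isKPath (w' : Fin n → Fin n → ℕ) {Q : List (Fin n)} (hQ : IsKPath G k Q) :
    ∃ P, IsKPath G k P ∧ ∀ Q, IsKPath G k Q → pathWeight w' P ≤ pathWeight w' Q := by
  have hfin : {P | IsKPath G k P}.Finite :=
    (List.finite_length_eq (Fin n) k).subset fun P hP => hP.1
  obtain ⟨P, hP, hmin⟩ := Set.exists_min_image _ (pathWeight w') hfin ⟨Q, hQ⟩
  exact ⟨P, hP, hmin⟩

lemma IsTestAnswer.isBoundedAnswer (hB : 0 ≤ B) (hz : Detects G k z w') {o : Option (List (Fin n))}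
    (h : IsTestAnswer G k z w' B o) : IsBoundedAnswer G k w' B o := by
  cases o with
  | none =>
    intro Q hQ
    by_contra! hQB
    obtain ⟨P, hP, hmin⟩ := exists_min_isKPath w' hQ
    exact hz P hP hmin (h _ ((hmin Q hQ).trans (Nat.le_floor hQB)))
  | some P =>
    obtain ⟨hP, h1, h2, h3⟩ := h
    refine ⟨hP, (Nat.le_floor_iff hB).1 h1, fun Q hQ => ?_⟩
    obtain ⟨P₀, hP₀, hmin⟩ := exists_min_isKPath w' hQ
    by_contra! hlt
    exact hz P₀ hP₀ hmin (h3 _ ((hmin Q hQ).trans_lt hlt))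

/-- The random point whose coordinates are the numbers with the successive blocks of `b` random
bits. -/
def randomPoint (b : ℕ) (ρ : ℕ → Bool) (m : ℕ) : ℝ := bitsVal ρ (m * b) b

lemma index_lt {v i : ℕ} (hv : v < n) (hi : i < k) : v * k + i < n * k := by
  calc v * k + i < v * k + k := by omega
    _ = (v + 1) * k := by ring
    _ ≤ n * k := Nat.mul_le_mul_right _ hv

lemma testSum_congr {z' : ℕ → ℝ} (hk : 1 ≤ k) (h : ∀ m < 2 * n * k, z m = z' m) (d : ℕ) :
    testSum G k z w' d = testSum G k z' w' d := by
  refine topSum_congr (D := d) hk (fun _ _ _ _ => Iff.rfl) (fun _ _ _ _ _ => .inl rfl)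
    (fun v hv i hi => h _ ?_) (fun v hv j hj => h _ ?_) le_rfl
  · have := index_lt hv hi
    rw [mul_assoc]; omega
  · have := index_lt hv hj
    rw [mul_assoc]; omega

lemma coinMeasure_testSum_le (hk : 1 ≤ k) (b : ℕ) {P : List (Fin n)} (hP : IsKPath G k P)
    (w' : Fin n → Fin n → ℕ) :
    coinMeasure {ρ | testSum G k (randomPoint b ρ) w' (pathWeight w' P) = 0} ≤
      ((2 * n * k : ℕ) : ENNReal) * ((2 * k : ℕ) * (2 ^ b : ENNReal)⁻¹) := by
  set p := P.map Fin.val with hp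
  -- the indicators of the path, as a point
  set a : ℕ → ℝ := fun m => if m < n * k then (if p[m % k]? = some (m / k) then 1 else 0)
    else if p[(m - n * k) % k]? = some ((m - n * k) / k) then 1 else 0 with ha
  have hdiv : ∀ v i, i < k → (v * k + i) / k = v ∧ (v * k + i) % k = i := by
    intro v i hi
    rw [mul_comm, Nat.mul_add_div (by omega), Nat.div_eq_of_lt hi, Nat.mul_add_mod,
      Nat.mod_eq_of_lt hi]
    simp
  refine coinMeasure_root_le (f := fun z => testSum G k z w' (pathWeight w' P)) (a := a)
    (fun z m => ?_) (fun z z' h => testSum_congr hk h _) ?_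
  · have : ∀ l, IsPoly 1 fun t => Function.update z m t l := by
      intro l
      by_cases hl : l = m
      · subst hl; simpa using IsPoly.id le_rfl
      · simpa [Function.update_of_ne hl] using IsPoly.const 1 (z l)
    exact IsPoly.topSum hk (fun v i => this _) (fun v j => this _) _
  · have h1 := topSum_indicator_ne_zero (n := n) (k := k) (A := adjN G) (W := wtN w') (p := p) hk
      (by simpa [hp] using hP.1) (hP.2.1.map Fin.val_injective) (isChain_map_val.2 hP.2.2)
      (by simp [hp])
    rw [hp, pathWeight_map_val, ← hp] at h1
    refine ne_of_eq_of_ne (topSum_congr (D := pathWeight w' P) hk (fun _ _ _ _ => Iff.rfl)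
      (fun _ _ _ _ _ => .inl rfl) (fun v hv i hi => ?_) (fun v hv j hj => ?_) le_rfl) h1
    · obtain ⟨e1, e2⟩ := hdiv v i hi
      simp only [ha, if_pos (index_lt hv hi), e1, e2]
    · obtain ⟨e1, e2⟩ := hdiv v j hj
      simp only [ha]
      rw [if_neg (by omega), show n * k + v * k + j - n * k = v * k + j by omega, e1, e2]

lemma coinMeasure_not_detects_le (hk : 1 ≤ k) (b : ℕ) (G : Digraph (Fin n))
    (w' : Fin n → Fin n → ℕ) :
    coinMeasure {ρ | ¬ Detects G k (randomPoint b ρ) w'} ≤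
      ((2 * n * k : ℕ) : ENNReal) * ((2 * k : ℕ) * (2 ^ b : ENNReal)⁻¹) := by
  by_cases h : ∃ Q, IsKPath G k Q
  · obtain ⟨Q, hQ⟩ := h
    obtain ⟨P, hP, hmin⟩ := exists_min_isKPath w' hQ
    refine (MeasureTheory.measure_mono fun ρ hρ => ?_).trans (coinMeasure_testSum_le hk b hP w')
    by_contra h0
    refine hρ fun P' hP' hmin' => ?_
    rw [le_antisymm (hmin' P hP) (hmin P' hP')]
    exact h0
  · have : {ρ | ¬ Detects G k (randomPoint b ρ) w'} = ∅ := by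
      ext ρ
      simp only [Set.mem_ofPred_eq, Set.mem_empty_iff_false, iff_false, not_not]
      exact fun P hP => (h ⟨P, hP⟩).elim
    simp [this]

end Random

/-! ### The randomized program -/

/-- Computes `2ᵏ` in register `2`. -/
def powProg : Prog := .nset 2 (nc 1) ;; .for 25 (nv 1) (.nset 2 (nv 2 + nv 2))

/-- Counts in register `19` how often `M` has to be raised to the power `2 / 3` until it is at
most `2`. This bounds the number of iterations of the main loop. -/
def countProg : Prog :=
  (.rset 8 (rv 0) ;; .nset 19 (nc 0)) ;;
  .loop (.rlt (rc 2) (rv 8)) (.rset 8 (.cbrt (rv 8) * .cbrt (rv 8)) ;; .nset 19 (nv 19 + nc 1))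

/-- The power of register `0` with a fixed exponent. -/
def powExp : ℕ → NExp
  | 0 => nc 1
  | c + 1 => powExp c * nv 0

/-- Stores in the real array `1` a point whose `2nk` coordinates are drawn from `{0, …, 2ᵇ - 1}`,
where `2ᵇ` is the least power of two that is at least register `20`. -/
def drawProg : Prog :=
  .for 21 (nc 2 * nv 0 * nv 1)
    ((.nset 22 (nc 1) ;; .nset 23 (nc 0)) ;;
      .loop (.nlt (nv 22) (nv 20))
        (.flip 24 ;; .nset 23 (nc 2 * nv 23 + nv 24) ;; .nset 22 (nv 22 + nv 22)) ;;
      .rput 1 (nv 21) (.ofNat (nv 23)))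

/-- One iteration of the main loop. The real registers `2` and `3` hold `L` and `U`, and `8` and `9`
hold `X` and `δ U`. -/
def iterProg : Prog :=
  (.rset 8 (.sqrt (rv 2 * rv 3)) ;;
    .rset 9 ((.cbrt (rv 2 / rv 3) - .sqrt (rv 2 / rv 3)) * rv 3) ;;
    .rset 4 (rv 9 / .ofNat (nv 1 - nc 1)) ;;
    .rset 5 (rv 8 / rv 4)) ;;
  solveProg ;;
  .ite (.neq (nv 12) (nc 1)) (.rset 3 (rv 8 + rv 9)) (.rset 2 (rv 8))

/-- The last call of the subroutine. -/
def finalProg : Prog :=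
  (.rset 4 (rv 1 * rv 2 / .ofNat (nv 1 - nc 1)) ;; .rset 5 (rv 3 / rv 4)) ;;
  solveProg ;;
  .nset 0 (nv 12)

/-- The whole program, with failure probability at most `n ^ (-c)`. -/
def mainProg (c : ℕ) : Prog :=
  powProg ;; countProg ;;
  .nset 20 ((nv 19 + nc 1) * (nc 4 * nv 0 * nv 1 * nv 1) * powExp c) ;;
  drawProg ;;
  (.rset 2 (.ofNat (nv 1 - nc 1)) ;; .rset 3 (.ofNat (nv 1 - nc 1) * rv 0)) ;;
  .loop (.rlt (rc 2 * rv 2) (rv 3)) iterProg ;;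
  finalProg

lemma powExp_eval (c : ℕ) (s : Store) : (powExp c).eval s = s.nvar 0 ^ c := by
  induction c with
  | zero => simp [powExp]
  | succ c ih => simp [powExp, ih, pow_succ]

section

variable {ρ : ℕ → Bool} {β : ℕ} {s : Store} {n k : ℕ}

lemma powProg_spec (hβ : 1 ≤ β) (hs : s.Bdd β) (hk : s.nvar 1 = k) (hP : 2 ^ k < 2 ^ β)
    (hc : s.coins = 0) :
    Runs ρ β (k + 1) powProg s fun s' => s'.nvar 2 = 2 ^ k ∧ s'.coins = 0 := by
  refine Runs.seq (R := fun s' => s'.nvar 1 = k ∧ s'.nvar 2 = 1 ∧ s'.coins = 0) hβ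
    ((Runs.of_wp hβ hs ?_).mono (by omega) fun _ _ h => h) ?_
  · simp [wp, hk, hc]; omega
  rintro s₁ hs₁ ⟨h1, h2, h3⟩
  refine (Runs.for (N := 1) (T := k) (fun i s' => s'.nvar 2 = 2 ^ i ∧ s'.coins = 0) hβ hs₁ le_rfl
    (hk ▸ hs.1 1) (by decide) ?_ ?_ ?_).mono (by omega) fun _ _ h => h
  · intro s' hA
    rw [NExp.eval_var, hA.n 1 (by decide), h1]
  · simp [h2, h3]
  · intro i hi s' hs' _ _ ⟨hJ, hJc⟩
    refine .of_wp hβ hs' ?_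
    have : 2 ^ (i + 1) ≤ 2 ^ k := Nat.pow_le_pow_right (by norm_num) hi
    simp [wp, hJ, hJc]
    rw [pow_succ] at this ⊢
    omega

lemma countProg_spec (hβ : 1 ≤ β) (hs : s.Bdd β) {M : ℝ} (hM : s.rvar 0 = M) (hM1 : 1 ≤ M) {T : ℕ}
    (h1 : ∀ i < T, 2 < M ^ ((2 / 3 : ℝ) ^ i)) (h2 : M ^ ((2 / 3 : ℝ) ^ T) ≤ 2) (hT : T < 2 ^ β)
    (hc : s.coins = 0) :
    Runs ρ β (T + 1) countProg s fun s' => s'.nvar 19 = T ∧ s'.coins = 0 := by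
  refine Runs.seq (R := fun s' => s'.nvar 19 = 0 ∧ s'.rvar 8 = M ∧ s'.coins = 0) hβ
    ((Runs.of_wp hβ hs ?_).mono (by omega) fun _ _ h => h) ?_
  · simp [wp, hM, hc]
  rintro s₁ hs₁ ⟨h19, h8, hc₁⟩
  refine (Runs.loop (N := 1) (T := T) (fun i s' => s'.nvar 19 = i ∧
    s'.rvar 8 = M ^ ((2 / 3 : ℝ) ^ i) ∧ s'.coins = 0) hβ hs₁ le_rfl
    ⟨h19, by simpa using h8, hc₁⟩ ?_ ?_).mono (by omega) fun _ _ h => ⟨h.1, h.2.2⟩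
  · rintro i hi s' hs' - ⟨hJ, hJ', hJc⟩
    refine ⟨by simpa [hJ'] using h1 i hi, .of_wp hβ hs' ?_⟩
    have h0 : 0 ≤ M := by linarith
    simp only [wp, RExp.eval_mul, RExp.eval_cbrt, RExp.eval_var, hJ', NExp.eval_add, NExp.eval_var,
      Store.setR_nvar, hJ, NExp.eval_const, Store.setN_nvar, if_true, Store.setN_rvar,
      Store.setR_rvar, Store.setN_coins, Store.setR_coins, hJc, true_and, and_true]
    refine ⟨by omega, ?_⟩
    rw [max_eq_left (by positivity), ← Real.rpow_mul h0, ← Real.rpow_add (by linarith), pow_succ]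
    ring_nf
  · rintro s' - - ⟨hJ, hJ', -⟩
    simpa [hJ'] using h2

lemma drawProg_spec (hβ : 1 ≤ β) (hs : s.Bdd β) (hn : s.nvar 0 = n) (hk : s.nvar 1 = k) {R : ℕ}
    (hR : s.nvar 20 = R) (hRβ : 2 * R < 2 ^ β) (hnk : 2 * n * k < 2 ^ β) (hcoins : s.coins = 0) :
    Runs ρ β ((β + 1) * (2 * n * k + 1)) drawProg s fun s' =>
      ∀ m < 2 * n * k, s'.rarr 1 m = randomPoint (Nat.clog 2 R) ρ m := by
  set b := Nat.clog 2 R with hb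
  have hbβ : b ≤ β := Nat.clog_le_of_le_pow (by omega)
  have hlt : ∀ l, l < b ↔ 2 ^ l < R := fun l => Nat.lt_clog_iff_pow_lt (by norm_num)
  refine (Runs.for (N := β + 1) (T := 2 * n * k) (fun m s' => s'.coins = m * b ∧
    ∀ m' < m, s'.rarr 1 m' = randomPoint b ρ m') hβ hs (by omega) hnk (by decide) ?_ ?_ ?_).mono
    le_rfl fun _ _ h => h.2
  · intro s' hA
    simp only [NExp.eval_mul, NExp.eval_const, NExp.eval_var]
    rw [hA.n 0 (by decide), hA.n 1 (by decide), hn, hk]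
  · simpa using hcoins
  · rintro m hm s' hs' hA h21 ⟨hJ, hJ'⟩
    have hR' : s'.nvar 20 = R := (hA.n 20 (by decide)).trans hR
    refine Runs.seq (R := (· = (s'.setN 22 1).setN 23 0)) hβ
      ((Runs.of_wp hβ hs' ?_).mono (by omega) fun _ _ h => h) ?_
    · simp [wp]; omega
    rintro s₁ hs₁ rfl
    refine Runs.seq (R := fun s'' => s''.nvar 23 = bitsVal ρ (m * b) b ∧ s''.coins = m * b + b ∧
      s''.nvar 21 = m ∧ s''.rarr 1 = s'.rarr 1) hβ ?_ ?_
    · refine (Runs.loop (N := 1) (T := b) (fun l s'' => s''.nvar 22 = 2 ^ l ∧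
        s''.nvar 23 = bitsVal ρ (m * b) l ∧ s''.coins = m * b + l) hβ hs₁ le_rfl
        (by simpa [bitsVal] using hJ) ?_ ?_).agree.mono (by omega) ?_
      · rintro l hl s₂ hs₂ hA₂ ⟨h1, h2, h3⟩
        have e20 : s₂.nvar 20 = R := (hA₂.n 20 (by decide)).trans hR'
        have hlR := (hlt l).1 hl
        have hv := bitsVal_lt ρ (m * b) l
        refine ⟨by simpa [h1, e20] using hlR, .of_wp hβ hs₂ ?_⟩
        simp +decide only [wp, NExp.eval_add, NExp.eval_mul, NExp.eval_const, NExp.eval_var,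
          Store.flip_nvar, Store.setN_nvar, Store.setN_coins, Store.flip_coins, if_true, if_false,
          h1, h2, h3]
        refine ⟨?_, by omega, by rw [pow_succ]; ring, rfl, by ring⟩
        split_ifs <;> omega
      · rintro s₂ - hA₂ ⟨h1, -, -⟩
        have e20 : s₂.nvar 20 = R := (hA₂.n 20 (by decide)).trans hR'
        simpa [h1, e20] using (hlt b).not.1 (lt_irrefl b)
      · rintro s₂ - ⟨hA₂, h1, h2, h3⟩
        exact ⟨h2, h3, (hA₂.n 21 (by decide)).trans h21, hA₂.ra 1 (by decide)⟩
    · rintro s₂ hs₂ ⟨h1, h2, h3, h4⟩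
      refine (Runs.of_wp hβ hs₂ ?_).mono (by omega) fun _ _ h => h
      simp only [wp, NExp.eval_var, h3, RExp.eval_ofNat, h1, Store.setN_coins, Store.putR_coins, h2,
        Store.setN_rarr, Store.putR_rarr, true_and]
      refine ⟨by ring, fun m' hm' => ?_⟩
      split_ifs with h
      · rw [h]; rfl
      · rw [h4]; exact hJ' m' (by omega)

end

section Main

variable {ρ : ℕ → Bool} {β : ℕ} {s : Store} {n k : ℕ} {G : Digraph (Fin n)} {w : Fin n → Fin n → ℝ}
  {M ε : ℝ} {z : ℕ → ℝ}

/-- The memory holds the input. -/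
structure HoldsInput (s : Store) (G : Digraph (Fin n)) (w : Fin n → Fin n → ℝ) (k : ℕ) (M ε : ℝ) :
    Prop where
  hn : s.nvar 0 = n
  hk : s.nvar 1 = k
  hM : s.rvar 0 = M
  hε : s.rvar 1 = ε
  adj : s.narr 0 = (inputStore G w k M ε).narr 0
  wts : s.rarr 0 = (inputStore G w k M ε).rarr 0

lemma HoldsInput.of_agree {p : Prog} {s' : Store} (h : HoldsInput s G w k M ε) (hA : Agree p s s')
    (h0 : ∀ x ∈ [0, 1], x ∉ p.nW) (h1 : ∀ x ∈ [0, 1], x ∉ p.rW) (h2 : 0 ∉ p.naW)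
    (h3 : 0 ∉ p.raW) : HoldsInput s' G w k M ε := by
  have e : ∀ x ∈ [0, 1], s'.nvar x = s.nvar x := fun x hx => hA.n x (h0 x hx)
  have e' : ∀ x ∈ [0, 1], s'.rvar x = s.rvar x := fun x hx => hA.r x (h1 x hx)
  simp only [List.forall_mem_cons] at e e'
  exact ⟨e.1.trans h.hn, e.2.1.trans h.hk, e'.1.trans h.hM, e'.2.1.trans h.hε,
    (hA.na 0 h2).trans h.adj, (hA.ra 0 h3).trans h.wts⟩

/-- The memory holds the input and the random point. -/
structure Ready (s : Store) (G : Digraph (Fin n)) (w : Fin n → Fin n → ℝ) (k : ℕ) (M ε : ℝ)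
    (z : ℕ → ℝ) : Prop extends HoldsInput s G w k M ε where
  hP : s.nvar 2 = 2 ^ k
  pt : ∀ m < 2 * n * k, s.rarr 1 m = z m

lemma Ready.of_agree {p : Prog} {s' : Store} (h : Ready s G w k M ε z) (hA : Agree p s s')
    (h0 : ∀ x ∈ [0, 1], x ∉ p.nW) (h1 : ∀ x ∈ [0, 1], x ∉ p.rW) (h2 : 0 ∉ p.naW) (h3 : 0 ∉ p.raW)
    (h4 : 2 ∉ p.nW) (h5 : 1 ∉ p.raW) : Ready s' G w k M ε z :=
  ⟨h.toHoldsInput.of_agree hA h0 h1 h2 h3, (hA.n 2 h4).trans h.hP,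
    by rw [hA.ra 1 h5]; exact h.pt⟩

lemma input_index {u v : ℕ} (hu : u < n) (hv : v < n) : ∃ h : n * u + v < n * n,
    finProdFinEquiv.symm (⟨n * u + v, h⟩ : Fin (n * n)) = (⟨u, hu⟩, ⟨v, hv⟩) := by
  have h : n * u + v < n * n := by
    calc n * u + v < n * u + n := by omega
      _ = n * (u + 1) := by ring
      _ ≤ n * n := Nat.mul_le_mul_left _ hu
  refine ⟨h, ?_⟩
  rw [Equiv.symm_apply_eq]
  ext
  simp [finProdFinEquiv, add_comm]

lemma inputStore_adj {u v : ℕ} (hu : u < n) (hv : v < n) :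
    (inputStore G w k M ε).narr 0 (n * u + v) = 1 ↔ adjN G u v := by
  obtain ⟨h, he⟩ := input_index hu hv
  simp only [inputStore, Function.update_self, dif_pos h]
  have : adjN G u v ↔ G.Adj ⟨u, hu⟩ ⟨v, hv⟩ := ⟨fun ⟨_, _, h⟩ => h, fun h => ⟨hu, hv, h⟩⟩
  rw [this]
  split_ifs with h <;> rw [he] at h <;> simp [h]

lemma inputStore_weight {u v : ℕ} (hu : u < n) (hv : v < n) :
    (inputStore G w k M ε).rarr 0 (n * u + v) = w ⟨u, hu⟩ ⟨v, hv⟩ := by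
  obtain ⟨h, he⟩ := input_index hu hv
  simp only [inputStore, Function.update_self, dif_pos h, he]

/-- The answer `out` is found in register `12` and array `1`. -/
def Shows (s : Store) (k : ℕ) : Option (List (Fin n)) → Prop
  | none => s.nvar 12 = 0
  | some P => s.nvar 12 = 1 ∧ P.map Fin.val = (List.range k).map (s.narr 1)

lemma solveProg_spec' {B σ : ℝ} (hF : Fits β n k ⌊B⌋₊) (hnβ : n * n < 2 ^ β) (hs : s.Bdd β)
    (hR : Ready s G w k M ε z) (hσ : s.rvar 4 = σ) (hB : s.rvar 5 = B) (hB0 : 0 ≤ B) :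
    Runs ρ β (solveBound β n k ⌊B⌋₊) solveProg s fun s' => Agree solveProg s s' ∧
      Ready s' G w k M ε z ∧ ∃ out, Shows s' k out ∧ IsTestAnswer G k z (scaled w σ) B out := by
  have hk1 : 1 ≤ k := by linarith [hF.hk]
  have hsum : ∀ d, pointSum n k (s.adj n) (s.rarr 0) (s.rarr 1) σ d =
      testSum G k z (scaled w σ) d := by
    intro d
    rw [← testSum_congr hk1 hR.pt]
    refine topSum_congr (D := d) hk1 (fun u hu v hv => ?_) (fun u hu v hv _ => .inl ?_)
      (fun _ _ _ _ => rfl) (fun _ _ _ _ => rfl) le_rfl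
    · rw [Store.adj, hR.adj]; exact inputStore_adj hu hv
    · rw [hR.wts, inputStore_weight hu hv, wtN, dif_pos ⟨hu, hv⟩]; rfl
  refine (solveProg_spec hF hnβ hs hR.hn hR.hk hR.hP hσ hB hB0).agree.mono le_rfl ?_
  rintro s' - ⟨hA, hres⟩
  refine ⟨hA, hR.of_agree hA (by decide) (by decide) (by decide) (by decide) (by decide)
    (by decide), ?_⟩
  simp only [hsum] at hres
  rcases hres with ⟨h12, p, hp, hlen, hnd, hch, hlt, dd, hdd, hpw, hne, hmin⟩ | ⟨h12, h0⟩
  · obtain ⟨P, rfl⟩ := exists_map_val hlt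
    have hadj : (P.map Fin.val).IsChain (adjN G) := by
      refine List.isChain_iff_getElem.2 fun i hi => ?_
      have h1 := List.isChain_iff_getElem.1 hch i hi
      rw [Store.adj, hR.adj] at h1
      exact (inputStore_adj (hlt _ (List.getElem_mem _)) (hlt _ (List.getElem_mem _))).1 h1
    have hpw' : pathWeight (scaled w σ) P = dd := by
      rw [← hpw, pathWeight, pathWeight, ← List.map_tail, List.zipWith_map]
      congr 2
      ext u v
      rw [hR.wts, inputStore_weight u.2 v.2]
      rfl
    refine ⟨some P, ⟨h12, hp.symm⟩, isKPath_of_map_val hlen hnd hadj, ?_⟩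
    rw [hpw']
    exact ⟨hdd, hne, hmin⟩
  · exact ⟨none, h12, h0⟩

end Main

/-! ### The run of the program -/

section

variable {ρ : ℕ → Bool} {β : ℕ} {s : Store} {n k D D' : ℕ} {G : Digraph (Fin n)}
  {w : Fin n → Fin n → ℝ} {M ε : ℝ} {z : ℕ → ℝ}

lemma Fits.mono (h : Fits β n k D) (hD : D' ≤ D) : Fits β n k D' :=
  ⟨h.hβ, h.hn, h.hk, lt_of_le_of_lt (by gcongr) h.hlt⟩

lemma solveBound_mono (hD : D' ≤ D) : solveBound β n k D' ≤ solveBound β n k D := by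
  unfold solveBound evalBound
  gcongr

lemma solveBound_pos : 1 ≤ solveBound β n k D := evalBound_pos.trans evalBound_le_solveBound

lemma Shows.some_iff {out : Option (List (Fin n))} (h : Shows s k out) :
    s.nvar 12 = 1 ↔ out.isSome := by
  cases out with
  | none => simp [show s.nvar 12 = 0 from h]
  | some P => simpa using h.1

lemma iterProg_spec {b : Bounds} (hk : 2 ≤ k) (hF : Fits β n k (9 * k)) (hnβ : n * n < 2 ^ β)
    (hs : s.Bdd β) (hR : Ready s G w k M ε z) (h2 : s.rvar 2 = b.L) (h3 : s.rvar 3 = b.U)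
    (hL : 0 < b.L) (hU : 2 * b.L < b.U) :
    Runs ρ β (solveBound β n k (9 * k)) iterProg s fun s' => Ready s' G w k M ε z ∧
      s'.rvar 2 = (loopStep (pointSubroutine (one_le_two.trans hk) G z) w k b).L ∧
      s'.rvar 3 = (loopStep (pointSubroutine (one_le_two.trans hk) G z) w k b).U := by
  have hβ := hF.hβ
  obtain ⟨h1, h4, h5⟩ := Bounds.X_div_le hL hU hk
  set σ : ℝ := b.δ * b.U / ((k : ℝ) - 1) with hσ
  have hfl : ⌊b.X / σ⌋₊ ≤ 9 * k := Nat.floor_le_of_le (by exact_mod_cast h5)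
  have hdiv : 0 ≤ b.L / b.U := (div_pos_and_lt_half hL hU).1.le
  refine Runs.seq (R := fun s' => (Ready s' G w k M ε z ∧ s'.rvar 2 = b.L ∧ s'.rvar 3 = b.U) ∧
    s'.rvar 8 = b.X ∧ s'.rvar 9 = b.δ * b.U ∧ s'.rvar 4 = σ ∧ s'.rvar 5 = b.X / σ) hβ
    ((Runs.of_wp hβ hs ?_).mono solveBound_pos fun _ _ h => h) ?_
  · simp +decide only [wp, RExp.eval_mul, RExp.eval_sqrt, RExp.eval_cbrt, RExp.eval_div,
      RExp.eval_sub, RExp.eval_var, RExp.eval_ofNat, NExp.eval_sub, NExp.eval_var, NExp.eval_const,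
      Store.setR_nvar, Store.setR_rvar, if_true, if_false, h2, h3, hR.hk, natCast_sub_one hk,
      max_eq_left hdiv]
    exact ⟨⟨⟨⟨hR.hn, hR.hk, by simpa using hR.hM, by simpa using hR.hε, hR.adj, hR.wts⟩, hR.hP, hR.pt⟩,
      trivial⟩, rfl, rfl, rfl, rfl⟩
  rintro s₁ hs₁ ⟨⟨hR₁, e2, e3⟩, e8, e9, e4, e5⟩
  refine Runs.seq hβ ((solveProg_spec' (hF.mono hfl) hnβ hs₁ hR₁ e4 e5 h4).mono
    (solveBound_mono hfl) fun _ _ h => h) ?_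
  rintro s₂ hs₂ ⟨hA, hR₂, out, hout, htest⟩
  have f2 : s₂.rvar 2 = b.L := (hA.r 2 (by decide)).trans e2
  have f3 : s₂.rvar 3 = b.U := (hA.r 3 (by decide)).trans e3
  have f8 : s₂.rvar 8 = b.X := (hA.r 8 (by decide)).trans e8
  have f9 : s₂.rvar 9 = b.δ * b.U := (hA.r 9 (by decide)).trans e9
  have hiff : s₂.nvar 12 = 1 ↔
      (pointSubroutine (one_le_two.trans hk) G z (scaled w σ) (b.X / σ)).isSome := by
    rw [hout.some_iff, htest.isSome_iff, (pointSubroutine_spec _ _ _ _ _).isSome_iff]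
  simp only [loopStep, ← hσ]
  refine Runs.ite hβ hs₂ solveBound_pos (fun h => ?_) fun h => ?_
  · rw [if_pos (hiff.1 h)]
    refine (Runs.of_wp hβ hs₂ ?_).mono solveBound_pos fun _ _ h => h
    simp only [wp, RExp.eval_add, RExp.eval_var, Store.setR_rvar, f8, f9]
    exact ⟨⟨⟨hR₂.hn, hR₂.hk, by simpa using hR₂.hM, by simpa using hR₂.hε, hR₂.adj, hR₂.wts⟩, hR₂.hP,
      hR₂.pt⟩,
      by simpa using f2, by simp⟩
  · rw [if_neg fun h' => h (hiff.2 h')]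
    refine (Runs.of_wp hβ hs₂ ?_).mono solveBound_pos fun _ _ h => h
    simp only [wp, RExp.eval_var, Store.setR_rvar, f8]
    exact ⟨⟨⟨hR₂.hn, hR₂.hk, by simpa using hR₂.hM, by simpa using hR₂.hε, hR₂.adj, hR₂.wts⟩, hR₂.hP,
      hR₂.pt⟩,
      by simp, by simpa using f3⟩

lemma finalProg_spec {b : Bounds} (hk : 2 ≤ k) (hF : Fits β n k ⌊2 * k * (1 / ε)⌋₊)
    (hnβ : n * n < 2 ^ β) (hs : s.Bdd β) (hR : Ready s G w k M ε z) (h2 : s.rvar 2 = b.L)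
    (h3 : s.rvar 3 = b.U) (hL : 0 < b.L) (hLU : b.L ≤ b.U) (hU : b.U ≤ 2 * b.L) (hε : 0 < ε) :
    Runs ρ β (solveBound β n k ⌊2 * k * (1 / ε)⌋₊) finalProg s fun s' => ∃ out, Displays s' k out ∧
      IsTestAnswer G k z (scaled w (ε * b.L / ((k : ℝ) - 1))) (b.U / (ε * b.L / ((k : ℝ) - 1)))
        out := by
  have hβ := hF.hβ
  obtain ⟨h1, h4, h5⟩ := Bounds.U_div_le hL hLU hU hk hε
  set σ : ℝ := ε * b.L / ((k : ℝ) - 1) with hσ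
  have hfl : ⌊b.U / σ⌋₊ ≤ ⌊2 * k * (1 / ε)⌋₊ := Nat.floor_le_floor h5
  refine Runs.seq (R := fun s' => Ready s' G w k M ε z ∧ s'.rvar 4 = σ ∧ s'.rvar 5 = b.U / σ) hβ
    ((Runs.of_wp hβ hs ?_).mono solveBound_pos fun _ _ h => h) ?_
  · simp +decide only [wp, RExp.eval_mul, RExp.eval_div, RExp.eval_var, RExp.eval_ofNat,
      NExp.eval_sub, NExp.eval_var, NExp.eval_const, Store.setR_rvar, if_true, if_false, h2,
      h3, hR.hk, hR.hε, natCast_sub_one hk]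
    exact ⟨⟨⟨hR.hn, hR.hk, by simpa using hR.hM, by simpa using hR.hε, hR.adj, hR.wts⟩, hR.hP, hR.pt⟩,
      rfl, rfl⟩
  rintro s₁ hs₁ ⟨hR₁, e4, e5⟩
  refine Runs.seq hβ ((solveProg_spec' (hF.mono hfl) hnβ hs₁ hR₁ e4 e5 h4).mono
    (solveBound_mono hfl) fun _ _ h => h) ?_
  rintro s₂ hs₂ ⟨hA, hR₂, out, hout, htest⟩
  refine (Runs.of_wp hβ hs₂ ?_).mono solveBound_pos fun _ _ h => h
  refine ⟨hs₂.1 12, out, ?_, htest⟩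
  cases out with
  | none => simpa [Displays, Shows] using hout
  | some P => simpa [Displays, Shows] using hout

lemma inputStore_bdd (hn : n < 2 ^ β) (hk : k < 2 ^ β) : (inputStore G w k M ε).Bdd β := by
  have h1 : 0 < 2 ^ β := by omega
  refine ⟨fun x => ?_, fun a i => ?_⟩
  · simp only [inputStore, Function.update_apply]
    split_ifs <;> assumption
  · simp only [inputStore, Function.update_apply]
    split_ifs
    · dsimp only
      split_ifs with h
      · have : n ≠ 0 := by rintro rfl; simp at h
        omega
      all_goals exact h1
    · exact h1

/-- A lower bound for the size of the set from which each coordinate of the random point is drawn.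
It is the number `T + 1` of calls times the bound `4 n k²` of the degrees, times `n ^ c`. -/
def drawRange (c n k T : ℕ) : ℕ := (T + 1) * (4 * n * k * k) * n ^ c

/-- For all random bits, the program runs like the algorithm with the subroutine that evaluates the
sums at the random point. -/
lemma mainProg_spec {c T : ℕ} (h : IsInstance G w k M ε) (h1 : ∀ i < T, 2 < M ^ ((2 / 3 : ℝ) ^ i))
    (h2 : M ^ ((2 / 3 : ℝ) ^ T) ≤ 2) (hF : Fits β n k (9 * k))
    (hF' : Fits β n k ⌊2 * k * (1 / ε)⌋₊) (hnβ : n * n < 2 ^ β)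
    (hRβ : 2 * drawRange c n k T < 2 ^ β) (hk : 1 ≤ k)
    (hz : z = randomPoint (Nat.clog 2 (drawRange c n k T)) ρ) :
    Runs ρ β (solveBound β n k (9 * k) * (T + 1) + solveBound β n k ⌊2 * k * (1 / ε)⌋₊) (mainProg c)
      (inputStore G w k M ε) fun s' => ∃ t out,
        LoopRuns (pointSubroutine hk G z) w k M t ∧ Displays s' k out ∧
        let b := bounds (pointSubroutine hk G z) w k M t
        IsTestAnswer G k z (scaled w (ε * b.L / ((k : ℝ) - 1)))
          (b.U / (ε * b.L / ((k : ℝ) - 1))) out := by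
  obtain ⟨hn1, hk2, hM1, hε, -⟩ := h
  have hβ := hF.hβ
  set N := solveBound β n k (9 * k) * (T + 1) + solveBound β n k ⌊2 * k * (1 / ε)⌋₊ with hN
  set R := drawRange c n k T with hR
  have hP : 2 ^ k < 2 ^ β := by
    refine lt_of_le_of_lt ?_ hF.hlt
    exact Nat.le_mul_of_pos_left _ (by positivity)
  have hkβ : k < 2 ^ β := lt_trans Nat.lt_two_pow_self hP
  have hnc : 1 ≤ n ^ c := Nat.one_le_pow _ _ hn1
  have hnk : 1 ≤ n * k := Nat.mul_pos hn1 hk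
  have hTR : T + 1 ≤ R := by
    rw [hR, drawRange, mul_assoc]
    exact Nat.le_mul_of_pos_right _ (by positivity)
  have hnkR : 2 * n * k ≤ 2 * R := by
    rw [hR, drawRange]
    calc 2 * n * k = 2 * (1 * (1 * n * k * 1) * 1) := by ring
      _ ≤ 2 * ((T + 1) * (4 * n * k * k) * n ^ c) := by gcongr <;> omega
  have hE : 2 * n * k + 1 ≤ evalBound n k (9 * k) := by
    rw [evalBound]
    have : 2 * n * k ≤ k * n * (9 * k + 1) * 2 ^ k := by
      calc 2 * n * k = k * n * 1 * 2 ^ 1 := by ring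
        _ ≤ k * n * (9 * k + 1) * 2 ^ k := by gcongr <;> omega
    exact (Nat.succ_le_succ this).trans (Nat.le_mul_of_pos_left _ (by positivity))
  have hS : (β + 1) * (2 * n * k + 1) ≤ solveBound β n k (9 * k) := by
    rw [solveBound, mul_comm (β + 1)]
    calc _ ≤ evalBound n k (9 * k) * (β + 1) := Nat.mul_le_mul_right _ hE
      _ ≤ _ := Nat.le_mul_of_pos_right _ (by omega)
  have hS1 : 1 ≤ solveBound β n k (9 * k) := solveBound_pos
  have hSN : solveBound β n k (9 * k) ≤ N :=
    (Nat.le_mul_of_pos_right _ (Nat.succ_pos T)).trans (Nat.le_add_right _ _)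
  have hTN : T + 1 ≤ N := (Nat.le_mul_of_pos_left _ hS1).trans (Nat.le_add_right _ _)
  have hkN : k + 1 ≤ N := by
    refine le_trans ?_ hSN
    rw [solveBound]
    exact Nat.le_mul_of_pos_left _ (Nat.mul_pos evalBound_pos (by omega))
  have hI₀ : HoldsInput (inputStore G w k M ε) G w k M ε :=
    ⟨by simp [inputStore], by simp [inputStore], by simp [inputStore], by simp [inputStore], rfl,
      rfl⟩
  refine Runs.seq (R := fun s' => HoldsInput s' G w k M ε ∧ s'.nvar 2 = 2 ^ k ∧ s'.coins = 0) hβ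
    ((powProg_spec hβ (inputStore_bdd hF.n_lt hkβ) hI₀.hk hP rfl).agree.mono hkN
      fun s' _ ⟨hA, h⟩ => ⟨hI₀.of_agree hA (by decide) (by decide) (by decide) (by decide), h⟩) ?_
  rintro s₁ hs₁ ⟨hI₁, hP₁, hc₁⟩
  refine Runs.seq (R := fun s' => (HoldsInput s' G w k M ε ∧ s'.nvar 2 = 2 ^ k) ∧
    s'.nvar 19 = T ∧ s'.coins = 0) hβ
    ((countProg_spec hβ hs₁ hI₁.hM hM1 h1 h2 (by omega) hc₁).agree.mono hTN
      fun s' _ ⟨hA, h⟩ => ⟨⟨hI₁.of_agree hA (by decide) (by decide) (by decide) (by decide),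
        (hA.n 2 (by decide)).trans hP₁⟩, h⟩) ?_
  rintro s₂ hs₂ ⟨⟨hI₂, hP₂⟩, hT₂, hc₂⟩
  refine Runs.seq (R := fun s' => (HoldsInput s' G w k M ε ∧ s'.nvar 2 = 2 ^ k) ∧
    s'.nvar 20 = R ∧ s'.coins = 0) hβ
    ((Runs.of_wp (Q := fun s' => s'.nvar 20 = R ∧ s'.coins = 0) hβ hs₂ ?_).agree.mono (by omega)
      fun s' _ ⟨hA, h⟩ => ⟨⟨hI₂.of_agree hA (by simp [Prog.nW]) (by simp [Prog.rW])
        (by simp [Prog.naW]) (by simp [Prog.raW]), (hA.n 2 (by simp [Prog.nW])).trans hP₂⟩, h⟩) ?_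
  · simp only [wp, NExp.eval_mul, NExp.eval_add, NExp.eval_var, NExp.eval_const, powExp_eval, hT₂,
      hI₂.hn, hI₂.hk, Store.setN_nvar, Store.setN_coins, hc₂, if_true, and_true]
    exact ⟨by change R < _; omega, rfl⟩
  rintro s₃ hs₃ ⟨⟨hI₃, hP₃⟩, hR₃, hc₃⟩
  refine Runs.seq (R := fun s' => Ready s' G w k M ε z) hβ
    ((drawProg_spec hβ hs₃ hI₃.hn hI₃.hk hR₃ hRβ (by omega) hc₃).agree.mono (hS.trans hSN)
      fun s' _ ⟨hA, h⟩ => ⟨hI₃.of_agree hA (by decide) (by decide) (by decide) (by decide),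
        (hA.n 2 (by decide)).trans hP₃, by rw [hz]; exact h⟩) ?_
  rintro s₄ hs₄ hR₄
  set 𝓑 := pointSubroutine hk G z with h𝓑
  refine Runs.seq (R := fun s' => Ready s' G w k M ε z ∧ s'.rvar 2 = (bounds 𝓑 w k M 0).L ∧
    s'.rvar 3 = (bounds 𝓑 w k M 0).U) hβ
    ((Runs.of_wp hβ hs₄ ?_).mono (by omega) fun _ _ h => h) ?_
  · simp +decide only [wp, RExp.eval_mul, RExp.eval_var, RExp.eval_ofNat, NExp.eval_sub,
      NExp.eval_var, NExp.eval_const, Store.setR_nvar, Store.setR_rvar, if_true, if_false, hR₄.hk,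
      natCast_sub_one hk2, hR₄.hM]
    exact ⟨⟨⟨hR₄.hn, hR₄.hk, by simpa using hR₄.hM, by simpa using hR₄.hε, hR₄.adj, hR₄.wts⟩, hR₄.hP,
      hR₄.pt⟩, rfl, rfl⟩
  rintro s₅ hs₅ hJ₅
  obtain ⟨t, htT, ht⟩ := exists_loopRuns hk2 hM1 𝓑 w h2
  refine Runs.seq (R := fun s' => Ready s' G w k M ε z ∧ s'.rvar 2 = (bounds 𝓑 w k M t).L ∧
    s'.rvar 3 = (bounds 𝓑 w k M t).U) hβ ?_ ?_
  · refine (Runs.loop (T := t) (fun i s' => Ready s' G w k M ε z ∧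
      s'.rvar 2 = (bounds 𝓑 w k M i).L ∧ s'.rvar 3 = (bounds 𝓑 w k M i).U) hβ hs₅ hS1 hJ₅
      ?_ ?_).mono ?_ fun _ _ h => h
    · rintro i hi s' hs' - ⟨hJ, e2, e3⟩
      exact ⟨by simpa [e2, e3] using ht.1 i hi, iterProg_spec hk2 hF hnβ hs' hJ e2 e3
        (ht.bounds_spec hk2 hM1 hi.le).1 (ht.1 i hi)⟩
    · rintro s' - - ⟨-, e2, e3⟩
      simpa [e2, e3] using ht.2
    · exact (Nat.mul_le_mul_left _ (by omega)).trans (Nat.le_add_right _ _)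
  rintro s₆ hs₆ ⟨hR₆, e2, e3⟩
  obtain ⟨hL, hLU⟩ := ht.bounds_spec hk2 hM1 le_rfl
  exact (finalProg_spec hk2 hF' hnβ hs₆ hR₆ e2 e3 hL hLU ht.2 hε).mono (Nat.le_add_left _ _)
    fun s' _ ⟨out, hd, ht'⟩ => ⟨t, out, ht, hd, ht'⟩

end

/-! ### The probability of success -/

section

section Exact

variable {V : Type*} {G : Digraph V} {w : V → V → ℝ} {𝓑 𝓑' : Subroutine V} {k t : ℕ} {M : ℝ}

lemma Subroutine.Exact.bounds_eq (h : 𝓑.Exact G k) (h' : 𝓑'.Exact G k) (i : ℕ) :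
    bounds 𝓑' w k M i = bounds 𝓑 w k M i :=
  bounds_congr (t := i) (fun _ _ => (h _ _).isSome_eq (h' _ _)) le_rfl

lemma LoopRuns.congr (h : LoopRuns 𝓑 w k M t) (hb : ∀ i ≤ t, bounds 𝓑' w k M i = bounds 𝓑 w k M i) :
    LoopRuns 𝓑' w k M t :=
  ⟨fun i hi => by rw [hb i hi.le]; exact h.1 i hi, by rw [hb t le_rfl]; exact h.2⟩

end Exact

variable {n k t : ℕ} {G : Digraph (Fin n)} {w : Fin n → Fin n → ℝ} {M ε : ℝ} {z : ℕ → ℝ}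
  {𝓑 : Subroutine (Fin n)}

/-- The correct answers to the problem that are answers of the algorithm for some exact
subroutine. -/
def IsExactOutput (G : Digraph (Fin n)) (w : Fin n → Fin n → ℝ) (k : ℕ) (M ε : ℝ)
    (out : Option (List (Fin n))) : Prop :=
  IsApproxAnswer G w k ε out ∧ ∃ 𝓑 : Subroutine (Fin n), 𝓑.Exact G k ∧ Returns 𝓑 w k M ε out

/-- An exact subroutine may be changed so that its answer to the last call is any given correct
answer; the bounds do not change. -/
lemma isExactOutput_of_isBoundedAnswer (h : IsInstance G w k M ε) (h𝓑 : 𝓑.Exact G k)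
    (ht : LoopRuns 𝓑 w k M t) {out : Option (List (Fin n))}
    (hout : let b := bounds 𝓑 w k M t; let s : ℝ := ε * b.L / ((k : ℝ) - 1)
      IsBoundedAnswer G k (scaled w s) (b.U / s) out) : IsExactOutput G w k M ε out := by
  classical
  set b := bounds 𝓑 w k M t with hb
  set s : ℝ := ε * b.L / ((k : ℝ) - 1) with hs
  let 𝓑' : Subroutine (Fin n) := fun w' B => if w' = scaled w s ∧ B = b.U / s then out else 𝓑 w' B
  have h𝓑' : 𝓑'.Exact G k := by
    intro w' B
    by_cases hw : w' = scaled w s ∧ B = b.U / s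
    · obtain ⟨rfl, rfl⟩ := hw
      simpa [𝓑'] using hout
    · simp only [𝓑', if_neg hw]
      exact h𝓑 w' B
  have heq := h𝓑.bounds_eq (w := w) (M := M) h𝓑'
  have ht' : LoopRuns 𝓑' w k M t := ht.congr fun i _ => heq i
  have hfin : finalAnswer 𝓑' w k M ε t = out := by
    simp [finalAnswer, heq, 𝓑', ← hb, ← hs]
  exact ⟨hfin ▸ finalAnswer_isApproxAnswer h h𝓑' ht', 𝓑', h𝓑', t, ht', hfin.symm⟩

/-- If the point detects the paths of minimum weight in all calls made with an exact subroutine,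
then the subroutine that evaluates the sums at the point leads to the same bounds. -/
lemma isExactOutput_of_detects (h : IsInstance G w k M ε) (hk : 1 ≤ k) (h𝓑 : 𝓑.Exact G k)
    (ht : LoopRuns 𝓑 w k M t)
    (hz : ∀ i < t, let b := bounds 𝓑 w k M i; Detects G k z (scaled w (b.δ * b.U / ((k : ℝ) - 1))))
    (hz' : Detects G k z (scaled w (ε * (bounds 𝓑 w k M t).L / ((k : ℝ) - 1)))) {t' : ℕ}
    {out : Option (List (Fin n))} (ht' : LoopRuns (pointSubroutine hk G z) w k M t')
    (hout : let b := bounds (pointSubroutine hk G z) w k M t'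
      IsTestAnswer G k z (scaled w (ε * b.L / ((k : ℝ) - 1))) (b.U / (ε * b.L / ((k : ℝ) - 1)))
        out) :
    IsExactOutput G w k M ε out := by
  obtain ⟨-, hk2, hM, hε, -⟩ := id h
  have heq : ∀ i ≤ t, bounds (pointSubroutine hk G z) w k M i = bounds 𝓑 w k M i := by
    refine fun i hi => bounds_congr (t := t) (fun j hj => (h𝓑 _ _).isSome_eq ?_) hi
    exact (pointSubroutine_spec hk G z _ _).isBoundedAnswer
      (Bounds.X_div_le (ht.bounds_spec hk2 hM hj.le).1 (ht.1 j hj) hk2).2.1 (hz j hj)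
  obtain rfl := (ht.congr heq).unique ht'
  rw [heq t le_rfl] at hout
  obtain ⟨hL, hLU⟩ := ht.bounds_spec hk2 hM le_rfl
  exact isExactOutput_of_isBoundedAnswer h h𝓑 ht
    (hout.isBoundedAnswer (Bounds.U_div_le hL hLU ht.2 hk2 hε).2.1 hz')

/-- The union bound is taken over the calls that are made with such a subroutine. -/
lemma exists_exact (G : Digraph (Fin n)) (k : ℕ) : ∃ 𝓑 : Subroutine (Fin n), 𝓑.Exact G k := by
  have : ∀ w' B, ∃ o, IsBoundedAnswer G k w' B o := by
    intro w' B
    by_cases h : ∃ Q, IsKPath G k Q ∧ ((pathWeight w' Q : ℕ) : ℝ) ≤ B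
    · obtain ⟨Q, hQ, hQB⟩ := h
      obtain ⟨P, hP, hmin⟩ := exists_min_isKPath w' hQ
      exact ⟨some P, hP, le_trans (by exact_mod_cast hmin Q hQ) hQB, hmin⟩
    · push Not at h
      exact ⟨none, h⟩
  choose 𝓑 h𝓑 using this
  exact ⟨𝓑, h𝓑⟩

/-- The union bound over all calls of the subroutine. -/
lemma le_coinMeasure_isExactOutput (h : IsInstance G w k M ε) (hk : 1 ≤ k) {T : ℕ}
    (hT : M ^ ((2 / 3 : ℝ) ^ T) ≤ 2) (c : ℕ) :
    ENNReal.ofReal (1 - 1 / (n : ℝ) ^ c) ≤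
      coinMeasure {ρ | ∀ t out, let z := randomPoint (Nat.clog 2 (drawRange c n k T)) ρ
        let b := bounds (pointSubroutine hk G z) w k M t
        LoopRuns (pointSubroutine hk G z) w k M t →
        IsTestAnswer G k z (scaled w (ε * b.L / ((k : ℝ) - 1)))
          (b.U / (ε * b.L / ((k : ℝ) - 1))) out → IsExactOutput G w k M ε out} := by
  obtain ⟨hn1, hk2, hM, hε, -⟩ := id h
  set m := Nat.clog 2 (drawRange c n k T) with hm
  set A := {ρ | _} with hA
  obtain ⟨𝓑, h𝓑⟩ := exists_exact G k
  obtain ⟨t, htT, ht⟩ := exists_loopRuns hk2 hM 𝓑 w hT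
  let W : ℕ → Fin n → Fin n → ℕ := fun i => if i < t then
    scaled w ((bounds 𝓑 w k M i).δ * (bounds 𝓑 w k M i).U / ((k : ℝ) - 1)) else
    scaled w (ε * (bounds 𝓑 w k M t).L / ((k : ℝ) - 1))
  have hsub : Aᶜ ⊆ ⋃ i ∈ Finset.range (t + 1), {ρ | ¬ Detects G k (randomPoint m ρ) (W i)} := by
    intro ρ hρ
    by_contra hn
    simp only [Finset.mem_range, Set.mem_iUnion, Set.mem_ofPred_eq, exists_prop, not_exists, not_and,
      not_not] at hn
    refine hρ fun t' out ht' hout => isExactOutput_of_detects h hk h𝓑 ht (fun i hi => ?_) ?_ ht' hout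
    · simpa [W, hi] using hn i (by omega)
    · simpa [W] using hn t (by omega)
  have hR : drawRange c n k T ≤ 2 ^ m := Nat.le_pow_clog (by norm_num) _
  have hbad : coinMeasure Aᶜ ≤ ENNReal.ofReal (1 / (n : ℝ) ^ c) := by
    have hn0 : (0 : ℝ) < n := by exact_mod_cast hn1
    calc coinMeasure Aᶜ
        ≤ ∑ i ∈ Finset.range (t + 1), coinMeasure {ρ | ¬ Detects G k (randomPoint m ρ) (W i)} :=
          (MeasureTheory.measure_mono hsub).trans (MeasureTheory.measure_biUnion_finset_le _ _)
      _ ≤ ∑ _i ∈ Finset.range (t + 1),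
          ((2 * n * k : ℕ) : ENNReal) * ((2 * k : ℕ) * (2 ^ m : ENNReal)⁻¹) :=
          Finset.sum_le_sum fun i _ => coinMeasure_not_detects_le hk m G (W i)
      _ = (((t + 1) * (4 * n * k * k) : ℕ) : ENNReal) / ((2 ^ m : ℕ) : ENNReal) := by
          rw [Finset.sum_const, Finset.card_range, nsmul_eq_mul, ENNReal.div_eq_inv_mul]
          push_cast
          ring
      _ ≤ ENNReal.ofReal (1 / (n : ℝ) ^ c) := by
          rw [← ENNReal.ofReal_natCast, ← ENNReal.ofReal_natCast,
            ← ENNReal.ofReal_div_of_pos (by positivity)]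
          refine ENNReal.ofReal_le_ofReal ?_
          rw [div_le_div_iff₀ (by positivity) (by positivity), one_mul]
          norm_cast
          refine le_trans ?_ hR
          rw [drawRange]
          gcongr
  rw [ENNReal.ofReal_sub _ (by positivity), ENNReal.ofReal_one, tsub_le_iff_right]
  calc (1 : ENNReal) = coinMeasure (A ∪ Aᶜ) := by rw [Set.union_compl_self, MeasureTheory.measure_univ]
    _ ≤ coinMeasure A + coinMeasure Aᶜ := MeasureTheory.measure_union_le _ _
    _ ≤ _ := by gcongr

end

/-! ### The matrix multiplication exponent is at least two -/

section Exponent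

variable {K : Type*} [Field K]

lemma matMulRankLE_cube (n : ℕ) : MatMulRankLE K n (n ^ 3) := by
  classical
  have e : Fin (n ^ 3) ≃ Fin n × Fin n × Fin n :=
    Fintype.equivOfCardEq (by simp; ring)
  refine ⟨fun t => Matrix.entryLinearMap K K (e t).1 (e t).2.1,
    fun t => Matrix.entryLinearMap K K (e t).2.1 (e t).2.2,
    fun t => Matrix.single (e t).1 (e t).2.2 1, fun A B => ?_⟩
  rw [e.sum_comp (fun x => (Matrix.entryLinearMap K K x.1 x.2.1 A *
    Matrix.entryLinearMap K K x.2.1 x.2.2 B) • Matrix.single x.1 x.2.2 (1 : K))]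
  ext i j
  simp [Fintype.sum_prod_type, Matrix.sum_apply, Matrix.mul_apply, Matrix.single_apply, ite_and]

/-- The products `A * 1` are all matrices, so the coefficient matrices span a space of dimension
`n ^ 2`. -/
lemma MatMulRankLE.sq_le {n r : ℕ} (h : MatMulRankLE K n r) : n ^ 2 ≤ r := by
  obtain ⟨f, g, C, h⟩ := h
  have hspan : Submodule.span K (Set.range C) = ⊤ := by
    refine eq_top_iff.2 fun A _ => ?_
    have := h A 1
    rw [mul_one] at this
    rw [this]
    exact Submodule.sum_mem _ fun t _ => Submodule.smul_mem _ _ (Submodule.subset_span ⟨t, rfl⟩)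
  have h1 := finrank_range_le_card (R := K) C
  rw [Set.finrank, hspan, finrank_top, Module.finrank_matrix] at h1
  simpa [sq] using h1

lemma two_le_matMulExponent : 2 ≤ matMulExponent K := by
  refine le_csInf ⟨3, 1, fun n _ => ⟨n ^ 3, matMulRankLE_cube n, ?_⟩⟩ ?_
  · rw [one_mul]
    exact_mod_cast le_rfl
  rintro τ ⟨c, hc⟩
  by_contra! hτ
  have hlim : Filter.Tendsto (fun n : ℕ => (n : ℝ) ^ (2 - τ)) Filter.atTop Filter.atTop :=
    (tendsto_rpow_atTop (by linarith)).comp tendsto_natCast_atTop_atTop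
  obtain ⟨n, hn, hn1⟩ := ((hlim.eventually_gt_atTop c).and (Filter.eventually_ge_atTop 1)).exists
  obtain ⟨r, hr, hrc⟩ := hc n hn1
  have hn0 : (0 : ℝ) < n := by exact_mod_cast hn1
  have h1 : (n : ℝ) ^ (2 : ℕ) ≤ r := by exact_mod_cast hr.sq_le
  have h2 : (n : ℝ) ^ (2 - τ) * (n : ℝ) ^ τ = (n : ℝ) ^ (2 : ℕ) := by
    rw [← Real.rpow_add hn0, ← Real.rpow_natCast]; norm_num
  have h3 : 0 < (n : ℝ) ^ τ := by positivity
  nlinarith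

end Exponent

/-! ### The running time -/

lemma exists_lt_two_pow {Y : ℝ} (hY : 1 ≤ Y) :
    ∃ β : ℕ, 1 ≤ β ∧ Y < 2 ^ β ∧ (β : ℝ) ≤ Real.log Y / Real.log 2 + 1 := by
  have h2 : 0 < Real.log 2 := Real.log_pos (by norm_num)
  have h0 : 0 ≤ Real.log Y / Real.log 2 := div_nonneg (Real.log_nonneg hY) h2.le
  refine ⟨⌊Real.log Y / Real.log 2⌋₊ + 1, by omega, ?_, ?_⟩
  · rw [← Real.rpow_natCast, ← Real.log_lt_log_iff (by linarith) (by positivity),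
      Real.log_rpow (by norm_num), ← div_lt_iff₀ h2]
    exact_mod_cast Nat.lt_floor_add_one _
  · push_cast
    linarith [Nat.floor_le h0]

lemma solveBound_le {β n k D : ℕ} {x : ℝ} (hβ : 1 ≤ β) (hn : 1 ≤ n) (hk : 2 ≤ k)
    (hD : (D : ℝ) + 1 ≤ x) :
    (solveBound β n k D : ℝ) ≤ 32 * ((n : ℝ) ^ 2 * (k : ℝ) ^ 3 * x * 2 ^ k * β) := by
  have h1 : 1 ≤ k * n * (D + 1) * 2 ^ k := Nat.one_le_iff_ne_zero.2 (by positivity)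
  have h2 : solveBound β n k D ≤ 32 * (n ^ 2 * k ^ 3 * (D + 1) * 2 ^ k * β) := by
    calc solveBound β n k D
        ≤ (2 * n) * (2 * k) * (2 * (k * n * (D + 1) * 2 ^ k)) * (2 * β) * (2 * k) := by
          unfold solveBound evalBound
          gcongr <;> omega
      _ = _ := by ring
  calc (solveBound β n k D : ℝ) ≤ 32 * ((n : ℝ) ^ 2 * (k : ℝ) ^ 3 * (D + 1) * 2 ^ k * β) := by
        exact_mod_cast h2
    _ ≤ _ := by gcongr

/-- The running time, with `β` of the order of `log (2 + F)`. -/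
lemma exists_time_bound (c κ : ℕ) {ω C₀ : ℝ} (hω : 2 ≤ ω) (hC₀ : 0 ≤ C₀) : ∃ C : ℝ,
    ∀ (n k T : ℕ) (l e F : ℝ), 1 ≤ n → 2 ≤ k → 1 ≤ l → 0 < e → (T : ℝ) ≤ C₀ * l →
      F = 2 ^ k * (k : ℝ) ^ 4 * (n : ℝ) ^ ω * (l + e) →
      ∃ β : ℕ, Fits β n k (9 * k) ∧ Fits β n k ⌊2 * k * e⌋₊ ∧ n * n < 2 ^ β ∧
        2 * drawRange c n k T < 2 ^ β ∧
        ((κ * (solveBound β n k (9 * k) * (T + 1) + solveBound β n k ⌊2 * k * e⌋₊) * β ^ 2 : ℕ) : ℝ) ≤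
          C * F * Real.log (2 + F) ^ 3 := by
  set C₃ : ℝ := 10 + 8 * (C₀ + 1) with hC₃
  set C₂ : ℝ := (Real.log C₃ + (c + 1)) / Real.log 2 + 1 with hC₂
  set C₁ : ℝ := 320 * (C₀ + 1) + 64 with hC₁
  refine ⟨κ * C₁ * C₂ ^ 3, fun n k T l e F hn hk hl he hT hF => ?_⟩
  have hn' : (1 : ℝ) ≤ n := by exact_mod_cast hn
  have hk' : (2 : ℝ) ≤ k := by exact_mod_cast hk
  have hx : 1 ≤ l + e := by linarith
  have hP : (1 : ℝ) ≤ 2 ^ k := one_le_pow₀ (by norm_num)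
  have hnω : (n : ℝ) ^ 2 ≤ (n : ℝ) ^ ω := by
    rw [← Real.rpow_natCast]
    exact Real.rpow_le_rpow_of_exponent_le hn' (by exact_mod_cast hω)
  have hT1 : (T : ℝ) + 1 ≤ (C₀ + 1) * l := by nlinarith
  -- `E` is `F` with the exponent `2` in place of `ω`
  set E : ℝ := 2 ^ k * (k : ℝ) ^ 4 * (n : ℝ) ^ 2 * (l + e) with hE
  have hEF : E ≤ F := by
    rw [hF, hE]
    gcongr
  have hk1 : (1 : ℝ) ≤ k := by linarith
  have hn2 : (n : ℝ) ≤ (n : ℝ) ^ 2 := by nlinarith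
  have hD : ((⌊2 * k * e⌋₊ : ℕ) : ℝ) + 1 ≤ 2 * k * (l + e) := by
    have := Nat.floor_le (show 0 ≤ 2 * k * e by positivity)
    nlinarith
  have hD9 : ((9 * k : ℕ) : ℝ) + 1 ≤ 10 * k := by push_cast; linarith
  have hnE : (n : ℝ) ^ 2 ≤ E := by
    calc (n : ℝ) ^ 2 = 1 * 1 * (n : ℝ) ^ 2 * 1 := by ring
      _ ≤ E := by
        rw [hE]
        gcongr
        exact one_le_pow₀ (by linarith)
  have hF1 : 1 ≤ F := le_trans (by nlinarith) (hnE.trans hEF)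
  -- the numbers that have to fit into `β` bits
  set Y : ℝ := C₃ * (2 + F) ^ (c + 1) with hY
  have hC₃1 : 10 ≤ C₃ := by linarith
  have hpow : F ≤ (2 + F) ^ (c + 1) :=
    calc F ≤ (2 + F) ^ 1 := by linarith
      _ ≤ _ := pow_le_pow_right₀ (by linarith) (by omega)
  have hY10 : 10 * F ≤ Y := by
    rw [hY]
    gcongr
  obtain ⟨β, hβ1, hβY, hβ⟩ := exists_lt_two_pow (show 1 ≤ Y by linarith)
  have hlt : ∀ m : ℕ, (m : ℝ) ≤ Y → m < 2 ^ β := fun m hm => by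
    have := hm.trans_lt hβY
    exact_mod_cast this
  have hlog : 1 ≤ Real.log (2 + F) := by
    rw [Real.le_log_iff_exp_le (by linarith)]
    linarith [Real.exp_one_lt_d9]
  have hβ' : (β : ℝ) ≤ C₂ * Real.log (2 + F) := by
    have h2 : 0 < Real.log 2 := Real.log_pos (by norm_num)
    have h3 : 0 ≤ Real.log C₃ := Real.log_nonneg (by linarith)
    rw [hY, Real.log_mul (by linarith) (by positivity), Real.log_pow] at hβ
    refine hβ.trans ?_
    rw [hC₂, add_mul, one_mul]
    gcongr
    rw [div_mul_eq_mul_div]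
    gcongr
    push_cast
    nlinarith
  refine ⟨β, ⟨hβ1, hn, hk, hlt _ ?_⟩, ⟨hβ1, hn, hk, hlt _ ?_⟩, hlt _ ?_, hlt _ ?_, ?_⟩
  · refine le_trans ?_ hY10
    push_cast at hD9 ⊢
    calc (k : ℝ) * n * (9 * k + 1) * 2 ^ k ≤ k * (n : ℝ) ^ 2 * (10 * k) * 2 ^ k := by gcongr
      _ = 10 * (2 ^ k * (k : ℝ) ^ 2 * (n : ℝ) ^ 2 * 1) := by ring
      _ ≤ 10 * E := by rw [hE]; gcongr; norm_num
      _ ≤ 10 * F := by linarith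
  · refine le_trans ?_ hY10
    push_cast
    calc (k : ℝ) * n * (⌊2 * k * e⌋₊ + 1) * 2 ^ k ≤ k * (n : ℝ) ^ 2 * (2 * k * (l + e)) * 2 ^ k := by
          gcongr
      _ = 2 * (2 ^ k * (k : ℝ) ^ 2 * (n : ℝ) ^ 2 * (l + e)) := by ring
      _ ≤ 2 * E := by rw [hE]; gcongr; norm_num
      _ ≤ 10 * F := by linarith
  · push_cast
    nlinarith
  · have hnF : (n : ℝ) ≤ 2 + F := by linarith
    rw [drawRange]
    push_cast
    calc 2 * (((T : ℝ) + 1) * (4 * n * k * k) * (n : ℝ) ^ c)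
        ≤ 2 * ((C₀ + 1) * l * (4 * (n : ℝ) ^ 2 * k * k) * (2 + F) ^ c) := by gcongr
      _ = 8 * (C₀ + 1) * (1 * (k : ℝ) ^ 2 * (n : ℝ) ^ 2 * l) * (2 + F) ^ c := by ring
      _ ≤ 8 * (C₀ + 1) * E * (2 + F) ^ c := by
          rw [hE]
          gcongr
          · norm_num
          · linarith
      _ ≤ C₃ * (2 + F) * (2 + F) ^ c := by gcongr <;> linarith
      _ = Y := by rw [hY]; ring
  · have h1 : (solveBound β n k (9 * k) : ℝ) * (T + 1) ≤ 320 * (C₀ + 1) * (E * β) := by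
      calc _ ≤ 32 * ((n : ℝ) ^ 2 * (k : ℝ) ^ 3 * (10 * k) * 2 ^ k * β) * ((C₀ + 1) * l) :=
            mul_le_mul (solveBound_le hβ1 hn hk hD9) hT1 (by positivity) (by positivity)
        _ = 320 * (C₀ + 1) * (2 ^ k * (k : ℝ) ^ 4 * (n : ℝ) ^ 2 * l * β) := by ring
        _ ≤ _ := by rw [hE]; gcongr; linarith
    have h2 : (solveBound β n k ⌊2 * k * e⌋₊ : ℝ) ≤ 64 * (E * β) :=
      (solveBound_le hβ1 hn hk hD).trans_eq (by rw [hE]; ring)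
    have h3 : (β : ℝ) ^ 3 ≤ (C₂ * Real.log (2 + F)) ^ 3 := by gcongr
    have hC₁0 : 0 ≤ κ * C₁ := by positivity
    push_cast
    calc (κ : ℝ) * (solveBound β n k (9 * k) * (T + 1) + solveBound β n k ⌊2 * k * e⌋₊) * (β : ℝ) ^ 2
        ≤ κ * (C₁ * (E * β)) * (β : ℝ) ^ 2 := by
          have : (solveBound β n k (9 * k) : ℝ) * (T + 1) + solveBound β n k ⌊2 * k * e⌋₊ ≤
              C₁ * (E * β) := by
            rw [hC₁]
            linarith
          gcongr
      _ = κ * C₁ * E * (β : ℝ) ^ 3 := by ring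
      _ ≤ κ * C₁ * F * (C₂ * Real.log (2 + F)) ^ 3 :=
        mul_le_mul (mul_le_mul_of_nonneg_left hEF hC₁0) h3 (by positivity)
          (mul_nonneg hC₁0 (by linarith))
      _ = _ := by ring

/-- The number of iterations that the program counts. -/
lemma exists_count {M : ℝ} {B : ℕ} (h : M ^ ((2 / 3 : ℝ) ^ B) ≤ 2) :
    ∃ T ≤ B, (∀ i < T, 2 < M ^ ((2 / 3 : ℝ) ^ i)) ∧ M ^ ((2 / 3 : ℝ) ^ T) ≤ 2 := by
  classical
  have hex : ∃ T : ℕ, M ^ ((2 / 3 : ℝ) ^ T) ≤ 2 := ⟨B, h⟩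
  exact ⟨Nat.find hex, Nat.find_min' hex h, fun i hi => not_le.1 (Nat.find_min hex hi),
    Nat.find_spec hex⟩

end KPath

theorem mainTheorem2 :
    -- the main loop and the approximation guarantee
    (∃ C : ℝ, ∀ (n : ℕ) (G : Digraph (Fin n)) (w : Fin n → Fin n → ℝ) (k : ℕ) (M ε : ℝ),
      KPath.IsInstance G w k M ε → ∀ 𝓑 : KPath.Subroutine (Fin n),
      ∃ t : ℕ, KPath.LoopRuns 𝓑 w k M t ∧ (t : ℝ) ≤ C * KPath.logLog M ∧
        (∀ i < t,
          (KPath.bounds 𝓑 w k M (i + 1)).U / (KPath.bounds 𝓑 w k M (i + 1)).L ≤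
            ((KPath.bounds 𝓑 w k M i).U / (KPath.bounds 𝓑 w k M i).L) ^ (2 / 3 : ℝ)) ∧
        (𝓑.Exact G k →
          (∀ P, KPath.IsMinKPath G w k P → ∀ i ≤ t,
            (KPath.bounds 𝓑 w k M i).L ≤ KPath.pathWeight w P ∧
              KPath.pathWeight w P ≤ (KPath.bounds 𝓑 w k M i).U) ∧
          KPath.IsApproxAnswer G w k ε (KPath.finalAnswer 𝓑 w k M ε t))) ∧
    -- the randomized implementation and its running time
    (∀ (K : Type*) [Field K] (c : ℕ), ∃ (p : KPath.Prog) (C : ℝ) (a d : ℕ),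
      ∀ (n : ℕ) (G : Digraph (Fin n)) (w : Fin n → Fin n → ℝ) (k : ℕ) (M ε : ℝ),
      KPath.IsInstance G w k M ε →
        (∀ F : ℝ,
          F = 2 ^ k * (k : ℝ) ^ a * (n : ℝ) ^ KPath.matMulExponent K * (KPath.logLog M + 1 / ε) →
          ∀ ρ : ℕ → Bool, ∃ s t, KPath.Exec ρ p (KPath.inputStore G w k M ε) s t ∧
            (t : ℝ) ≤ C * F * Real.log (2 + F) ^ d) ∧
        ENNReal.ofReal (1 - 1 / (n : ℝ) ^ c) ≤
          KPath.coinMeasure {ρ | ∃ s t out,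
            KPath.Exec ρ p (KPath.inputStore G w k M ε) s t ∧ KPath.Displays s k out ∧
            KPath.IsApproxAnswer G w k ε out ∧
            ∃ 𝓑 : KPath.Subroutine (Fin n), 𝓑.Exact G k ∧ KPath.Returns 𝓑 w k M ε out}) := by
  obtain ⟨C₀, hC₀, hiter⟩ := KPath.exists_iterations_bound
  refine ⟨⟨C₀, fun n G w k M ε h 𝓑 => ?_⟩, fun K _ c => ?_⟩
  · obtain ⟨-, hk, hM, -, hw⟩ := id h
    obtain ⟨T, hT, hMT⟩ := hiter M hM
    obtain ⟨t, htT, ht⟩ := KPath.exists_loopRuns hk hM 𝓑 w hMT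
    refine ⟨t, ht, le_trans (by exact_mod_cast htT) hT, fun i hi => ?_, fun h𝓑 =>
      ⟨fun P hP i hi => KPath.bounds_contain_opt hk hM hw h𝓑 hP ht hi,
        KPath.finalAnswer_isApproxAnswer h h𝓑 ht⟩⟩
    exact (KPath.loopStep_spec 𝓑 w k (ht.bounds_spec hk hM hi.le).1 (ht.1 i hi)).2.2
  · obtain ⟨C, hC⟩ := KPath.exists_time_bound c (KPath.mainProg c).kc
      (KPath.two_le_matMulExponent (K := K)) hC₀
    refine ⟨KPath.mainProg c, C, 4, 3, fun n G w k M ε h => ?_⟩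
    obtain ⟨hn, hk, hM, hε, -⟩ := id h
    obtain ⟨B, hB, hMB⟩ := hiter M hM
    obtain ⟨T, hTB, hT, hMT⟩ := KPath.exists_count hMB
    obtain ⟨β, hF, hF', hnβ, hRβ, htime⟩ := hC n k T (KPath.logLog M) (1 / ε) _ hn hk
      (le_max_left _ _) (by positivity) (le_trans (by exact_mod_cast hTB) hB) rfl
    have hk1 : 1 ≤ k := by omega
    refine ⟨fun F hFeq ρ => ?_, ?_⟩
    · obtain ⟨-, s, t, hexec, ht, -⟩ :=
        KPath.mainProg_spec (ρ := ρ) h hT hMT hF hF' hnβ hRβ hk1 rfl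
      refine ⟨s, t, hexec, ?_⟩
      rw [hFeq]
      exact le_trans (by exact_mod_cast ht) htime
    · refine (KPath.le_coinMeasure_isExactOutput h hk1 hMT c).trans
        (MeasureTheory.measure_mono fun ρ hρ => ?_)
      obtain ⟨-, s, t, hexec, -, -, t', out, hloop, hdisp, htest⟩ :=
        KPath.mainProg_spec (ρ := ρ) h hT hMT hF hF' hnβ hRβ hk1 rfl
      exact ⟨s, t, out, hexec, hdisp, hρ t' out hloop htest⟩
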